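/- Let $n\ge 3$, let $(M,g)$ be a smooth $n$-dimensional Riemannian manifold (without boundary) with nonnegative scalar curvature, and let $\Sigma$ be a smooth closed (that is, nonempty, compact and without boundary) hypersurface immersed in $M$, in particular possibly embedded, with smooth unit normal field $\nu$. Let $g_\Sigma$ be the induced metric, $\mu$ its Riemannian measure, $|\Sigma|=\mu(\Sigma)$, $\mathrm{Sc}^\Sigma$ its scalar curvature and $\Delta^\Sigma$ its Laplace--Beltrami operator. Let $B=g(\nabla_\cdot\,\nu,\cdot)$ be the second fundamental form, $H=\mathrm{tr}_{g_\Sigma}B$ the mean curvature, and $\mathring B=B-\frac{H}{n-1}g_\Sigma$. Suppose that $H>0$ on $\Sigma$ and that $\Sigma$ is an area-constrained Willmore hypersurface with Lagrange parameter $\lambda\in\mathbb R$, that is, $$0=\lambda H+\Delta^\Sigma H-\frac{n-3}{2(n-1)}H^3+H|\mathring B|^2+H\,\mathrm{Ric}^M(\nu,\nu)\quad\text{on }\Sigma .$$ Let $\omega_{n-1}$ be the area of the unit sphere in $\mathbb R^n$ and define $$\mathcal E_{n,1}(\Sigma)=\frac{1}{2(n-1)(n-2)\omega_{n-1}}\left(\frac{|\Sigma|}{\omega_{n-1}}\right)^{\frac1{n-1}}\int_\Sigma\left(\mathrm{Sc}^\Sigma-\frac{n-2}{n-1}H^2\right)d\mu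 ,$$ $$\mathcal E_{n,2}(\Sigma)=\frac12\left(\frac{|\Sigma|}{\omega_{n-1}}\right)^{\frac{n-2}{n-1}}\left(1-\frac{1}{(n-1)^2\omega_{n-1}}\left(\frac{\omega_{n-1}}{|\Sigma|}\right)^{\frac{n-3}{n-1}}\int_\Sigma H^2\,d\mu\right).$$ 1. If $\displaystyle \lambda\ge\frac{n-3}{2(n-2)|\Sigma|}\int_\Sigma \mathrm{Sc}^\Sigma\,d\mu$, then $\mathcal E_{n,1}(\Sigma)\ge 0$; if the inequality for $\lambda$ is strict, then $\mathcal E_{n,1}(\Sigma)>0$. 2. If $\displaystyle \lambda\ge\frac{1}{2|\Sigma|}\int_\Sigma \mathrm{Sc}^\Sigma\,d\mu-\frac{n-1}{2}\left(\frac{\omega_{n-1}}{|\Sigma|}\right)^{\frac{2}{n-1}}$, then $\mathcal E_{n,2}(\Sigma)\ge 0$; if the inequality for $\lambda$ is strict, then $\mathcal E_{n,2}(\Sigma)>0$. -/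

import Mathlib

open scoped Manifold ContDiff

noncomputable section

namespace Willmore

/-! ### Riemannian geometry in coordinates -/

/-- The coordinate space `ℝᵐ`. -/
abbrev Coord (m : ℕ) : Type := EuclideanSpace ℝ (Fin m)

/-- The `i`-th standard basis vector of `ℝᵐ`. -/
def basisVec {m : ℕ} (i : Fin m) : Coord m := EuclideanSpace.single i 1

/-- The partial derivative `∂ᵢ f`. -/
def pd {m : ℕ} (i : Fin m) (f : Coord m → ℝ) (x : Coord m) : ℝ :=
  fderiv ℝ f x (basisVec i)

/-- The Christoffel symbol
`Γᵏᵢⱼ = ½ gᵏˡ (∂ᵢ gⱼₗ + ∂ⱼ gᵢₗ - ∂ₗ gᵢⱼ)` of a metric with components `g`. -/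
def christoffel {m : ℕ} (g : Coord m → Matrix (Fin m) (Fin m) ℝ) (k i j : Fin m)
    (x : Coord m) : ℝ :=
  (1 / 2) * ∑ l, (g x)⁻¹ k l *
    (pd i (fun y => g y j l) x + pd j (fun y => g y i l) x - pd l (fun y => g y i j) x)

/-- The components
`Ricᵢⱼ = ∂ₖ Γᵏᵢⱼ - ∂ᵢ Γᵏₖⱼ + Γᵏₖₗ Γˡᵢⱼ - Γᵏᵢₗ Γˡₖⱼ` (sums over `k`, `l`) of the Ricci tensor.
The sign is the one for which round spheres have positive Ricci curvature. -/
def ricciComp {m : ℕ} (g : Coord m → Matrix (Fin m) (Fin m) ℝ) (i j : Fin m)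
    (x : Coord m) : ℝ :=
  ∑ k, (pd k (christoffel g k i j) x - pd i (christoffel g k k j) x
    + ∑ l, (christoffel g k k l x * christoffel g l i j x
      - christoffel g k i l x * christoffel g l k j x))

/-- The scalar curvature `gⁱʲ Ricᵢⱼ`. -/
def scalarComp {m : ℕ} (g : Coord m → Matrix (Fin m) (Fin m) ℝ) (x : Coord m) : ℝ :=
  ∑ i, ∑ j, (g x)⁻¹ i j * ricciComp g i j x

/-- The Laplace-Beltrami operator `gⁱʲ (∂ᵢ ∂ⱼ f - Γᵏᵢⱼ ∂ₖ f)`. -/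
def laplaceComp {m : ℕ} (g : Coord m → Matrix (Fin m) (Fin m) ℝ) (f : Coord m → ℝ)
    (x : Coord m) : ℝ :=
  ∑ i, ∑ j, (g x)⁻¹ i j * (pd i (pd j f) x - ∑ k, christoffel g k i j x * pd k f x)

/-! ### Riemannian geometry on a manifold

All the quantities below are computed at a point `p` in the preferred chart at `p`; for a smooth
metric they do not depend on the chart. -/

section Manifold

variable {m : ℕ} {X : Type*} [TopologicalSpace X] [ChartedSpace (Coord m) X]

variable (X) in
/-- A field of forms in two variables on the tangent spaces of `X`. It is only used for Riemannian
metrics and their pullbacks. -/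
abbrev BilinField : Type _ :=
  (p : X) → TangentSpace (𝓡 m) p → TangentSpace (𝓡 m) p → ℝ

/-- The field of inner products of a smooth Riemannian metric. -/
def metricField [IsManifold (𝓡 m) ∞ X]
    (g : Bundle.ContMDiffRiemannianMetric (𝓡 m) ∞ (Coord m)
      (fun x : X => TangentSpace (𝓡 m) x)) : BilinField (m := m) X :=
  fun p v w => g.inner p v w

/-- The coordinate vector field `∂ᵢ` of the preferred chart at `p`, at the point with
coordinates `y`. -/
def coordField (p : X) (i : Fin m) (y : Coord m) :
    TangentSpace (𝓡 m) ((extChartAt (𝓡 m) p).symm y) :=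
  mfderiv (𝓡 m) (𝓡 m) (extChartAt (𝓡 m) p).symm y (basisVec i)

/-- The components `gᵢⱼ = g(∂ᵢ, ∂ⱼ)` in the preferred chart at `p`, as functions of the
coordinates. -/
def metricComp (g : BilinField (m := m) X) (p : X) (y : Coord m) : Matrix (Fin m) (Fin m) ℝ :=
  Matrix.of fun i j => g ((extChartAt (𝓡 m) p).symm y) (coordField p i y) (coordField p j y)

/-- The components of a tangent vector at `p` in the preferred chart at `p`. -/
def vecComp (p : X) (v : TangentSpace (𝓡 m) p) : Coord m :=
  mfderiv (𝓡 m) (𝓡 m) (extChartAt (𝓡 m) p) p v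

/-- The Ricci curvature `Ric(v, w)` at `p`. -/
def ricci (g : BilinField (m := m) X) (p : X) (v w : TangentSpace (𝓡 m) p) : ℝ :=
  ∑ i, ∑ j, ricciComp (metricComp g p) i j (extChartAt (𝓡 m) p p) * vecComp p v i * vecComp p w j

/-- The scalar curvature at `p`. -/
def scalarCurvature (g : BilinField (m := m) X) (p : X) : ℝ :=
  scalarComp (metricComp g p) (extChartAt (𝓡 m) p p)

/-- The Laplace-Beltrami operator applied to `f`, at `p`. -/
def laplaceBeltrami (g : BilinField (m := m) X) (f : X → ℝ) (p : X) : ℝ :=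
  laplaceComp (metricComp g p) (f ∘ (extChartAt (𝓡 m) p).symm) (extChartAt (𝓡 m) p p)

/-- The measure `√(det gᵢⱼ) dy` on the domain of the preferred chart at `p`, as a measure on `X`
(zero outside of that domain). -/
def chartVolume [MeasurableSpace X] (g : BilinField (m := m) X) (p : X) :
    MeasureTheory.Measure X :=
  ((MeasureTheory.volume.restrict (extChartAt (𝓡 m) p).target).withDensity
    fun y => ENNReal.ofReal (Real.sqrt (metricComp g p y).det)).map (extChartAt (𝓡 m) p).symm

/-- The Riemannian volume measure. The measures `√(det gᵢⱼ) dy` of any two charts agree where both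
charts are defined, so their supremum is the measure which restricts to `√(det gᵢⱼ) dy` on the
domain of every chart. -/
def riemannianVolume [MeasurableSpace X] (g : BilinField (m := m) X) : MeasureTheory.Measure X :=
  ⨆ p : X, chartVolume g p

end Manifold

/-! ### Hypersurfaces

A hypersurface of an `n`-dimensional manifold `M` is given by an immersion `ι : S → M` of a
manifold `S` of dimension `n - 1`, with a field `ν` of unit normal vectors along `ι`. -/

section Hypersurface

variable {n : ℕ}
  {M : Type*} [TopologicalSpace M] [ChartedSpace (Coord n) M]
  {S : Type*} [TopologicalSpace S] [ChartedSpace (Coord (n - 1)) S]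

/-- The induced metric `ι^* g`. -/
def inducedMetric (g : BilinField (m := n) M) (ι : S → M) : BilinField (m := n - 1) S :=
  fun p v w => g (ι p) (mfderiv (𝓡 (n - 1)) (𝓡 n) ι p v) (mfderiv (𝓡 (n - 1)) (𝓡 n) ι p w)

variable (n) in
/-- `ι` is a smooth immersion. -/
def IsSmoothImmersion (ι : S → M) : Prop :=
  ContMDiff (𝓡 (n - 1)) (𝓡 n) ∞ ι ∧
    ∀ p, Function.Injective (mfderiv (𝓡 (n - 1)) (𝓡 n) ι p)

/-- `ν` is a smooth field of unit normal vectors along `ι`. -/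
def IsUnitNormal [IsManifold (𝓡 n) ∞ M] (g : BilinField (m := n) M) (ι : S → M)
    (ν : (p : S) → TangentSpace (𝓡 n) (ι p)) : Prop :=
  ContMDiff (𝓡 (n - 1)) (𝓡 n).tangent ∞
      (fun p => (⟨ι p, ν p⟩ : TangentBundle (𝓡 n) M)) ∧
    (∀ p, g (ι p) (ν p) (ν p) = 1) ∧
    ∀ p v, g (ι p) (ν p) (mfderiv (𝓡 (n - 1)) (𝓡 n) ι p v) = 0

/-- The immersion `ι` in the preferred charts at `p` and at `ι p`. -/
def localRep (ι : S → M) (p : S) : Coord (n - 1) → Coord n :=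
  extChartAt (𝓡 n) (ι p) ∘ ι ∘ (extChartAt (𝓡 (n - 1)) p).symm

/-- The components `(∇_{∂ᵢ} ∂ⱼ F)ᵃ = ∂ᵢ∂ⱼ Fᵃ + Γᵃ_{cd}(F) ∂ᵢFᶜ ∂ⱼFᵈ` at `p` of the ambient covariant
derivative of the coordinate tangent vectors of the hypersurface, where `F` is the immersion in
coordinates. -/
def ambientHessian (g : BilinField (m := n) M) (ι : S → M) (p : S) (i j : Fin (n - 1)) :
    Coord n :=
  WithLp.toLp 2 fun a =>
    pd i (pd j fun y => localRep ι p y a) (extChartAt (𝓡 (n - 1)) p p)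
      + ∑ c, ∑ d, christoffel (metricComp g (ι p)) a c d (extChartAt (𝓡 n) (ι p) (ι p))
        * pd i (fun y => localRep ι p y c) (extChartAt (𝓡 (n - 1)) p p)
        * pd j (fun y => localRep ι p y d) (extChartAt (𝓡 (n - 1)) p p)

/-- The components `Bᵢⱼ = - g(∇_{∂ᵢ} ∂ⱼ, ν) = g(∇_{∂ᵢ} ν, ∂ⱼ)` at `p` of the second fundamental form.
A round sphere in Euclidean space with its outward normal has a positive second fundamental
form. -/
def secondFF (g : BilinField (m := n) M) (ι : S → M) (ν : (p : S) → TangentSpace (𝓡 n) (ι p))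
    (p : S) : Matrix (Fin (n - 1)) (Fin (n - 1)) ℝ :=
  Matrix.of fun i j => -∑ a, ∑ b, metricComp g (ι p) (extChartAt (𝓡 n) (ι p) (ι p)) a b
    * ambientHessian g ι p i j a * vecComp (ι p) (ν p) b

/-- The components at `p` of the induced metric. -/
def firstFF (g : BilinField (m := n) M) (ι : S → M) (p : S) :
    Matrix (Fin (n - 1)) (Fin (n - 1)) ℝ :=
  metricComp (inducedMetric g ι) p (extChartAt (𝓡 (n - 1)) p p)

/-- The mean curvature `H`, the trace of the second fundamental form. -/
def meanCurvature (g : BilinField (m := n) M) (ι : S → M)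
    (ν : (p : S) → TangentSpace (𝓡 n) (ι p)) (p : S) : ℝ :=
  ∑ i, ∑ j, (firstFF g ι p)⁻¹ i j * secondFF g ι ν p i j

/-- The traceless part `B - H / (n - 1) g_Σ` of the second fundamental form. -/
def tracelessFF (g : BilinField (m := n) M) (ι : S → M)
    (ν : (p : S) → TangentSpace (𝓡 n) (ι p)) (p : S) : Matrix (Fin (n - 1)) (Fin (n - 1)) ℝ :=
  secondFF g ι ν p - (meanCurvature g ι ν p / ((n : ℝ) - 1)) • firstFF g ι p

/-- The squared norm of the traceless part of the second fundamental form. -/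
def tracelessNormSq (g : BilinField (m := n) M) (ι : S → M)
    (ν : (p : S) → TangentSpace (𝓡 n) (ι p)) (p : S) : ℝ :=
  ∑ i, ∑ j, ∑ k, ∑ l, (firstFF g ι p)⁻¹ i k * (firstFF g ι p)⁻¹ j l
    * tracelessFF g ι ν p i j * tracelessFF g ι ν p k l

/-- The hypersurface is an area-constrained Willmore hypersurface with Lagrange parameter `lam`:
`0 = λ H + Δ H - (n - 3) / (2 (n - 1)) H³ + H |B°|² + H Ric(ν, ν)`. -/
def IsAreaConstrainedWillmore (g : BilinField (m := n) M) (ι : S → M)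
    (ν : (p : S) → TangentSpace (𝓡 n) (ι p)) (lam : ℝ) : Prop :=
  ∀ p : S, 0 = lam * meanCurvature g ι ν p
    + laplaceBeltrami (inducedMetric g ι) (meanCurvature g ι ν) p
    - ((n : ℝ) - 3) / (2 * ((n : ℝ) - 1)) * meanCurvature g ι ν p ^ 3
    + meanCurvature g ι ν p * tracelessNormSq g ι ν p
    + meanCurvature g ι ν p * ricci g (ι p) (ν p) (ν p)

/-- The area `ω_{n-1}` of the unit sphere in `ℝⁿ`. -/
def sphereArea (n : ℕ) : ℝ :=
  (MeasureTheory.volume : MeasureTheory.Measure (Coord n)).toSphere.real Set.univ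

variable [MeasurableSpace S]

/-- The area `|Σ|`. -/
def area (g : BilinField (m := n) M) (ι : S → M) : ℝ :=
  (riemannianVolume (inducedMetric g ι)).real Set.univ

/-- The total scalar curvature `∫_Σ Sc^Σ dμ`. -/
def totalScalar (g : BilinField (m := n) M) (ι : S → M) : ℝ :=
  ∫ p, scalarCurvature (inducedMetric g ι) p ∂riemannianVolume (inducedMetric g ι)

/-- The energy
`E_{n,1} = 1 / (2(n-1)(n-2)ω) (|Σ|/ω)^{1/(n-1)} ∫ (Sc^Σ - (n-2)/(n-1) H²) dμ`, `ω = ω_{n-1}`. -/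
def energyOne (g : BilinField (m := n) M) (ι : S → M)
    (ν : (p : S) → TangentSpace (𝓡 n) (ι p)) : ℝ :=
  1 / (2 * ((n : ℝ) - 1) * ((n : ℝ) - 2) * sphereArea n)
    * (area g ι / sphereArea n) ^ (1 / ((n : ℝ) - 1))
    * ∫ p, (scalarCurvature (inducedMetric g ι) p
        - ((n : ℝ) - 2) / ((n : ℝ) - 1) * meanCurvature g ι ν p ^ 2)
      ∂riemannianVolume (inducedMetric g ι)

/-- The energy
`E_{n,2} = ½ (|Σ|/ω)^{(n-2)/(n-1)} (1 - 1 / ((n-1)²ω) (ω/|Σ|)^{(n-3)/(n-1)} ∫ H² dμ)`,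
`ω = ω_{n-1}`. -/
def energyTwo (g : BilinField (m := n) M) (ι : S → M)
    (ν : (p : S) → TangentSpace (𝓡 n) (ι p)) : ℝ :=
  1 / 2 * (area g ι / sphereArea n) ^ (((n : ℝ) - 2) / ((n : ℝ) - 1))
    * (1 - 1 / (((n : ℝ) - 1) ^ 2 * sphereArea n)
      * (sphereArea n / area g ι) ^ (((n : ℝ) - 3) / ((n : ℝ) - 1))
      * ∫ p, meanCurvature g ι ν p ^ 2 ∂riemannianVolume (inducedMetric g ι))

end Hypersurface

end Willmore

end

open scoped Manifold ContDiff

noncomputable section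

namespace Willmore

open Filter Topology

/-! ### Partial derivatives -/

section PartialDerivatives

variable {m N : ℕ} {f g : Coord m → ℝ} {x : Coord m} {i j : Fin m}

/-! Divide the Willmore equation by H > 0. The curvature term becomes Ric(ν,ν), and the twice traced
Gauss equation expresses it through the two scalar curvatures, H² and |B°|². The coefficients of H²
add up to -1/(2(n-1)), so λ + ΔH/H = Sc^Σ/2 - H²/(2(n-1)) - Sc^M/2 - |B°|²/2, where the last two
terms are nonpositive. Moreover Δ log H = ΔH/H - |∇H|²/H² ≤ ΔH/H, and Δ log H integrates to zero
over the closed manifold Σ. Hence λ|Σ| ≤ ½∫Sc^Σ - (1/(2(n-1)))∫H², which is `lam_mul_area_le`. Each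
energy is a positive factor times a linear expression in ∫Sc^Σ, ∫H² and powers of |Σ|. Up to
positive factors this expression is the defect in the inequality plus the excess of λ over its
threshold, so both parts follow by algebra.

The pointwise inequality rests on `IsImmersionOn.scalarComp_pull`, the Gauss equation for a map F
between coordinate spaces. Its hypothesis on the normal space is the completeness relation J h⁻¹ Jᵀ
= g⁻¹ - ν ⊗ ν, with J the Jacobian of F and h the pulled back metric. For a hypersurface with unit
normal it is `proj_of_unit_normal`. For a transition map it holds with ν = 0, and the Gauss equation
then says that scalar curvature is invariant under changes of coordinates.

Such invariance is indispensable: every quantity at p is computed in the chart preferred at p, a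
chart that varies with p, so even continuity in p is not visible from the definitions.
`scalarCurvature_eq`, `laplaceBeltrami_eq` and `meanComp_rep_eq` allow one fixed chart near each
point. They give smoothness of H, hence of log H, and continuity of the integrands.

The divergence theorem is `integral_laplaceBeltrami`. It combines the divergence form of the
Laplacian in one chart (`IsMetricOn.setIntegral_laplaceComp`), the identification of the volume on a
chart domain (`riemannianVolume_restrict`) and a partition of unity. -/

theorem pd_congr (h : f =ᶠ[𝓝 x] g) : pd i f x = pd i g x := by
  simp only [pd, h.fderiv_eq]

theorem pd_eventuallyEq (h : f =ᶠ[𝓝 x] g) : pd i f =ᶠ[𝓝 x] pd i g :=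
  h.eventuallyEq_nhds.mono fun _ hy => pd_congr hy

theorem pd_add (hf : DifferentiableAt ℝ f x) (hg : DifferentiableAt ℝ g x) :
    pd i (fun y => f y + g y) x = pd i f x + pd i g x := by
  simp only [pd]; rw [fderiv_fun_add hf hg]; rfl

theorem pd_sub (hf : DifferentiableAt ℝ f x) (hg : DifferentiableAt ℝ g x) :
    pd i (fun y => f y - g y) x = pd i f x - pd i g x := by
  simp only [pd]; rw [fderiv_fun_sub hf hg]; rfl

theorem pd_mul (hf : DifferentiableAt ℝ f x) (hg : DifferentiableAt ℝ g x) :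
    pd i (fun y => f y * g y) x = pd i f x * g x + f x * pd i g x := by
  simp only [pd]; rw [fderiv_fun_mul hf hg]; simp; ring

theorem pd_const (c : ℝ) : pd i (fun _ => c) x = 0 := by simp [pd]

theorem pd_const_mul (c : ℝ) (hf : DifferentiableAt ℝ f x) :
    pd i (fun y => c * f y) x = c * pd i f x := by
  rw [pd_mul (differentiableAt_const c) hf, pd_const]; ring

theorem pd_sum {κ : Type*} {s : Finset κ} {F : κ → Coord m → ℝ}
    (hF : ∀ k ∈ s, DifferentiableAt ℝ (F k) x) :
    pd i (fun y => ∑ k ∈ s, F k y) x = ∑ k ∈ s, pd i (F k) x := by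
  simp only [pd]; rw [fderiv_fun_sum hF]; simp

theorem pd_contDiffAt (hf : ContDiffAt ℝ ∞ f x) : ContDiffAt ℝ ∞ (pd i f) x :=
  (hf.fderiv_right (m := ∞) (by simp)).clm_apply contDiffAt_const

theorem pd_comm (hf : ContDiffAt ℝ ∞ f x) : pd i (pd j f) x = pd j (pd i f) x := by
  have hs : IsSymmSndFDerivAt ℝ f x := hf.isSymmSndFDerivAt (by simp; exact WithTop.coe_le_coe.2 le_top)
  have hd : DifferentiableAt ℝ (fderiv ℝ f) x :=
    (hf.fderiv_right (m := ∞) (by simp)).differentiableAt (by simp)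
  have key : ∀ k l : Fin m, pd k (pd l f) x = fderiv ℝ (fderiv ℝ f) x (basisVec k) (basisVec l) := by
    intro k l
    simp only [pd]
    have : fderiv ℝ (fun y => fderiv ℝ f y (basisVec l)) x
        = (fderiv ℝ (fderiv ℝ f) x).flip (basisVec l) := by
      rw [fderiv_clm_apply hd (differentiableAt_const _)]; ext; simp
    change fderiv ℝ (fun y => fderiv ℝ f y (basisVec l)) x (basisVec k) = _
    rw [this]; rfl
  rw [key, key, hs.eq]

theorem sum_smul_basisVec (v : Coord m) : ∑ i, v i • basisVec i = v := by
  ext k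
  simp [basisVec, Pi.single_apply]

theorem fderiv_eq_sum_pd (f : Coord m → ℝ) (x v : Coord m) :
    fderiv ℝ f x v = ∑ i, pd i f x * v i := by
  conv_lhs => rw [← sum_smul_basisVec v]
  simp [pd, mul_comm]

theorem pd_comp {f : Coord N → ℝ} {F : Coord m → Coord N} (hf : DifferentiableAt ℝ f (F x))
    (hF : DifferentiableAt ℝ F x) :
    pd i (fun y => f (F y)) x = ∑ a, pd a f (F x) * pd i (fun y => F y a) x := by
  have h1 : fderiv ℝ (fun y => f (F y)) x = (fderiv ℝ f (F x)).comp (fderiv ℝ F x) :=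
    fderiv_comp x hf hF
  have h2 : ∀ a, pd i (fun y => F y a) x = fderiv ℝ F x (basisVec i) a := by
    intro a
    have : HasFDerivAt (fun y => F y a)
        ((EuclideanSpace.proj a : Coord N →L[ℝ] ℝ).comp (fderiv ℝ F x)) x :=
      (EuclideanSpace.proj a : Coord N →L[ℝ] ℝ).hasFDerivAt.comp x hF.hasFDerivAt
    simp only [pd]; rw [this.fderiv]; rfl
  simp only [h2]
  rw [← fderiv_eq_sum_pd]
  simp only [pd]; rw [h1]; rfl

theorem contDiffAt_det {κ : Type*} [Fintype κ] [DecidableEq κ] {A : Coord m → Matrix κ κ ℝ}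
    (hA : ∀ i j, ContDiffAt ℝ ∞ (fun y => A y i j) x) :
    ContDiffAt ℝ ∞ (fun y => (A y).det) x := by
  simp only [Matrix.det_apply']
  exact ContDiffAt.sum fun σ _ => contDiffAt_const.mul (contDiffAt_prod fun k _ => hA _ _)

/-- By Cramer's rule each entry is a polynomial in the entries of the matrix divided by a
nonvanishing determinant. -/
theorem contDiffAt_inv_apply {κ : Type*} [Fintype κ] [DecidableEq κ] {A : Coord m → Matrix κ κ ℝ}
    (hA : ∀ i j, ContDiffAt ℝ ∞ (fun y => A y i j) x) (hx : (A x).det ≠ 0) (k l : κ) :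
    ContDiffAt ℝ ∞ (fun y => (A y)⁻¹ k l) x := by
  simp only [Matrix.inv_def, Ring.inverse_eq_inv', Matrix.smul_apply, smul_eq_mul,
    Matrix.adjugate_apply]
  refine ((contDiffAt_det hA).inv hx).mul (contDiffAt_det fun i j => ?_)
  simp only [Matrix.updateRow_apply]
  split_ifs
  · exact contDiffAt_const
  · exact hA i j

end PartialDerivatives

/-! ### Metrics in coordinates -/

section Metrics

variable {m N : ℕ}

/-- `g` is a smooth Riemannian metric on the open set `V` of the coordinate space. -/
structure IsMetricOn (g : Coord m → Matrix (Fin m) (Fin m) ℝ) (V : Set (Coord m)) : Prop where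
  isOpen : IsOpen V
  smooth : ∀ x ∈ V, ∀ a b, ContDiffAt ℝ ∞ (fun y => g y a b) x
  posDef : ∀ x ∈ V, (g x).PosDef

/-- The pairing `Aₐᵦ uᵃ vᵇ`. -/
def ip (A : Matrix (Fin m) (Fin m) ℝ) (u v : Fin m → ℝ) : ℝ := ∑ a, ∑ b, A a b * u a * v b

/-- The Christoffel symbol `½ (∂ᵢ gⱼₗ + ∂ⱼ gᵢₗ - ∂ₗ gᵢⱼ)` of the first kind. -/
def christoffelLow (g : Coord m → Matrix (Fin m) (Fin m) ℝ) (l i j : Fin m) (x : Coord m) : ℝ :=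
  (1 / 2) * (pd i (fun y => g y j l) x + pd j (fun y => g y i l) x - pd l (fun y => g y i j) x)

/-- The components `∂ₖ Γᵃᵢⱼ - ∂ᵢ Γᵃₖⱼ + Γᵃₖₗ Γˡᵢⱼ - Γᵃᵢₗ Γˡₖⱼ` of the curvature tensor. -/
def riemUp (g : Coord m → Matrix (Fin m) (Fin m) ℝ) (a k i j : Fin m) (x : Coord m) : ℝ :=
  pd k (christoffel g a i j) x - pd i (christoffel g a k j) x
    + ∑ l, (christoffel g a k l x * christoffel g l i j x
      - christoffel g a i l x * christoffel g l k j x)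

/-- The curvature tensor with its first index lowered. -/
def riemLow (g : Coord m → Matrix (Fin m) (Fin m) ℝ) (l k i j : Fin m) (x : Coord m) : ℝ :=
  ∑ a, g x l a * riemUp g a k i j x

theorem ricciComp_eq_sum_riemUp (g : Coord m → Matrix (Fin m) (Fin m) ℝ) (i j : Fin m)
    (x : Coord m) : ricciComp g i j x = ∑ k, riemUp g k k i j x := rfl

theorem christoffel_eq_sum_christoffelLow (g : Coord m → Matrix (Fin m) (Fin m) ℝ)
    (k i j : Fin m) (x : Coord m) :
    christoffel g k i j x = ∑ l, (g x)⁻¹ k l * christoffelLow g l i j x := by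
  simp only [christoffel, christoffelLow, Finset.mul_sum]
  exact Finset.sum_congr rfl fun _ _ => by ring

variable {g h : Coord m → Matrix (Fin m) (Fin m) ℝ} {V : Set (Coord m)} {x : Coord m}

theorem christoffel_eventuallyEq (hgh : g =ᶠ[𝓝 x] h) (k i j : Fin m) :
    christoffel g k i j =ᶠ[𝓝 x] christoffel h k i j := by
  filter_upwards [hgh.eventuallyEq_nhds] with y hy
  have e : ∀ a b c : Fin m, pd a (fun y => g y b c) y = pd a (fun y => h y b c) y := fun a b c =>
    pd_congr (hy.mono fun z hz => by simp only [hz])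
  simp only [christoffel, e, hy.self_of_nhds]

theorem scalarComp_congr (hgh : g =ᶠ[𝓝 x] h) : scalarComp g x = scalarComp h x := by
  have e := fun k i j => christoffel_eventuallyEq hgh k i j
  have e' := fun k i j => (e k i j).self_of_nhds
  have e'' := fun l k i j => pd_congr (i := l) (e k i j)
  simp only [scalarComp, ricciComp, e', e'', hgh.self_of_nhds]

namespace IsMetricOn

variable (hg : IsMetricOn g V) (hx : x ∈ V)
include hg hx

theorem mem_nhds : V ∈ 𝓝 x := hg.isOpen.mem_nhds hx

theorem det_pos : 0 < (g x).det := (hg.posDef x hx).det_pos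

theorem symm (a b : Fin m) : g x a b = g x b a := by
  have := (hg.posDef x hx).isHermitian.apply b a
  simpa using this

theorem inv_symm (a b : Fin m) : (g x)⁻¹ a b = (g x)⁻¹ b a := by
  have := (hg.posDef x hx).isHermitian.inv.apply b a
  simpa using this

theorem mul_inv : g x * (g x)⁻¹ = 1 := Matrix.mul_nonsing_inv _ (hg.det_pos hx).ne'.isUnit

theorem inv_mul : (g x)⁻¹ * g x = 1 := Matrix.nonsing_inv_mul _ (hg.det_pos hx).ne'.isUnit

theorem sum_mul_inv (a b : Fin m) : ∑ c, g x a c * (g x)⁻¹ c b = if a = b then 1 else 0 := by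
  have := congrFun (congrFun (hg.mul_inv hx) a) b
  rwa [Matrix.mul_apply, Matrix.one_apply] at this

theorem sum_inv_mul (a b : Fin m) : ∑ c, (g x)⁻¹ a c * g x c b = if a = b then 1 else 0 := by
  have := congrFun (congrFun (hg.inv_mul hx) a) b
  rwa [Matrix.mul_apply, Matrix.one_apply] at this

theorem ip_comm (u v : Fin m → ℝ) : ip (g x) u v = ip (g x) v u := by
  simp only [ip]
  rw [Finset.sum_comm]
  exact Finset.sum_congr rfl fun a _ => Finset.sum_congr rfl fun b _ => by
    rw [hg.symm hx a b]; ring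

theorem contDiffAt_inv (k l : Fin m) : ContDiffAt ℝ ∞ (fun y => (g y)⁻¹ k l) x :=
  contDiffAt_inv_apply (hg.smooth x hx) (hg.det_pos hx).ne' k l

theorem contDiffAt_christoffelLow (l i j : Fin m) : ContDiffAt ℝ ∞ (christoffelLow g l i j) x :=
  contDiffAt_const.mul (((pd_contDiffAt (hg.smooth x hx _ _)).add
    (pd_contDiffAt (hg.smooth x hx _ _))).sub (pd_contDiffAt (hg.smooth x hx _ _)))

theorem contDiffAt_christoffel (k i j : Fin m) : ContDiffAt ℝ ∞ (christoffel g k i j) x := by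
  have : christoffel g k i j = fun y => ∑ l, (g y)⁻¹ k l * christoffelLow g l i j y :=
    funext fun y => christoffel_eq_sum_christoffelLow g k i j y
  rw [this]
  exact ContDiffAt.sum fun l _ => (hg.contDiffAt_inv hx k l).mul (hg.contDiffAt_christoffelLow hx l i j)

theorem contDiffAt_scalarComp : ContDiffAt ℝ ∞ (scalarComp g) x := by
  have c := fun k i j => hg.contDiffAt_christoffel hx k i j
  refine ContDiffAt.sum fun i _ => ContDiffAt.sum fun j _ => (hg.contDiffAt_inv hx i j).mul ?_
  refine ContDiffAt.sum fun k _ => ((pd_contDiffAt (c _ _ _)).sub (pd_contDiffAt (c _ _ _))).add ?_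
  exact ContDiffAt.sum fun l _ => ((c _ _ _).mul (c _ _ _)).sub ((c _ _ _).mul (c _ _ _))

theorem pd_symm (k a b : Fin m) : pd k (fun y => g y a b) x = pd k (fun y => g y b a) x :=
  pd_congr (by filter_upwards [hg.mem_nhds hx] with y hy using hg.symm hy a b)

theorem christoffelLow_comm (l i j : Fin m) : christoffelLow g l i j x = christoffelLow g l j i x := by
  simp only [christoffelLow, hg.pd_symm hx l i j]; ring

theorem christoffel_comm (l i j : Fin m) : christoffel g l i j x = christoffel g l j i x := by
  simp only [christoffel_eq_sum_christoffelLow, hg.christoffelLow_comm hx _ i j]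

theorem sum_mul_christoffel (l i j : Fin m) :
    ∑ k, g x l k * christoffel g k i j x = christoffelLow g l i j x := by
  simp only [christoffel_eq_sum_christoffelLow, Finset.mul_sum]
  rw [Finset.sum_comm]
  simp only [← mul_assoc, ← Finset.sum_mul, hg.sum_mul_inv hx]
  simp

/-- Compatibility of the Levi-Civita connection with the metric, in coordinates: in the sum of the
two symbols all other derivatives of the metric cancel. -/
theorem pd_metric (c a b : Fin m) :
    pd c (fun y => g y a b) x = christoffelLow g a c b x + christoffelLow g b c a x := by
  simp only [christoffelLow, hg.pd_symm hx c b a, hg.pd_symm hx b c a, hg.pd_symm hx a c b]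
  ring

/-- The lowered curvature tensor in terms of Christoffel symbols of the first kind. -/
theorem riemLow_eq (l k i j : Fin m) :
    riemLow g l k i j x = pd k (christoffelLow g l i j) x - pd i (christoffelLow g l k j) x
      - ∑ p, (christoffelLow g p k l x * christoffel g p i j x
        - christoffelLow g p i l x * christoffel g p k j x) := by
  -- Product rule for `christoffelLow` written as the metric times `christoffel`; the derivative of
  -- the metric is replaced by `pd_metric`.
  have key : ∀ k i j : Fin m, ∑ a, g x l a * pd k (christoffel g a i j) x
      = pd k (christoffelLow g l i j) x
        - ∑ a, (christoffelLow g l k a x + christoffelLow g a k l x) * christoffel g a i j x := by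
    intro k i j
    have e : pd k (christoffelLow g l i j) x
        = pd k (fun y => ∑ a, g y l a * christoffel g a i j y) x :=
      pd_congr (by filter_upwards [hg.mem_nhds hx] with y hy using (hg.sum_mul_christoffel hy l i j).symm)
    have dg := fun a => (hg.smooth x hx l a).differentiableAt (by simp)
    have dc := fun a => (hg.contDiffAt_christoffel hx a i j).differentiableAt (by simp)
    rw [e, pd_sum (F := fun a y => g y l a * christoffel g a i j y) fun a _ => (dg a).mul (dc a), ← Finset.sum_sub_distrib]
    refine Finset.sum_congr rfl fun a _ => ?_
    rw [pd_mul (dg a) (dc a), hg.pd_metric hx]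
    ring
  have q : ∀ k i j : Fin m, ∑ a, g x l a * ∑ p, christoffel g a k p x * christoffel g p i j x
      = ∑ p, christoffelLow g l k p x * christoffel g p i j x := by
    intro k i j
    simp only [Finset.mul_sum]
    rw [Finset.sum_comm]
    simp only [← mul_assoc, ← Finset.sum_mul, hg.sum_mul_christoffel hx]
  simp only [riemLow, riemUp, Finset.sum_sub_distrib, mul_add, mul_sub, Finset.sum_add_distrib,
    key, q, add_mul]
  ring

/-- Immediate from `riemLow_eq`, whose right side is a difference of two terms that trade places
under k ↔ i. -/
theorem riemLow_antisymm_left (l k i j : Fin m) : riemLow g l k i j x = -riemLow g l i k j x := by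
  rw [hg.riemLow_eq hx, hg.riemLow_eq hx, Finset.sum_sub_distrib, Finset.sum_sub_distrib]
  ring

theorem pd_christoffelLow (k l i j : Fin m) : pd k (christoffelLow g l i j) x
    = (1 / 2) * (pd k (pd i fun y => g y j l) x + pd k (pd j fun y => g y i l) x
      - pd k (pd l fun y => g y i j) x) := by
  have d := fun a b c => (pd_contDiffAt (i := a) (hg.smooth x hx b c)).differentiableAt (by simp)
  have d1 : DifferentiableAt ℝ (fun y => pd i (fun y => g y j l) y + pd j (fun y => g y i l) y) x :=
    (d _ _ _).add (d _ _ _)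
  have d2 : DifferentiableAt ℝ (fun y => pd i (fun y => g y j l) y + pd j (fun y => g y i l) y
    - pd l (fun y => g y i j) y) x := d1.sub (d _ _ _)
  exact (pd_const_mul _ d2).trans (by rw [pd_sub d1 (d _ _ _), pd_add (d _ _ _) (d _ _ _)])

theorem sum_christoffelLow_mul_comm (k l i j : Fin m) :
    ∑ p, christoffelLow g p k l x * christoffel g p i j x
      = ∑ p, christoffelLow g p i j x * christoffel g p k l x := by
  simp only [christoffel_eq_sum_christoffelLow, Finset.mul_sum]
  rw [Finset.sum_comm]
  exact Finset.sum_congr rfl fun p _ => Finset.sum_congr rfl fun q _ => by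
    rw [hg.inv_symm hx p q]; ring

/-- In `riemLow_eq` the second derivatives of the metric cancel against those with l and j
exchanged, since partial derivatives commute. The two quadratic terms trade places, because
contracting two Christoffel symbols with the inverse metric is symmetric. Together with
`riemLow_antisymm_left` this is all the curvature symmetry that the traced Gauss equation needs; no
Bianchi identity enters. -/
theorem riemLow_antisymm_right (l k i j : Fin m) : riemLow g l k i j x = -riemLow g j k i l x := by
  have c : ∀ a b c d : Fin m, pd a (pd b fun y => g y c d) x = pd b (pd a fun y => g y c d) x :=
    fun a b c d => pd_comm (hg.smooth x hx c d)
  rw [hg.riemLow_eq hx, hg.riemLow_eq hx, Finset.sum_sub_distrib, Finset.sum_sub_distrib,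
    hg.sum_christoffelLow_mul_comm hx k l, hg.sum_christoffelLow_mul_comm hx i l]
  simp only [hg.pd_christoffelLow hx]
  rw [c k i j l, c k i l j]
  ring

theorem riemUp_eq (a k i j : Fin m) : riemUp g a k i j x = ∑ l, (g x)⁻¹ a l * riemLow g l k i j x := by
  simp only [riemLow, Finset.mul_sum]
  rw [Finset.sum_comm]
  simp only [← mul_assoc, ← Finset.sum_mul, hg.sum_inv_mul hx]
  simp

theorem ricciComp_eq (i j : Fin m) :
    ricciComp g i j x = ∑ k, ∑ l, (g x)⁻¹ k l * riemLow g l k i j x := by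
  rw [ricciComp_eq_sum_riemUp]
  exact Finset.sum_congr rfl fun k _ => hg.riemUp_eq hx k k i j

end IsMetricOn

end Metrics

end Willmore

namespace Willmore

open Filter Topology

/-! ### Maps between coordinate spaces -/

section Maps

variable {m N : ℕ}

theorem ip_add_left (A : Matrix (Fin m) (Fin m) ℝ) (u u' v : Fin m → ℝ) :
    ip A (fun a => u a + u' a) v = ip A u v + ip A u' v := by
  simp only [ip, mul_add, add_mul, Finset.sum_add_distrib]

theorem ip_add_right (A : Matrix (Fin m) (Fin m) ℝ) (u v v' : Fin m → ℝ) :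
    ip A u (fun a => v a + v' a) = ip A u v + ip A u v' := by
  simp only [ip, mul_add, Finset.sum_add_distrib]

theorem ip_sub_right (A : Matrix (Fin m) (Fin m) ℝ) (u v v' : Fin m → ℝ) :
    ip A u (fun a => v a - v' a) = ip A u v - ip A u v' := by
  simp only [ip, mul_sub, Finset.sum_sub_distrib]

theorem ip_sum_right {κ : Type*} [Fintype κ] (A : Matrix (Fin m) (Fin m) ℝ) (u : Fin m → ℝ)
    (c : κ → ℝ) (v : κ → Fin m → ℝ) :
    ip A u (fun a => ∑ k, c k * v k a) = ∑ k, c k * ip A u (v k) := by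
  simp only [ip, Finset.mul_sum]
  conv_rhs => rw [Finset.sum_comm]
  refine Finset.sum_congr rfl fun a _ => ?_
  conv_rhs => rw [Finset.sum_comm]
  exact Finset.sum_congr rfl fun b _ => Finset.sum_congr rfl fun k _ => by ring

/-- The coordinate tangent vector `∂ᵢ F`. -/
def tang (F : Coord m → Coord N) (i : Fin m) (y : Coord m) : Fin N → ℝ :=
  fun a => pd i (fun z => F z a) y

/-- The components of the pullback `F^* g`. -/
def pullComp (g : Coord N → Matrix (Fin N) (Fin N) ℝ) (F : Coord m → Coord N) (y : Coord m) :
    Matrix (Fin m) (Fin m) ℝ :=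
  Matrix.of fun i j => ip (g (F y)) (tang F i y) (tang F j y)

/-- The covariant derivative of a vector field `W` along `F`. -/
def covD (g : Coord N → Matrix (Fin N) (Fin N) ℝ) (F : Coord m → Coord N) (k : Fin m)
    (W : Coord m → Fin N → ℝ) (y : Coord m) : Fin N → ℝ :=
  fun a => pd k (fun z => W z a) y
    + ∑ c, ∑ d, christoffel g a c d (F y) * tang F k y c * W y d

/-- The covariant derivatives `∇_{∂ᵢ} ∂ⱼ F`. -/
def hess (g : Coord N → Matrix (Fin N) (Fin N) ℝ) (F : Coord m → Coord N) (i j : Fin m)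
    (y : Coord m) : Fin N → ℝ :=
  covD g F i (tang F j) y

variable {g : Coord N → Matrix (Fin N) (Fin N) ℝ} {V : Set (Coord N)} {F : Coord m → Coord N}
  {U : Set (Coord m)} {y : Coord m} {k i j l : Fin m} {W Z : Coord m → Fin N → ℝ}

theorem contDiffAt_coord (hF : ContDiffAt ℝ ∞ F y) (a : Fin N) :
    ContDiffAt ℝ ∞ (fun z => F z a) y :=
  (contDiffAt_euclidean.1 hF) a

theorem contDiffAt_tang (hF : ContDiffAt ℝ ∞ F y) (i : Fin m) (a : Fin N) :
    ContDiffAt ℝ ∞ (fun z => tang F i z a) y :=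
  pd_contDiffAt (contDiffAt_coord hF a)

theorem pd_tang_comm (hF : ContDiffAt ℝ ∞ F y) (i j : Fin m) (a : Fin N) :
    pd i (fun z => tang F j z a) y = pd j (fun z => tang F i z a) y :=
  pd_comm (contDiffAt_coord hF a)

theorem contDiffAt_covD (hg : IsMetricOn g V) (hy : F y ∈ V) (hF : ContDiffAt ℝ ∞ F y)
    (hW : ∀ a, ContDiffAt ℝ ∞ (fun z => W z a) y) (k : Fin m) (a : Fin N) :
    ContDiffAt ℝ ∞ (fun z => covD g F k W z a) y := by
  refine (pd_contDiffAt (hW a)).add ?_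
  refine ContDiffAt.sum fun c _ => ContDiffAt.sum fun d _ => ContDiffAt.mul (ContDiffAt.mul ?_ ?_) (hW d)
  · exact (hg.contDiffAt_christoffel hy a c d).comp y hF
  · exact contDiffAt_tang hF k c

theorem contDiffAt_hess (hg : IsMetricOn g V) (hy : F y ∈ V) (hF : ContDiffAt ℝ ∞ F y)
    (i j : Fin m) (a : Fin N) : ContDiffAt ℝ ∞ (fun z => hess g F i j z a) y :=
  contDiffAt_covD hg hy hF (contDiffAt_tang hF j) i a

/-- The connection is torsion free: the partial derivatives of F commute and the Christoffel symbols
are symmetric in their lower indices. -/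
theorem hess_comm (hg : IsMetricOn g V) (hy : F y ∈ V) (hF : ContDiffAt ℝ ∞ F y)
    (i j : Fin m) : hess g F i j y = hess g F j i y := by
  funext a
  simp only [hess, covD]
  rw [pd_tang_comm hF i j, Finset.sum_comm]
  congr 1
  exact Finset.sum_congr rfl fun c _ => Finset.sum_congr rfl fun d _ => by
    rw [hg.christoffel_comm hy a d c]; ring

theorem contDiffAt_ip {A : Coord m → Matrix (Fin N) (Fin N) ℝ}
    (hA : ∀ a b, ContDiffAt ℝ ∞ (fun z => A z a b) y)
    (hW : ∀ a, ContDiffAt ℝ ∞ (fun z => W z a) y) (hZ : ∀ a, ContDiffAt ℝ ∞ (fun z => Z z a) y) :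
    ContDiffAt ℝ ∞ (fun z => ip (A z) (W z) (Z z)) y :=
  ContDiffAt.sum fun a _ => ContDiffAt.sum fun b _ => ((hA a b).mul (hW a)).mul (hZ b)

/-- The pulled back connection is compatible with the metric. -/
theorem pd_ip (hg : IsMetricOn g V) (hy : F y ∈ V) (hF : ContDiffAt ℝ ∞ F y)
    (hW : ∀ a, ContDiffAt ℝ ∞ (fun z => W z a) y) (hZ : ∀ a, ContDiffAt ℝ ∞ (fun z => Z z a) y)
    (k : Fin m) : pd k (fun z => ip (g (F z)) (W z) (Z z)) y
      = ip (g (F y)) (covD g F k W y) (Z y) + ip (g (F y)) (W y) (covD g F k Z y) := by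
  have dG := fun a b => (hg.smooth _ hy a b).differentiableAt (by simp)
  have dF := hF.differentiableAt (by simp)
  have dGF : ∀ a b, DifferentiableAt ℝ (fun z => g (F z) a b) y := fun a b =>
    ((hg.smooth _ hy a b).comp y hF).differentiableAt (by simp)
  have dW := fun a => (hW a).differentiableAt (by simp)
  have dZ := fun a => (hZ a).differentiableAt (by simp)
  have d2 : ∀ a b, DifferentiableAt ℝ (fun z => g (F z) a b * W z a) y :=
    fun a b => (dGF a b).mul (dW a)
  have d3 : ∀ a b, DifferentiableAt ℝ (fun z => g (F z) a b * W z a * Z z b) y :=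
    fun a b => (d2 a b).mul (dZ b)
  have e1 : pd k (fun z => ip (g (F z)) (W z) (Z z)) y
      = ∑ a, ∑ b, pd k (fun z => g (F z) a b * W z a * Z z b) y := by
    simp only [ip]
    rw [pd_sum (F := fun a z => ∑ b, g (F z) a b * W z a * Z z b)
      fun a _ => DifferentiableAt.fun_sum fun b _ => d3 a b]
    exact Finset.sum_congr rfl fun a _ => pd_sum fun b _ => d3 a b
  -- The derivative of the metric along F splits by `pd_metric` into two symbols of the first kind,
  -- one for each argument; `e3` recognizes them as the connection terms of the two covariant
  -- derivatives.
  have e2 : ∀ a b, pd k (fun z => g (F z) a b * W z a * Z z b) y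
      = (∑ c, (christoffelLow g a c b (F y) + christoffelLow g b c a (F y)) * tang F k y c)
          * W y a * Z y b
        + g (F y) a b * pd k (fun z => W z a) y * Z y b
        + g (F y) a b * W y a * pd k (fun z => Z z b) y := by
    intro a b
    rw [pd_mul (d2 a b) (dZ b), pd_mul (dGF a b) (dW a),
      pd_comp (f := fun x => g x a b) (dG a b) dF]
    simp only [hg.pd_metric hy, tang]
    ring
  have e3 : ∀ X Y : Fin N → ℝ,
      ip (g (F y)) (fun a => ∑ c, ∑ d, christoffel g a c d (F y) * tang F k y c * X d) Y
      = ∑ a, ∑ b, (∑ c, christoffelLow g b c a (F y) * tang F k y c) * X a * Y b := by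
    intro X Y
    have : ∀ b c d, christoffelLow g b c d (F y) = ∑ a, g (F y) a b * christoffel g a c d (F y) := by
      intro b c d
      rw [← hg.sum_mul_christoffel hy]
      exact Finset.sum_congr rfl fun a _ => by rw [hg.symm hy]
    simp only [ip, this, Finset.mul_sum, Finset.sum_mul]
    rw [Finset.sum_comm]
    conv_rhs => rw [Finset.sum_comm]
    refine Finset.sum_congr rfl fun b _ => ?_
    conv_rhs => rw [Finset.sum_comm]
    rw [Finset.sum_comm]
    refine Finset.sum_congr rfl fun c _ => ?_
    rw [Finset.sum_comm]
    exact Finset.sum_congr rfl fun d _ => Finset.sum_congr rfl fun a _ => by ring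
  have e4 : covD g F k W y = fun a => pd k (fun z => W z a) y
    + (fun a => ∑ c, ∑ d, christoffel g a c d (F y) * tang F k y c * W y d) a := rfl
  have e5 : covD g F k Z y = fun a => pd k (fun z => Z z a) y
    + (fun a => ∑ c, ∑ d, christoffel g a c d (F y) * tang F k y c * Z y d) a := rfl
  rw [e1, e4, e5, ip_add_left, ip_add_right, e3, hg.ip_comm hy (W y) (fun a => ∑ c, ∑ d, _), e3]
  simp only [e2, Finset.sum_add_distrib, add_mul]
  conv_rhs => enter [2, 2]; rw [Finset.sum_comm]
  have e6 : ∀ a b, (∑ c, christoffelLow g a c b (F y) * tang F k y c) * Z y b * W y a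
    = (∑ c, christoffelLow g a c b (F y) * tang F k y c) * W y a * Z y b := fun a b => by ring
  simp only [e6, ip]
  ring

/-- The commutator of covariant derivatives is the curvature of the target. -/
theorem covD_covD_sub (hg : IsMetricOn g V) (hU : ∀ᶠ z in 𝓝 y, F z ∈ V ∧ ContDiffAt ℝ ∞ F z)
    (hW : ∀ a, ContDiffAt ℝ ∞ (fun z => W z a) y) (k i : Fin m) (a : Fin N) :
    covD g F k (covD g F i W) y a - covD g F i (covD g F k W) y a
      = ∑ c, ∑ e, ∑ d, riemUp g a c e d (F y) * tang F k y c * tang F i y e * W y d := by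
  obtain ⟨hy, hF⟩ := hU.self_of_nhds
  have dF := hF.differentiableAt (by simp)
  have dC := fun a b c => (hg.contDiffAt_christoffel hy a b c).differentiableAt (by simp)
  have dCF : ∀ a b c, DifferentiableAt ℝ (fun z => christoffel g a b c (F z)) y := fun a b c =>
    ((hg.contDiffAt_christoffel hy a b c).comp y hF).differentiableAt (by simp)
  have dT := fun i a => (contDiffAt_tang hF i a).differentiableAt (by simp)
  have dW := fun a => (hW a).differentiableAt (by simp)
  -- All terms are arranged by their behaviour under k ↔ i: the second derivatives of W, those of F,
  -- and the bracket with one derivative of W are symmetric and drop out of the commutator. Only the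
  -- last triple sum survives, and its antisymmetrization is the curvature.
  have main : ∀ k i, covD g F k (covD g F i W) y a
      = pd k (pd i fun z => W z a) y
        + ∑ c, ∑ d, christoffel g a c d (F y) * pd k (fun z => tang F i z c) y * W y d
        + (∑ c, ∑ d, christoffel g a c d (F y) * tang F i y c * pd k (fun z => W z d) y
          + ∑ c, ∑ d, christoffel g a c d (F y) * tang F k y c * pd i (fun z => W z d) y)
        + ∑ c, ∑ e, ∑ d, (pd c (christoffel g a e d) (F y)
            + ∑ l, christoffel g a c l (F y) * christoffel g l e d (F y))
          * tang F k y c * tang F i y e * W y d := by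
    intro k i
    have d2 : ∀ c d, DifferentiableAt ℝ (fun z => christoffel g a c d (F z) * tang F i z c) y :=
      fun c d => (dCF a c d).mul (dT i c)
    have d3 : ∀ c d, DifferentiableAt ℝ
        (fun z => christoffel g a c d (F z) * tang F i z c * W z d) y :=
      fun c d => (d2 c d).mul (dW d)
    have e1 : pd k (fun z => covD g F i W z a) y = pd k (pd i fun z => W z a) y
        + ∑ c, ∑ d, pd k (fun z => christoffel g a c d (F z) * tang F i z c * W z d) y := by
      simp only [covD]
      rw [pd_add ((pd_contDiffAt (hW a)).differentiableAt (by simp))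
        (DifferentiableAt.fun_sum fun c _ => DifferentiableAt.fun_sum fun d _ => d3 c d),
        pd_sum (F := fun c z => ∑ d, christoffel g a c d (F z) * tang F i z c * W z d)
        fun c _ => DifferentiableAt.fun_sum fun d _ => d3 c d]
      congr 1
      exact Finset.sum_congr rfl fun c _ => pd_sum fun d _ => d3 c d
    have e2 : ∀ c d, pd k (fun z => christoffel g a c d (F z) * tang F i z c * W z d) y
        = (∑ e, pd e (christoffel g a c d) (F y) * tang F k y e) * tang F i y c * W y d
          + christoffel g a c d (F y) * pd k (fun z => tang F i z c) y * W y d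
          + christoffel g a c d (F y) * tang F i y c * pd k (fun z => W z d) y := by
      intro c d
      rw [pd_mul (d2 c d) (dW d), pd_mul (dCF a c d) (dT i c), pd_comp (dC a c d) dF]
      simp only [tang]
      ring
    have e3 : ∑ c, ∑ e, christoffel g a c e (F y) * tang F k y c * covD g F i W y e
        = ∑ c, ∑ d, christoffel g a c d (F y) * tang F k y c * pd i (fun z => W z d) y
          + ∑ c, ∑ e, ∑ d, (∑ l, christoffel g a c l (F y) * christoffel g l e d (F y))
            * tang F k y c * tang F i y e * W y d := by
      simp only [covD, mul_add, Finset.sum_add_distrib, Finset.mul_sum, Finset.sum_mul]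
      congr 1
      refine Finset.sum_congr rfl fun c _ => ?_
      rw [Finset.sum_comm]
      refine Finset.sum_congr rfl fun e _ => ?_
      rw [Finset.sum_comm]
      exact Finset.sum_congr rfl fun d _ => Finset.sum_congr rfl fun l _ => by ring
    have e4 : ∑ c, ∑ d, (∑ e, pd e (christoffel g a c d) (F y) * tang F k y e) * tang F i y c * W y d
        = ∑ c, ∑ e, ∑ d, pd c (christoffel g a e d) (F y) * tang F k y c * tang F i y e * W y d := by
      simp only [Finset.sum_mul]
      conv_rhs => rw [Finset.sum_comm]
      refine Finset.sum_congr rfl fun c _ => ?_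
      rw [Finset.sum_comm]
    change pd k (fun z => covD g F i W z a) y
      + ∑ c, ∑ e, christoffel g a c e (F y) * tang F k y c * covD g F i W y e = _
    rw [e1, e3]
    simp only [e2, Finset.sum_add_distrib, add_mul, e4]
    ring
  have sw : ∑ c, ∑ e, ∑ d, (pd c (christoffel g a e d) (F y)
            + ∑ l, christoffel g a c l (F y) * christoffel g l e d (F y))
          * tang F i y c * tang F k y e * W y d
      = ∑ c, ∑ e, ∑ d, (pd e (christoffel g a c d) (F y)
            + ∑ l, christoffel g a e l (F y) * christoffel g l c d (F y))
          * tang F k y c * tang F i y e * W y d := by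
    rw [Finset.sum_comm]
    exact Finset.sum_congr rfl fun _ _ => Finset.sum_congr rfl fun _ _ =>
      Finset.sum_congr rfl fun _ _ => by ring
  have fin : ∑ c, ∑ e, ∑ d, riemUp g a c e d (F y) * tang F k y c * tang F i y e * W y d
      = ∑ c, ∑ e, ∑ d, (pd c (christoffel g a e d) (F y)
            + ∑ l, christoffel g a c l (F y) * christoffel g l e d (F y))
          * tang F k y c * tang F i y e * W y d
        - ∑ c, ∑ e, ∑ d, (pd e (christoffel g a c d) (F y)
            + ∑ l, christoffel g a e l (F y) * christoffel g l c d (F y))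
          * tang F k y c * tang F i y e * W y d := by
    simp only [← Finset.sum_sub_distrib]
    exact Finset.sum_congr rfl fun _ _ => Finset.sum_congr rfl fun _ _ =>
      Finset.sum_congr rfl fun _ _ => by
        rw [riemUp, Finset.sum_sub_distrib]; ring
  rw [main k i, main i k, sw, fin, pd_comm (hW a)]
  simp only [pd_tang_comm hF i k]
  ring

end Maps

end Willmore

namespace Willmore

open Filter Topology

/-! ### The Gauss equation -/

section Gauss

variable {m N : ℕ}

theorem sum_comm_four {κ : Type*} [Fintype κ] (f : κ → κ → κ → κ → ℝ) :
    ∑ a, ∑ b, ∑ c, ∑ d, f a b c d = ∑ d, ∑ c, ∑ a, ∑ b, f a b c d :=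
  calc ∑ a, ∑ b, ∑ c, ∑ d, f a b c d = ∑ a, ∑ b, ∑ d, ∑ c, f a b c d :=
        Finset.sum_congr rfl fun _ _ => Finset.sum_congr rfl fun _ _ => Finset.sum_comm
    _ = ∑ a, ∑ d, ∑ b, ∑ c, f a b c d := Finset.sum_congr rfl fun _ _ => Finset.sum_comm
    _ = ∑ d, ∑ a, ∑ b, ∑ c, f a b c d := Finset.sum_comm
    _ = ∑ d, ∑ a, ∑ c, ∑ b, f a b c d :=
        Finset.sum_congr rfl fun _ _ => Finset.sum_congr rfl fun _ _ => Finset.sum_comm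
    _ = _ := Finset.sum_congr rfl fun _ _ => Finset.sum_comm

theorem ip_eq_dotProduct (A : Matrix (Fin m) (Fin m) ℝ) (u v : Fin m → ℝ) :
    ip A u v = u ⬝ᵥ A.mulVec v := by
  simp only [ip, dotProduct, Matrix.mulVec, Finset.mul_sum]
  exact Finset.sum_congr rfl fun a _ => Finset.sum_congr rfl fun b _ => by ring

/-- `F` is an isometric immersion of `U`, with the metric `F^* g`, into `V`, with the metric `g`. -/
structure IsImmersionOn (g : Coord N → Matrix (Fin N) (Fin N) ℝ) (F : Coord m → Coord N)
    (U : Set (Coord m)) (V : Set (Coord N)) : Prop where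
  metric : IsMetricOn g V
  pull : IsMetricOn (pullComp g F) U
  mapsTo : ∀ y ∈ U, F y ∈ V
  smooth : ∀ y ∈ U, ContDiffAt ℝ ∞ F y

/-- The Jacobian matrix of `F`. -/
def jac (F : Coord m → Coord N) (y : Coord m) : Matrix (Fin N) (Fin m) ℝ :=
  Matrix.of fun a i => tang F i y a

theorem pullComp_eq_mul (g : Coord N → Matrix (Fin N) (Fin N) ℝ) (F : Coord m → Coord N)
    (y : Coord m) : pullComp g F y = (jac F y).transpose * g (F y) * jac F y := by
  ext i j
  simp only [pullComp, ip, jac, Matrix.mul_apply, Matrix.of_apply, Matrix.transpose_apply,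
    Finset.sum_mul]
  rw [Finset.sum_comm]
  exact Finset.sum_congr rfl fun a _ => Finset.sum_congr rfl fun b _ => by ring

namespace IsImmersionOn

variable {g : Coord N → Matrix (Fin N) (Fin N) ℝ} {V : Set (Coord N)} {F : Coord m → Coord N}
  {U : Set (Coord m)} {y : Coord m} (hF : IsImmersionOn g F U V) (hy : y ∈ U)
include hF hy

theorem eventually : ∀ᶠ z in 𝓝 y, F z ∈ V ∧ ContDiffAt ℝ ∞ F z := by
  filter_upwards [hF.pull.mem_nhds hy] with z hz using ⟨hF.mapsTo z hz, hF.smooth z hz⟩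

/-- The Koszul formula. Each derivative of the induced metric is a sum of two products by `pd_ip`,
and symmetry of `hess` cancels all but one of the resulting products. -/
theorem christoffelLow_pull (l i j : Fin m) : christoffelLow (pullComp g F) l i j y
    = ip (g (F y)) (hess g F i j y) (tang F l y) := by
  have hV := hF.mapsTo y hy
  have hs := hF.smooth y hy
  have e : ∀ k a b, pd k (fun z => pullComp g F z a b) y
      = ip (g (F y)) (hess g F k a y) (tang F b y) + ip (g (F y)) (tang F a y) (hess g F k b y) :=
    fun k a b => pd_ip hF.metric hV hs (contDiffAt_tang hs a) (contDiffAt_tang hs b) k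
  simp only [christoffelLow, e]
  rw [hess_comm hF.metric hV hs j i, hess_comm hF.metric hV hs l i, hess_comm hF.metric hV hs l j,
    hF.metric.ip_comm hV (tang F j y), hF.metric.ip_comm hV (tang F i y)]
  ring

theorem christoffel_pull (k i j : Fin m) : christoffel (pullComp g F) k i j y
    = ∑ l, (pullComp g F y)⁻¹ k l * ip (g (F y)) (hess g F i j y) (tang F l y) := by
  simp only [christoffel_eq_sum_christoffelLow, hF.christoffelLow_pull hy]

/-- The Gauss equation before a normal vector is chosen, hence valid in any codimension.
Differentiating `christoffelLow_pull` produces third derivatives of F whose commutator is the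
ambient curvature, and products of second derivatives. Each sum over p subtracts from such a product
its tangential part. -/
theorem riemLow_pull (l k i j : Fin m) : riemLow (pullComp g F) l k i j y
    = ∑ a, ∑ c, ∑ e, ∑ d, riemLow g a c e d (F y)
        * tang F l y a * tang F k y c * tang F i y e * tang F j y d
      + (ip (g (F y)) (hess g F k l y) (hess g F i j y)
        - ∑ p, ip (g (F y)) (hess g F k l y) (tang F p y) * christoffel (pullComp g F) p i j y)
      - (ip (g (F y)) (hess g F i l y) (hess g F k j y)
        - ∑ p, ip (g (F y)) (hess g F i l y) (tang F p y) * christoffel (pullComp g F) p k j y) := by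
  have hV := hF.mapsTo y hy
  have hs := hF.smooth y hy
  have e : ∀ k i j, pd k (christoffelLow (pullComp g F) l i j) y
      = ip (g (F y)) (covD g F k (hess g F i j) y) (tang F l y)
        + ip (g (F y)) (hess g F i j y) (hess g F k l y) := by
    intro k i j
    rw [pd_congr (g := fun z => ip (g (F z)) (hess g F i j z) (tang F l z))
      (by filter_upwards [hF.pull.mem_nhds hy] with z hz using hF.christoffelLow_pull hz l i j)]
    exact pd_ip hF.metric hV hs (contDiffAt_hess hF.metric hV hs i j) (contDiffAt_tang hs l) k
  have r : ip (g (F y)) (tang F l y) (covD g F k (hess g F i j) y)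
        - ip (g (F y)) (tang F l y) (covD g F i (hess g F k j) y)
      = ∑ a, ∑ c, ∑ e, ∑ d, riemLow g a c e d (F y)
        * tang F l y a * tang F k y c * tang F i y e * tang F j y d := by
    rw [← ip_sub_right]
    have := fun a => covD_covD_sub hF.metric (hF.eventually hy) (contDiffAt_tang hs j) k i a
    change ip (g (F y)) (tang F l y) (fun a => covD g F k (covD g F i (tang F j)) y a
      - covD g F i (covD g F k (tang F j)) y a) = _
    simp only [this, ip, riemLow, Finset.mul_sum, Finset.sum_mul]
    refine Finset.sum_congr rfl fun a _ => ?_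
    rw [Finset.sum_comm]
    refine Finset.sum_congr rfl fun c _ => ?_
    rw [Finset.sum_comm]
    refine Finset.sum_congr rfl fun e _ => ?_
    rw [Finset.sum_comm]
    exact Finset.sum_congr rfl fun d _ => Finset.sum_congr rfl fun b _ => by ring
  rw [hF.pull.riemLow_eq hy, e, e, ← r, Finset.sum_sub_distrib]
  simp only [hF.christoffelLow_pull hy]
  rw [hF.metric.ip_comm hV (covD g F k _ y), hF.metric.ip_comm hV (covD g F i _ y),
    hF.metric.ip_comm hV (hess g F i j y), hF.metric.ip_comm hV (hess g F k j y)]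
  ring

/-- The projection `h^{kl} ∂ₖFᵃ ∂ₗFᶜ` contracted with a tensor. -/
theorem sum_inv_mul_tang (T : Fin N → Fin N → ℝ) :
    ∑ k, ∑ l, (pullComp g F y)⁻¹ k l * ∑ a, ∑ c, T a c * tang F l y a * tang F k y c
      = ∑ a, ∑ c, (jac F y * (pullComp g F y)⁻¹ * (jac F y).transpose) a c * T a c := by
  simp only [Matrix.mul_apply, jac, Matrix.of_apply, Matrix.transpose_apply, Finset.mul_sum,
    Finset.sum_mul]
  rw [Finset.sum_comm]
  have e : ∀ l k a c, (pullComp g F y)⁻¹ k l * (T a c * tang F l y a * tang F k y c)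
      = tang F l y a * (pullComp g F y)⁻¹ l k * tang F k y c * T a c := by
    intro l k a c; rw [hF.pull.inv_symm hy k l]; ring
  simp only [e]
  have s1 : ∀ f : Fin m → Fin m → Fin N → Fin N → ℝ,
      ∑ l, ∑ k, ∑ a, ∑ c, f l k a c = ∑ a, ∑ c, ∑ k, ∑ l, f l k a c := by
    intro f
    calc ∑ l, ∑ k, ∑ a, ∑ c, f l k a c = ∑ l, ∑ a, ∑ k, ∑ c, f l k a c :=
          Finset.sum_congr rfl fun l _ => Finset.sum_comm
      _ = ∑ a, ∑ l, ∑ k, ∑ c, f l k a c := Finset.sum_comm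
      _ = ∑ a, ∑ l, ∑ c, ∑ k, f l k a c := Finset.sum_congr rfl fun a _ =>
          Finset.sum_congr rfl fun l _ => Finset.sum_comm
      _ = ∑ a, ∑ c, ∑ l, ∑ k, f l k a c := Finset.sum_congr rfl fun a _ => Finset.sum_comm
      _ = _ := Finset.sum_congr rfl fun a _ => Finset.sum_congr rfl fun c _ => Finset.sum_comm
  rw [s1]

variable {ν : Fin N → ℝ}
  (hP : jac F y * (pullComp g F y)⁻¹ * (jac F y).transpose = (g (F y))⁻¹ - Matrix.vecMulVec ν ν)
include hP

/-- The tangential part of the inner product. -/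
theorem sum_inv_mul_ip_mul_ip (u v : Fin N → ℝ) :
    ∑ p, ∑ q, (pullComp g F y)⁻¹ p q * ip (g (F y)) u (tang F p y) * ip (g (F y)) v (tang F q y)
      = ip (g (F y)) u v - ip (g (F y)) u ν * ip (g (F y)) v ν := by
  have hV := hF.mapsTo y hy
  set G := g (F y) with hG
  have hGt : G.transpose = G := by ext a b; exact hF.metric.symm hV b a
  have t : ∀ u p, ip G u (tang F p y) = ((jac F y).transpose.mulVec (G.mulVec u)) p := by
    intro u p
    rw [hF.metric.ip_comm hV, ip_eq_dotProduct]; rfl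
  have l : ∑ p, ∑ q, (pullComp g F y)⁻¹ p q * ip G u (tang F p y) * ip G v (tang F q y)
      = (G.mulVec u) ⬝ᵥ (jac F y * (pullComp g F y)⁻¹ * (jac F y).transpose).mulVec (G.mulVec v) := by
    have : ∑ p, ∑ q, (pullComp g F y)⁻¹ p q * ip G u (tang F p y) * ip G v (tang F q y)
        = ip (pullComp g F y)⁻¹ ((jac F y).transpose.mulVec (G.mulVec u))
          ((jac F y).transpose.mulVec (G.mulVec v)) := by
      simp only [t]; rfl
    rw [this, ip_eq_dotProduct, ← Matrix.mulVec_mulVec, ← Matrix.mulVec_mulVec,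
      Matrix.mulVec_transpose, ← Matrix.dotProduct_mulVec]
  have inv : (G⁻¹).mulVec (G.mulVec v) = v := by
    rw [Matrix.mulVec_mulVec, hF.metric.inv_mul hV, Matrix.one_mulVec]
  rw [l, hP, Matrix.sub_mulVec, inv, dotProduct_sub]
  have n1 : (G.mulVec u) ⬝ᵥ v = ip G u v := by
    rw [hF.metric.ip_comm hV, ip_eq_dotProduct, dotProduct_comm]
  have n2 : ∀ w, ip G w ν = ν ⬝ᵥ G.mulVec w := by
    intro w; rw [hF.metric.ip_comm hV, ip_eq_dotProduct]
  rw [n1, n2, n2]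
  congr 1
  rw [Matrix.vecMulVec_mulVec, dotProduct_smul, dotProduct_comm (G.mulVec u) ν]
  rfl

/-- Expanding the induced Christoffel symbol shows that the subtracted sum is the tangential part of
the inner product, so by `hP` only the product of the normal components remains. This turns the
quadratic terms of `riemLow_pull` into second fundamental forms. -/
theorem hess_ip_sub (k l i j : Fin m) :
    ip (g (F y)) (hess g F k l y) (hess g F i j y)
        - ∑ p, ip (g (F y)) (hess g F k l y) (tang F p y) * christoffel (pullComp g F) p i j y
      = ip (g (F y)) (hess g F k l y) ν * ip (g (F y)) (hess g F i j y) ν := by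
  have := hF.sum_inv_mul_ip_mul_ip hy hP (hess g F k l y) (hess g F i j y)
  have e : ∑ p, ip (g (F y)) (hess g F k l y) (tang F p y) * christoffel (pullComp g F) p i j y
      = ∑ p, ∑ q, (pullComp g F y)⁻¹ p q * ip (g (F y)) (hess g F k l y) (tang F p y)
        * ip (g (F y)) (hess g F i j y) (tang F q y) := by
    refine Finset.sum_congr rfl fun p _ => ?_
    rw [hF.christoffel_pull hy, Finset.mul_sum]
    exact Finset.sum_congr rfl fun q _ => by ring
  rw [e, this]; ring

/-- The twice traced Gauss equation, for a normal space spanned by `ν` (`ν = 0` is allowed). -/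
theorem scalarComp_pull : scalarComp (pullComp g F) y
    = scalarComp g (F y) - 2 * ∑ e, ∑ d, ricciComp g e d (F y) * ν e * ν d
      + ((∑ i, ∑ j, (pullComp g F y)⁻¹ i j * ip (g (F y)) (hess g F i j y) ν) ^ 2
        - ∑ i, ∑ j, ∑ k, ∑ l, (pullComp g F y)⁻¹ i j * (pullComp g F y)⁻¹ k l
          * ip (g (F y)) (hess g F i l y) ν * ip (g (F y)) (hess g F k j y) ν) := by
  have hV := hF.mapsTo y hy
  have e1 : scalarComp (pullComp g F) y
      = (∑ i, ∑ j, (pullComp g F y)⁻¹ i j * ∑ k, ∑ l, (pullComp g F y)⁻¹ k l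
          * ∑ a, ∑ c, (∑ e, ∑ d, riemLow g a c e d (F y) * tang F i y e * tang F j y d)
            * tang F l y a * tang F k y c)
        + (∑ i, ∑ j, (pullComp g F y)⁻¹ i j * ∑ k, ∑ l, (pullComp g F y)⁻¹ k l
            * (ip (g (F y)) (hess g F k l y) ν * ip (g (F y)) (hess g F i j y) ν))
        - ∑ i, ∑ j, (pullComp g F y)⁻¹ i j * ∑ k, ∑ l, (pullComp g F y)⁻¹ k l
            * (ip (g (F y)) (hess g F i l y) ν * ip (g (F y)) (hess g F k j y) ν) := by
    simp only [scalarComp, hF.pull.ricciComp_eq hy, hF.riemLow_pull hy, hF.hess_ip_sub hy hP,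
      ← Finset.sum_add_distrib, ← Finset.sum_sub_distrib, ← mul_add, ← mul_sub]
    refine Finset.sum_congr rfl fun i _ => Finset.sum_congr rfl fun j _ => congrArg _ <|
      Finset.sum_congr rfl fun k _ => Finset.sum_congr rfl fun l _ => congrArg _ ?_
    congr 2
    refine Finset.sum_congr rfl fun a _ => Finset.sum_congr rfl fun c _ => ?_
    simp only [Finset.sum_mul]
    exact Finset.sum_congr rfl fun e _ => Finset.sum_congr rfl fun d _ => by ring
  set P := jac F y * (pullComp g F y)⁻¹ * (jac F y).transpose with hPdef
  -- Each of the two traces with the induced inverse metric becomes a contraction of ambient indices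
  -- with the projection P.
  have e2 : (∑ i, ∑ j, (pullComp g F y)⁻¹ i j * ∑ k, ∑ l, (pullComp g F y)⁻¹ k l
          * ∑ a, ∑ c, (∑ e, ∑ d, riemLow g a c e d (F y) * tang F i y e * tang F j y d)
            * tang F l y a * tang F k y c)
      = ∑ e, ∑ d, P d e * ∑ a, ∑ c, P a c * riemLow g a c e d (F y) := by
    simp only [hF.sum_inv_mul_tang hy]
    rw [← hPdef]
    have : ∀ i j : Fin m, ∑ a, ∑ c, P a c
        * (∑ e, ∑ d, riemLow g a c e d (F y) * tang F i y e * tang F j y d)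
        = ∑ d, ∑ e, (∑ a, ∑ c, P a c * riemLow g a c e d (F y)) * tang F j y d * tang F i y e := by
      intro i j
      simp only [Finset.mul_sum, Finset.sum_mul]
      rw [sum_comm_four]
      exact Finset.sum_congr rfl fun _ _ => Finset.sum_congr rfl fun _ _ =>
        Finset.sum_congr rfl fun _ _ => Finset.sum_congr rfl fun _ _ => by ring
    simp only [this, hF.sum_inv_mul_tang hy]
    rw [← hPdef, Finset.sum_comm]
  have hPs : ∀ a c, P a c = (g (F y))⁻¹ c a - ν c * ν a := by
    intro a c
    rw [hP, Matrix.sub_apply, hF.metric.inv_symm hV, Matrix.vecMulVec_apply]; ring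
  have ric : ∀ e d, ∑ a, ∑ c, P a c * riemLow g a c e d (F y)
      = ricciComp g e d (F y) - ∑ a, ∑ c, ν c * ν a * riemLow g a c e d (F y) := by
    intro e d
    simp only [hPs, sub_mul, Finset.sum_sub_distrib]
    rw [hF.metric.ricciComp_eq hV, Finset.sum_comm]
  -- Inserting P = g⁻¹ - ν ⊗ ν twice gives one term with four copies of ν; it vanishes since the
  -- curvature is antisymmetric in e and c.
  have z : ∑ e, ∑ d, ν e * ν d * ∑ a, ∑ c, ν c * ν a * riemLow g a c e d (F y) = 0 := by
    have : ∑ e, ∑ d, ν e * ν d * ∑ a, ∑ c, ν c * ν a * riemLow g a c e d (F y)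
        = ∑ d, ∑ a, ∑ e, ∑ c, ν d * ν a * ν e * ν c * riemLow g a c e d (F y) := by
      rw [Finset.sum_comm]
      refine Finset.sum_congr rfl fun d _ => ?_
      simp only [Finset.mul_sum]
      rw [Finset.sum_comm]
      exact Finset.sum_congr rfl fun a _ => Finset.sum_congr rfl fun e _ =>
        Finset.sum_congr rfl fun c _ => by ring
    rw [this]
    refine Finset.sum_eq_zero fun d _ => Finset.sum_eq_zero fun a _ => ?_
    have s : ∑ e, ∑ c, ν d * ν a * ν e * ν c * riemLow g a c e d (F y)
        = -∑ e, ∑ c, ν d * ν a * ν e * ν c * riemLow g a c e d (F y) := by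
      conv_lhs => rw [Finset.sum_comm]
      simp only [← Finset.sum_neg_distrib]
      exact Finset.sum_congr rfl fun e _ => Finset.sum_congr rfl fun c _ => by
        rw [hF.metric.riemLow_antisymm_left hV a e c d]; ring
    linarith
  have c2 : ∑ e, ∑ d, (g (F y))⁻¹ e d * ∑ a, ∑ c, ν c * ν a * riemLow g a c e d (F y)
      = ∑ e, ∑ d, ricciComp g e d (F y) * ν e * ν d := by
    -- The two antisymmetries applied together reverse the order of the four indices, so tracing
    -- over the other pair again gives the Ricci tensor.
    have q : ∀ a c e d, riemLow g a c e d (F y) = riemLow g d e c a (F y) := by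
      intro a c e d
      rw [hF.metric.riemLow_antisymm_left hV, hF.metric.riemLow_antisymm_right hV, neg_neg]
    simp only [Finset.mul_sum]
    rw [sum_comm_four]
    refine Finset.sum_congr rfl fun c _ => Finset.sum_congr rfl fun a _ => ?_
    rw [hF.metric.ricciComp_eq hV]
    simp only [Finset.sum_mul]
    exact Finset.sum_congr rfl fun e _ => Finset.sum_congr rfl fun d _ => by rw [q a c e d]; ring
  -- Both cross terms of the product of projections equal Ric(ν,ν), whence the factor 2.
  have e3 : ∑ e, ∑ d, P d e * ∑ a, ∑ c, P a c * riemLow g a c e d (F y)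
      = scalarComp g (F y) - 2 * ∑ e, ∑ d, ricciComp g e d (F y) * ν e * ν d := by
    simp only [ric]
    simp only [hPs, sub_mul, mul_sub, Finset.sum_sub_distrib, z, c2]
    have : ∑ e, ∑ d, ν e * ν d * ricciComp g e d (F y)
        = ∑ e, ∑ d, ricciComp g e d (F y) * ν e * ν d :=
      Finset.sum_congr rfl fun e _ => Finset.sum_congr rfl fun d _ => by ring
    rw [this, scalarComp]
    ring
  rw [e1, e2, e3]
  have e4 : ∑ i, ∑ j, (pullComp g F y)⁻¹ i j * ∑ k, ∑ l, (pullComp g F y)⁻¹ k l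
            * (ip (g (F y)) (hess g F k l y) ν * ip (g (F y)) (hess g F i j y) ν)
      = (∑ i, ∑ j, (pullComp g F y)⁻¹ i j * ip (g (F y)) (hess g F i j y) ν) ^ 2 := by
    rw [sq, Finset.sum_mul]
    refine Finset.sum_congr rfl fun i _ => ?_
    rw [Finset.sum_mul]
    refine Finset.sum_congr rfl fun j _ => ?_
    simp only [Finset.mul_sum]
    exact Finset.sum_congr rfl fun k _ => Finset.sum_congr rfl fun l _ => by ring
  rw [e4]
  simp only [Finset.mul_sum]
  rw [add_sub_assoc]
  congr 2
  exact Finset.sum_congr rfl fun i _ => Finset.sum_congr rfl fun j _ =>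
    Finset.sum_congr rfl fun k _ => Finset.sum_congr rfl fun l _ => by ring

end IsImmersionOn

end Gauss

end Willmore

namespace Willmore

open Filter Topology

/-! ### Normal spaces of dimension zero and one -/

section Projection

variable {m N : ℕ}

/-- `D⁻¹ * Kᵀ * G` is a left inverse of `K`. As `K` has as many columns as rows, it is also a right
inverse, which says that `K * D⁻¹ * Kᵀ` inverts `G`. -/
theorem mul_inv_mul_transpose {κ : Type*} [Fintype κ] [DecidableEq κ]
    {G : Matrix (Fin N) (Fin N) ℝ} {D : Matrix κ κ ℝ} {K : Matrix (Fin N) κ ℝ}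
    (hc : Fintype.card κ = N) (hD : IsUnit D.det) (hK : K.transpose * G * K = D) :
    K * D⁻¹ * K.transpose = G⁻¹ := by
  have h1 : (D⁻¹ * K.transpose * G) * K = 1 := by
    rw [Matrix.mul_assoc, Matrix.mul_assoc, ← Matrix.mul_assoc K.transpose, hK,
      Matrix.nonsing_inv_mul _ hD]
  have h2 := (Matrix.mul_eq_one_comm_of_card_eq κ (Fin N) ℝ (by simpa using hc)).1 h1
  refine (Matrix.inv_eq_left_inv ?_).symm
  rw [← h2]
  simp only [Matrix.mul_assoc]

variable {g : Coord N → Matrix (Fin N) (Fin N) ℝ} {V : Set (Coord N)} {F : Coord m → Coord N}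
  {U : Set (Coord m)} {y : Coord m}

/-- The vectors ∂ᵢF together with ν form a frame, the columns of `K`, with block diagonal Gram
matrix diag(h, 1). By `mul_inv_mul_transpose` the inverse ambient metric is then the sum of the
tangential projection and ν ⊗ ν. -/
theorem proj_of_unit_normal (hF : IsImmersionOn g F U V) (hy : y ∈ U) (hm : m + 1 = N)
    {ν : Fin N → ℝ} (h1 : ip (g (F y)) ν ν = 1) (h0 : ∀ i, ip (g (F y)) (tang F i y) ν = 0) :
    jac F y * (pullComp g F y)⁻¹ * (jac F y).transpose = (g (F y))⁻¹ - Matrix.vecMulVec ν ν := by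
  have hV := hF.mapsTo y hy
  set h := pullComp g F y with hh
  set G := g (F y) with hG
  let K : Matrix (Fin N) (Fin m ⊕ Unit) ℝ := Matrix.fromCols (jac F y) (Matrix.of fun a _ => ν a)
  let D : Matrix (Fin m ⊕ Unit) (Fin m ⊕ Unit) ℝ := Matrix.fromBlocks h 0 0 1
  have hdet : IsUnit D.det := by
    rw [Matrix.det_fromBlocks_zero₂₁, Matrix.det_one, mul_one]
    exact (hF.pull.det_pos hy).ne'.isUnit
  have hK : K.transpose * G * K = D := by
    have e : ∀ s t, (K.transpose * G * K) s t = ip G (fun a => K a s) (fun a => K a t) := by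
      intro s t
      simp only [ip, Matrix.mul_apply, Matrix.transpose_apply, Finset.sum_mul]
      rw [Finset.sum_comm]
      exact Finset.sum_congr rfl fun a _ => Finset.sum_congr rfl fun b _ => by ring
    ext s t
    rw [e]
    rcases s with i | i <;> rcases t with j | j
    · rfl
    · exact h0 i
    · exact (hF.metric.ip_comm hV _ _).trans (h0 j)
    · exact h1
  have key := mul_inv_mul_transpose (by simpa using hm) hdet hK
  have hDi : D⁻¹ = Matrix.fromBlocks h⁻¹ 0 0 1 := by
    refine Matrix.inv_eq_left_inv ?_
    simp only [D, Matrix.fromBlocks_multiply]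
    rw [hF.pull.inv_mul hy]
    simp
  rw [← key, hDi]
  simp only [K, Matrix.transpose_fromCols, Matrix.fromCols_mul_fromBlocks, Matrix.fromCols_mul_fromRows]
  ext a b
  simp [Matrix.vecMulVec_apply, Matrix.mul_apply]

theorem proj_of_equidim {g : Coord m → Matrix (Fin m) (Fin m) ℝ} {V : Set (Coord m)}
    {F : Coord m → Coord m} (hF : IsImmersionOn g F U V) (hy : y ∈ U) :
    jac F y * (pullComp g F y)⁻¹ * (jac F y).transpose = (g (F y))⁻¹ :=
  mul_inv_mul_transpose (by simp) (hF.pull.det_pos hy).ne'.isUnit (pullComp_eq_mul g F y).symm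

end Projection

/-! ### Changes of coordinates -/

section ChangeOfCoordinates

theorem ContDiffAt.eventually_differentiableAt {E E' : Type*} [NormedAddCommGroup E]
    [NormedSpace ℝ E] [NormedAddCommGroup E'] [NormedSpace ℝ E'] {f : E → E'} {x : E}
    (hf : ContDiffAt ℝ ∞ f x) : ∀ᶠ z in 𝓝 x, DifferentiableAt ℝ f z :=
  ((hf.of_le (m := 1) (by exact_mod_cast le_top)).eventually (by simp)).mono fun _ hz =>
    hz.differentiableAt (by simp)

variable {m N : ℕ}

namespace IsImmersionOn

variable {g : Coord m → Matrix (Fin m) (Fin m) ℝ} {V : Set (Coord m)} {F : Coord m → Coord m}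
  {U : Set (Coord m)} {y : Coord m} (hF : IsImmersionOn g F U V) (hy : y ∈ U)
include hF hy

/-- A map between spaces of equal dimension has no normal directions, so the Gauss equation applies
with ν = 0 and every extrinsic term vanishes. -/
theorem scalarComp_eq : scalarComp (pullComp g F) y = scalarComp g (F y) := by
  have hP : jac F y * (pullComp g F y)⁻¹ * (jac F y).transpose
      = (g (F y))⁻¹ - Matrix.vecMulVec 0 0 := by
    rw [proj_of_equidim hF hy]; ext; simp
  have z : ∀ u : Fin m → ℝ, ip (g (F y)) u 0 = 0 := fun u => by simp [ip]
  rw [hF.scalarComp_pull hy hP]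
  simp [z]

/-- The transformation law of Christoffel symbols. -/
theorem hess_eq (i j a : Fin m) :
    hess g F i j y a = ∑ k, christoffel (pullComp g F) k i j y * tang F k y a := by
  have hV := hF.mapsTo y hy
  have h1 : hess g F i j y = (jac F y * (pullComp g F y)⁻¹ * (jac F y).transpose).mulVec
      ((g (F y)).mulVec (hess g F i j y)) := by
    rw [proj_of_equidim hF hy, Matrix.mulVec_mulVec, hF.metric.inv_mul hV, Matrix.one_mulVec]
  rw [h1]
  have t : (jac F y).transpose.mulVec ((g (F y)).mulVec (hess g F i j y))
      = fun l => ip (g (F y)) (hess g F i j y) (tang F l y) := by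
    funext l
    rw [hF.metric.ip_comm hV, ip_eq_dotProduct]; rfl
  rw [← Matrix.mulVec_mulVec, ← Matrix.mulVec_mulVec, t]
  simp only [hF.christoffel_pull hy, Matrix.mulVec, dotProduct, jac, Matrix.of_apply]
  exact Finset.sum_congr rfl fun k _ => mul_comm _ _

/-- The chain rule for second derivatives leaves a term with second derivatives of F. By the
transformation law `hess_eq` the Christoffel term produces the same one, so the Hessian of u
transforms as a tensor; its trace is then handled by `sum_inv_mul_tang` and `proj_of_equidim`. -/
theorem laplaceComp_eq {u : Coord m → ℝ} (hu : ContDiffAt ℝ ∞ u (F y)) :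
    laplaceComp (pullComp g F) (fun z => u (F z)) y = laplaceComp g u (F y) := by
  have hV := hF.mapsTo y hy
  have hs := hF.smooth y hy
  have dF := hs.differentiableAt (by simp)
  have cu1 : ∀ a, ContDiffAt ℝ ∞ (fun z => pd a u (F z)) y := fun a =>
    (pd_contDiffAt (i := a) hu).comp y hs
  have ct := fun j a => contDiffAt_tang hs j a
  have e1 : ∀ j, pd j (fun z => u (F z)) =ᶠ[𝓝 y] fun z => ∑ a, pd a u (F z) * tang F j z a := by
    intro j
    filter_upwards [hF.pull.mem_nhds hy,
      hs.continuousAt.eventually (ContDiffAt.eventually_differentiableAt hu)] with z hz hz'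
    exact pd_comp hz' ((hF.smooth z hz).differentiableAt (by simp))
  have e2 : ∀ i j, pd i (pd j fun z => u (F z)) y
      = ∑ a, ∑ c, pd c (pd a u) (F y) * tang F j y a * tang F i y c
        + ∑ a, pd a u (F y) * pd i (fun z => tang F j z a) y := by
    intro i j
    rw [pd_congr (e1 j), pd_sum (F := fun a z => pd a u (F z) * tang F j z a) fun a _ =>
      ((cu1 a).mul (ct j a)).differentiableAt (by simp), ← Finset.sum_add_distrib]
    refine Finset.sum_congr rfl fun a _ => ?_
    rw [pd_mul ((cu1 a).differentiableAt (by simp)) ((ct j a).differentiableAt (by simp)),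
      pd_comp ((pd_contDiffAt hu).differentiableAt (by simp)) dF, Finset.sum_mul]
    congr 1
    exact Finset.sum_congr rfl fun c _ => by simp only [tang]; ring
  have e3 : ∀ i j, ∑ k, christoffel (pullComp g F) k i j y * pd k (fun z => u (F z)) y
      = ∑ a, pd a u (F y) * pd i (fun z => tang F j z a) y
        + ∑ a, ∑ c, (∑ e, christoffel g e c a (F y) * pd e u (F y)) * tang F j y a * tang F i y c := by
    intro i j
    have : ∑ k, christoffel (pullComp g F) k i j y * pd k (fun z => u (F z)) y
        = ∑ e, pd e u (F y) * hess g F i j y e := by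
      simp only [hF.hess_eq hy, (e1 _).self_of_nhds, Finset.mul_sum]
      rw [Finset.sum_comm]
      exact Finset.sum_congr rfl fun a _ => Finset.sum_congr rfl fun k _ => by ring
    rw [this]
    simp only [hess, covD, mul_add, Finset.sum_add_distrib, Finset.mul_sum, Finset.sum_mul]
    congr 1
    rw [Finset.sum_comm]
    conv_rhs => rw [Finset.sum_comm]
    refine Finset.sum_congr rfl fun c _ => ?_
    rw [Finset.sum_comm]
    exact Finset.sum_congr rfl fun a _ => Finset.sum_congr rfl fun e _ => by ring
  have e4 : ∀ i j, pd i (pd j fun z => u (F z)) y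
        - ∑ k, christoffel (pullComp g F) k i j y * pd k (fun z => u (F z)) y
      = ∑ a, ∑ c, (pd c (pd a u) (F y) - ∑ e, christoffel g e c a (F y) * pd e u (F y))
        * tang F j y a * tang F i y c := by
    intro i j
    rw [e2, e3]
    simp only [sub_mul, Finset.sum_sub_distrib]
    ring
  simp only [laplaceComp, e4]
  rw [hF.sum_inv_mul_tang hy, proj_of_equidim hF hy, Finset.sum_comm]
  exact Finset.sum_congr rfl fun c _ => Finset.sum_congr rfl fun a _ => by
    rw [hF.metric.inv_symm hV]

end IsImmersionOn

theorem laplaceComp_congr {g h : Coord m → Matrix (Fin m) (Fin m) ℝ} {u v : Coord m → ℝ}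
    {x : Coord m} (hgh : g =ᶠ[𝓝 x] h) (huv : u =ᶠ[𝓝 x] v) :
    laplaceComp g u x = laplaceComp h v x := by
  simp only [laplaceComp, hgh.self_of_nhds, (christoffel_eventuallyEq hgh _ _ _).self_of_nhds,
    pd_congr huv, pd_congr (pd_eventuallyEq huv)]

/-! ### Mean curvature in coordinates -/

/-- The mean curvature with respect to the normal vector `ν`. -/
def meanComp (g : Coord N → Matrix (Fin N) (Fin N) ℝ) (F : Coord m → Coord N) (ν : Fin N → ℝ)
    (y : Coord m) : ℝ :=
  ∑ i, ∑ j, (pullComp g F y)⁻¹ i j * -ip (g (F y)) (hess g F i j y) ν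

theorem tang_eventuallyEq {F F' : Coord m → Coord N} {y : Coord m} (h : F =ᶠ[𝓝 y] F') (i : Fin m) :
    tang F i =ᶠ[𝓝 y] tang F' i := by
  filter_upwards [h.eventuallyEq_nhds] with z hz
  funext a
  exact pd_congr (hz.mono fun w hw => by simp only [hw])

theorem hess_congr {g g' : Coord N → Matrix (Fin N) (Fin N) ℝ} {F F' : Coord m → Coord N}
    {y : Coord m} (h : F =ᶠ[𝓝 y] F') (hg : g =ᶠ[𝓝 (F y)] g') (i j : Fin m) :
    hess g F i j y = hess g' F' i j y := by
  have t := fun i => tang_eventuallyEq h i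
  funext a
  simp only [hess, covD, (t _).self_of_nhds, ← h.self_of_nhds,
    (christoffel_eventuallyEq hg _ _ _).self_of_nhds]
  congr 1
  exact pd_congr ((t j).mono fun w hw => by simp only [hw])

theorem meanComp_congr {g g' : Coord N → Matrix (Fin N) (Fin N) ℝ} {F F' : Coord m → Coord N}
    {y : Coord m} (h : F =ᶠ[𝓝 y] F') (hg : g =ᶠ[𝓝 (F y)] g') (ν : Fin N → ℝ) :
    meanComp g F ν y = meanComp g' F' ν y := by
  have t := fun i => tang_eventuallyEq h i
  have p : pullComp g F y = pullComp g' F' y := by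
    ext i j
    simp only [pullComp, Matrix.of_apply, (t _).self_of_nhds, ← h.self_of_nhds, hg.self_of_nhds]
  simp only [meanComp, p, hess_congr h hg, ← h.self_of_nhds, hg.self_of_nhds]

theorem tang_comp {L : ℕ} {F : Coord m → Coord N} {φ : Coord L → Coord m} {y : Coord L}
    (hF : DifferentiableAt ℝ F (φ y)) (hφ : DifferentiableAt ℝ φ y) (j : Fin L) (a : Fin N) :
    tang (fun z => F (φ z)) j y a = ∑ k, tang F k (φ y) a * tang φ j y k :=
  pd_comp (f := fun x => F x a) (differentiableAt_euclidean.1 hF a) hφ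

theorem ip_sum_sum {κ κ' : Type*} [Fintype κ] [Fintype κ'] (A : Matrix (Fin N) (Fin N) ℝ)
    (c : κ → ℝ) (d : κ' → ℝ) (u : κ → Fin N → ℝ) (v : κ' → Fin N → ℝ) :
    ip A (fun a => ∑ k, u k a * c k) (fun a => ∑ l, v l a * d l)
      = ∑ k, ∑ l, ip A (u k) (v l) * c k * d l := by
  have e : (fun a => ∑ l, v l a * d l) = fun a => ∑ l, d l * v l a := by
    funext a; exact Finset.sum_congr rfl fun l _ => mul_comm _ _
  rw [e, ip_sum_right]
  conv_rhs => rw [Finset.sum_comm]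
  refine Finset.sum_congr rfl fun l _ => ?_
  simp only [ip, Finset.mul_sum, Finset.sum_mul]
  have s : ∀ f : Fin N → Fin N → κ → ℝ, ∑ a, ∑ b, ∑ k, f a b k = ∑ k, ∑ a, ∑ b, f a b k := fun f => by
    rw [Finset.sum_comm' (t' := Finset.univ) (s' := fun _ => Finset.univ) (by simp)]
    rw [Finset.sum_congr rfl fun b _ => Finset.sum_comm]
    rw [Finset.sum_comm]
    exact Finset.sum_congr rfl fun k _ => Finset.sum_comm
  rw [s]
  exact Finset.sum_congr rfl fun k _ => Finset.sum_congr rfl fun a _ =>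
    Finset.sum_congr rfl fun b _ => by ring

theorem pullComp_comp {L : ℕ} (g : Coord N → Matrix (Fin N) (Fin N) ℝ) {F : Coord m → Coord N}
    {φ : Coord L → Coord m} {y : Coord L} (hF : DifferentiableAt ℝ F (φ y))
    (hφ : DifferentiableAt ℝ φ y) :
    pullComp g (fun z => F (φ z)) y = pullComp (pullComp g F) φ y := by
  ext i j
  have t : ∀ j, tang (fun z => F (φ z)) j y = fun a => ∑ k, tang F k (φ y) a * tang φ j y k :=
    fun j => funext fun a => tang_comp hF hφ j a
  simp only [pullComp, Matrix.of_apply, t, ip_sum_sum]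
  rfl

/-- The second fundamental form under a change of coordinates of the hypersurface. -/
theorem ip_hess_comp {L : ℕ} {g : Coord N → Matrix (Fin N) (Fin N) ℝ} {F : Coord m → Coord N}
    {φ : Coord L → Coord m} {y : Coord L} (hF : ContDiffAt ℝ ∞ F (φ y)) (hφ : ContDiffAt ℝ ∞ φ y)
    {ν : Fin N → ℝ} (hν : ∀ i, ip (g (F (φ y))) (tang F i (φ y)) ν = 0) (i j : Fin L) :
    ip (g (F (φ y))) (hess g (fun z => F (φ z)) i j y) ν
      = ∑ k, ∑ l, ip (g (F (φ y))) (hess g F k l (φ y)) ν * tang φ i y k * tang φ j y l := by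
  have dF := hF.differentiableAt (by simp)
  have dφ := hφ.differentiableAt (by simp)
  have e1 : ∀ j a, (fun z => tang (fun z => F (φ z)) j z a)
      =ᶠ[𝓝 y] fun z => ∑ l, tang F l (φ z) a * tang φ j z l := by
    intro j a
    filter_upwards [ContDiffAt.eventually_differentiableAt hφ,
      hφ.continuousAt.eventually (ContDiffAt.eventually_differentiableAt hF)] with z hz hz'
    exact tang_comp hz' hz j a
  have cT : ∀ l a, ContDiffAt ℝ ∞ (fun z => tang F l (φ z) a) y := fun l a =>
    (contDiffAt_tang hF l a).comp y hφ
  have e2 : ∀ a, pd i (fun z => tang (fun z => F (φ z)) j z a) y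
      = ∑ l, ∑ k, pd k (fun x => tang F l x a) (φ y) * tang φ i y k * tang φ j y l
        + ∑ l, tang F l (φ y) a * pd i (fun z => tang φ j z l) y := by
    intro a
    rw [pd_congr (e1 j a), pd_sum (F := fun l z => tang F l (φ z) a * tang φ j z l) fun l _ =>
      ((cT l a).mul (contDiffAt_tang hφ j l)).differentiableAt (by simp), ← Finset.sum_add_distrib]
    refine Finset.sum_congr rfl fun l _ => ?_
    rw [pd_mul ((cT l a).differentiableAt (by simp))
      ((contDiffAt_tang hφ j l).differentiableAt (by simp)),
      pd_comp (f := fun x => tang F l x a) ((contDiffAt_tang hF l a).differentiableAt (by simp)) dφ,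
      Finset.sum_mul]
    rfl
  have e3 : ∀ a, ∑ c, ∑ d, christoffel g a c d (F (φ y)) * tang (fun z => F (φ z)) i y c
        * tang (fun z => F (φ z)) j y d
      = ∑ l, ∑ k, (∑ c, ∑ d, christoffel g a c d (F (φ y)) * tang F k (φ y) c * tang F l (φ y) d)
        * tang φ i y k * tang φ j y l := by
    intro a
    have t : ∀ j, tang (fun z => F (φ z)) j y = fun a => ∑ k, tang F k (φ y) a * tang φ j y k :=
      fun j => funext fun a => tang_comp dF dφ j a
    have := ip_sum_sum (Matrix.of fun c d => christoffel g a c d (F (φ y))) (tang φ i y) (tang φ j y)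
      (fun k => tang F k (φ y)) (fun k => tang F k (φ y))
    simp only [ip, Matrix.of_apply] at this
    simp only [t]
    rw [this, Finset.sum_comm]
  -- The last sum, with second derivatives of φ, is tangent to F. It is the only nontensorial term,
  -- and pairing with the normal vector kills it by `hν`.
  have e4 : hess g (fun z => F (φ z)) i j y = fun a =>
      (∑ l, (∑ k, hess g F k l (φ y) a * tang φ i y k) * tang φ j y l)
      + ∑ l, tang F l (φ y) a * pd i (fun z => tang φ j z l) y := by
    funext a
    change pd i (fun z => tang (fun z => F (φ z)) j z a) y
      + ∑ c, ∑ d, christoffel g a c d (F (φ y)) * tang (fun z => F (φ z)) i y c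
        * tang (fun z => F (φ z)) j y d = _
    rw [e2, e3]
    simp only [hess, covD, add_mul, Finset.sum_mul, Finset.sum_add_distrib]
    ring
  have l1 : ∀ (κ : Type) [Fintype κ] (u : κ → Fin N → ℝ) (c : κ → ℝ),
      ip (g (F (φ y))) (fun a => ∑ k, u k a * c k) ν = ∑ k, ip (g (F (φ y))) (u k) ν * c k := by
    intro κ _ u c
    have := ip_sum_sum (g (F (φ y))) c (fun _ : Unit => 1) u (fun _ => ν)
    simpa using this
  rw [e4, ip_add_left, l1 _ (fun l => tang F l (φ y))]
  rw [l1 _ (fun l a => ∑ k, hess g F k l (φ y) a * tang φ i y k)]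
  simp only [l1 _ (fun k => hess g F k _ (φ y)), hν, zero_mul, Finset.sum_const_zero, add_zero,
    Finset.sum_mul]
  rw [Finset.sum_comm]

/-- For fixed ν the second fundamental form is a tensor by `ip_hess_comp`, and φ is an isometry onto
its image for the induced metrics, so the traces agree. -/
theorem meanComp_comp_right {g : Coord N → Matrix (Fin N) (Fin N) ℝ} {F : Coord m → Coord N}
    {φ : Coord m → Coord m} {y : Coord m} {U U' : Set (Coord m)}
    (hφ : IsImmersionOn (pullComp g F) φ U' U) (hy : y ∈ U') (hF : ContDiffAt ℝ ∞ F (φ y))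
    {ν : Fin N → ℝ} (hν : ∀ i, ip (g (F (φ y))) (tang F i (φ y)) ν = 0) :
    meanComp g (fun z => F (φ z)) ν y = meanComp g F ν (φ y) := by
  have sφ := hφ.smooth y hy
  simp only [meanComp, ip_hess_comp hF sφ hν,
    pullComp_comp g (hF.differentiableAt (by simp)) (sφ.differentiableAt (by simp))]
  have e : ∀ i j, -∑ k, ∑ l, ip (g (F (φ y))) (hess g F k l (φ y)) ν * tang φ i y k * tang φ j y l
      = ∑ l, ∑ k, -ip (g (F (φ y))) (hess g F k l (φ y)) ν * tang φ j y l * tang φ i y k := by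
    intro i j
    rw [Finset.sum_comm]
    simp only [← Finset.sum_neg_distrib]
    exact Finset.sum_congr rfl fun _ _ => Finset.sum_congr rfl fun _ _ => by ring
  simp only [e]
  rw [hφ.sum_inv_mul_tang hy, proj_of_equidim hφ hy, Finset.sum_comm]
  exact Finset.sum_congr rfl fun k _ => Finset.sum_congr rfl fun l _ => by
    rw [hφ.metric.inv_symm (hφ.mapsTo y hy)]

/-- The second derivatives of the immersion under a change of coordinates of the target. -/
theorem hess_comp_left {g : Coord N → Matrix (Fin N) (Fin N) ℝ} {F : Coord m → Coord N}
    {ψ : Coord N → Coord N} {V V' : Set (Coord N)} {y : Coord m}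
    (hψ : IsImmersionOn g ψ V V') (hy : F y ∈ V) (hF : ContDiffAt ℝ ∞ F y) (i j : Fin m)
    (a : Fin N) : hess g (fun z => ψ (F z)) i j y a
      = ∑ e, tang ψ e (F y) a * hess (pullComp g ψ) F i j y e := by
  have sψ := hψ.smooth _ hy
  have dψ := sψ.differentiableAt (by simp)
  have dF := hF.differentiableAt (by simp)
  have e1 : (fun z => tang (fun z => ψ (F z)) j z a)
      =ᶠ[𝓝 y] fun z => ∑ e, tang ψ e (F z) a * tang F j z e := by
    filter_upwards [ContDiffAt.eventually_differentiableAt hF,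
      hF.continuousAt.eventually (ContDiffAt.eventually_differentiableAt sψ)] with z hz hz'
    exact tang_comp hz' hz j a
  have cT : ∀ e, ContDiffAt ℝ ∞ (fun z => tang ψ e (F z) a) y := fun e =>
    (contDiffAt_tang sψ e a).comp y hF
  have e2 : pd i (fun z => tang (fun z => ψ (F z)) j z a) y
      = ∑ d, ∑ c, pd c (fun x => tang ψ d x a) (F y) * tang F i y c * tang F j y d
        + ∑ e, tang ψ e (F y) a * pd i (fun z => tang F j z e) y := by
    rw [pd_congr e1, pd_sum (F := fun e z => tang ψ e (F z) a * tang F j z e) fun e _ =>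
      ((cT e).mul (contDiffAt_tang hF j e)).differentiableAt (by simp), ← Finset.sum_add_distrib]
    refine Finset.sum_congr rfl fun e _ => ?_
    rw [pd_mul ((cT e).differentiableAt (by simp))
      ((contDiffAt_tang hF j e).differentiableAt (by simp)),
      pd_comp (f := fun x => tang ψ e x a) ((contDiffAt_tang sψ e a).differentiableAt (by simp)) dF,
      Finset.sum_mul]
    rfl
  have e3 : ∑ c, ∑ d, christoffel g a c d (ψ (F y)) * tang (fun z => ψ (F z)) i y c
        * tang (fun z => ψ (F z)) j y d
      = ∑ d, ∑ c, (∑ e, ∑ f, christoffel g a e f (ψ (F y)) * tang ψ c (F y) e * tang ψ d (F y) f)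
        * tang F i y c * tang F j y d := by
    have t : ∀ j, tang (fun z => ψ (F z)) j y = fun a => ∑ k, tang ψ k (F y) a * tang F j y k :=
      fun j => funext fun a => tang_comp dψ dF j a
    have := ip_sum_sum (Matrix.of fun c d => christoffel g a c d (ψ (F y))) (tang F i y) (tang F j y)
      (fun k => tang ψ k (F y)) (fun k => tang ψ k (F y))
    simp only [ip, Matrix.of_apply] at this
    simp only [t]
    rw [this, Finset.sum_comm]
  have e4 : ∀ c d, pd c (fun x => tang ψ d x a) (F y)
      + ∑ e, ∑ f, christoffel g a e f (ψ (F y)) * tang ψ c (F y) e * tang ψ d (F y) f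
      = ∑ k, christoffel (pullComp g ψ) k c d (F y) * tang ψ k (F y) a :=
    fun c d => hψ.hess_eq hy c d a
  change pd i (fun z => tang (fun z => ψ (F z)) j z a) y
      + ∑ c, ∑ d, christoffel g a c d (ψ (F y)) * tang (fun z => ψ (F z)) i y c
        * tang (fun z => ψ (F z)) j y d = _
  rw [e2, e3, add_right_comm, ← Finset.sum_add_distrib]
  simp only [← Finset.sum_add_distrib, ← add_mul, e4]
  simp only [hess, covD, mul_add, Finset.sum_add_distrib, Finset.mul_sum, Finset.sum_mul]
  rw [add_comm]
  congr 1
  rw [Finset.sum_comm]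
  conv_rhs => rw [Finset.sum_comm]
  refine Finset.sum_congr rfl fun c _ => ?_
  conv_rhs => rw [Finset.sum_comm]
  exact Finset.sum_congr rfl fun d _ => Finset.sum_congr rfl fun e _ => by ring

/-- The differential of ψ carries both the second derivatives and the normal vector, so pairing them
with g is the same as pairing the originals with the pulled back metric. -/
theorem meanComp_comp_left {g : Coord N → Matrix (Fin N) (Fin N) ℝ} {F : Coord m → Coord N}
    {ψ : Coord N → Coord N} {V V' : Set (Coord N)} {y : Coord m}
    (hψ : IsImmersionOn g ψ V V') (hy : F y ∈ V) (hF : ContDiffAt ℝ ∞ F y) (ν : Fin N → ℝ) :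
    meanComp g (fun z => ψ (F z)) (fun a => ∑ e, tang ψ e (F y) a * ν e) y
      = meanComp (pullComp g ψ) F ν y := by
  have dψ := (hψ.smooth _ hy).differentiableAt (by simp)
  have h : ∀ i j, hess g (fun z => ψ (F z)) i j y
      = fun a => ∑ e, tang ψ e (F y) a * hess (pullComp g ψ) F i j y e :=
    fun i j => funext fun a => hess_comp_left hψ hy hF i j a
  simp only [meanComp, pullComp_comp g dψ (hF.differentiableAt (by simp)), h, ip_sum_sum]
  rfl

end ChangeOfCoordinates

end Willmore

namespace Willmore

open Filter Topology

/-! ### The Laplacian in coordinates -/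

section Laplacian

variable {m : ℕ}

theorem pd_prod {κ : Type*} [DecidableEq κ] (s : Finset κ) {f : κ → Coord m → ℝ} {x : Coord m}
    (hf : ∀ k ∈ s, DifferentiableAt ℝ (f k) x) (i : Fin m) :
    pd i (fun y => ∏ k ∈ s, f k y) x = ∑ k ∈ s, (∏ j ∈ s.erase k, f j x) * pd i (f k) x := by
  have := HasFDerivAt.finsetProd fun k hk => (hf k hk).hasFDerivAt
  simp only [pd]
  rw [this.fderiv]
  simp

/-- Jacobi's formula for the derivative of a determinant. -/
theorem pd_det {κ : Type*} [Fintype κ] [DecidableEq κ] {A : Coord m → Matrix κ κ ℝ} {x : Coord m}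
    (hA : ∀ k l, DifferentiableAt ℝ (fun y => A y k l) x) (hx : (A x).det ≠ 0) (i : Fin m) :
    pd i (fun y => (A y).det) x
      = (A x).det * ∑ k, ∑ l, (A x)⁻¹ k l * pd i (fun y => A y l k) x := by
  have dP : ∀ σ : Equiv.Perm κ, DifferentiableAt ℝ (fun y => ∏ k, A y (σ k) k) x := fun σ =>
    (HasFDerivAt.finsetProd fun k _ => (hA (σ k) k).hasFDerivAt).differentiableAt
  -- The determinant is differentiated one column at a time; Cramer's rule then evaluates the
  -- determinant with a replaced column through the adjugate.
  have h1 : pd i (fun y => (A y).det) x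
      = ∑ k, ((A x).updateCol k fun l => pd i (fun y => A y l k) x).det := by
    simp only [Matrix.det_apply']
    rw [pd_sum (F := fun (σ : Equiv.Perm κ) y => ((Equiv.Perm.sign σ : ℤ) : ℝ) * ∏ k, A y (σ k) k)
      fun σ _ => (differentiableAt_const _).mul (dP σ),
      Finset.sum_comm]
    refine Finset.sum_congr rfl fun σ _ => ?_
    rw [pd_const_mul _ (dP σ),
      pd_prod (f := fun k y => A y (σ k) k) _ fun k _ => hA _ _, Finset.mul_sum]
    refine Finset.sum_congr rfl fun k _ => ?_
    rw [← Finset.mul_prod_erase Finset.univ _ (Finset.mem_univ k), Matrix.updateCol_self]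
    congr 1
    rw [mul_comm]
    congr 1
    refine Finset.prod_congr rfl fun j hj => ?_
    rw [Matrix.updateCol_ne (Finset.ne_of_mem_erase hj)]
  rw [h1, Finset.mul_sum]
  refine Finset.sum_congr rfl fun k _ => ?_
  rw [← Matrix.cramer_apply, Matrix.cramer_eq_adjugate_mulVec, Matrix.inv_def,
    Ring.inverse_eq_inv']
  simp only [Matrix.mulVec, dotProduct, Matrix.smul_apply, smul_eq_mul, Finset.mul_sum]
  exact Finset.sum_congr rfl fun l _ => by field_simp

theorem pd_sqrt {f : Coord m → ℝ} {x : Coord m} (hf : DifferentiableAt ℝ f x) (hx : 0 < f x)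
    (i : Fin m) : pd i (fun y => Real.sqrt (f y)) x = pd i f x / (2 * Real.sqrt (f x)) := by
  simp only [pd]
  rw [fderiv_sqrt hf hx.ne']
  simp [div_eq_inv_mul]

theorem pd_log {f : Coord m → ℝ} {x : Coord m} (hf : DifferentiableAt ℝ f x) (hx : f x ≠ 0)
    (i : Fin m) : pd i (fun y => Real.log (f y)) x = pd i f x * (f x)⁻¹ := by
  simp only [pd]
  rw [fderiv.log hf hx]
  simp [mul_comm]

theorem pd_inv {f : Coord m → ℝ} {x : Coord m} (hf : DifferentiableAt ℝ f x) (hx : f x ≠ 0)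
    (i : Fin m) : pd i (fun y => (f y)⁻¹) x = -pd i f x / f x ^ 2 := by
  have := (hasDerivAt_inv hx).comp_hasFDerivAt x hf.hasFDerivAt
  simp only [pd]
  rw [show (fun y => (f y)⁻¹) = (fun y => y⁻¹) ∘ f from rfl, this.fderiv]
  simp [div_eq_inv_mul]

theorem laplaceComp_sum (g : Coord m → Matrix (Fin m) (Fin m) ℝ) {x : Coord m} {κ : Type*}
    (s : Finset κ) {u : κ → Coord m → ℝ} (hu : ∀ k ∈ s, ContDiffAt ℝ ∞ (u k) x) :
    laplaceComp g (fun y => ∑ k ∈ s, u k y) x = ∑ k ∈ s, laplaceComp g (u k) x := by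
  have e1 : ∀ j, pd j (fun y => ∑ k ∈ s, u k y) =ᶠ[𝓝 x] fun y => ∑ k ∈ s, pd j (u k) y := by
    intro j
    have : ∀ᶠ y in 𝓝 x, ∀ k ∈ s, DifferentiableAt ℝ (u k) y :=
      (Filter.eventually_all_finset s).2 fun k hk => ContDiffAt.eventually_differentiableAt (hu k hk)
    filter_upwards [this] with y hy using pd_sum hy
  have e2 : ∀ i j, pd i (pd j fun y => ∑ k ∈ s, u k y) x = ∑ k ∈ s, pd i (pd j (u k)) x := by
    intro i j
    rw [pd_congr (e1 j), pd_sum (F := fun k => pd j (u k)) fun k hk =>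
      (pd_contDiffAt (hu k hk)).differentiableAt (by simp)]
  simp only [laplaceComp, e2, (e1 _).self_of_nhds]
  conv_rhs => rw [Finset.sum_comm]
  refine Finset.sum_congr rfl fun i _ => ?_
  conv_rhs => rw [Finset.sum_comm]
  refine Finset.sum_congr rfl fun j _ => ?_
  rw [← Finset.mul_sum, Finset.sum_sub_distrib, Finset.sum_comm (s := s)]
  simp only [Finset.mul_sum]

namespace IsMetricOn

variable {g : Coord m → Matrix (Fin m) (Fin m) ℝ} {V : Set (Coord m)} {x : Coord m}
  (hg : IsMetricOn g V) (hx : x ∈ V)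
include hg hx

/-- Differentiate g g⁻¹ = 1 and multiply by g⁻¹ from the left. -/
theorem pd_inv_apply (c i j : Fin m) : pd c (fun y => (g y)⁻¹ i j) x
    = -∑ a, ∑ b, (g x)⁻¹ i a * pd c (fun y => g y a b) x * (g x)⁻¹ b j := by
  have dg := fun a b => (hg.smooth x hx a b).differentiableAt (by simp)
  have di := fun a b => (hg.contDiffAt_inv hx a b).differentiableAt (by simp)
  have e : ∀ a, ∑ b, (pd c (fun y => g y a b) x * (g x)⁻¹ b j
      + g x a b * pd c (fun y => (g y)⁻¹ b j) x) = 0 := by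
    intro a
    have h0 : pd c (fun y => ∑ b, g y a b * (g y)⁻¹ b j) x = 0 := by
      rw [pd_congr (g := fun _ => if a = j then 1 else 0)
        (by filter_upwards [hg.mem_nhds hx] with y hy using hg.sum_mul_inv hy a j), pd_const]
    rw [pd_sum (F := fun b y => g y a b * (g y)⁻¹ b j) fun b _ => (dg a b).mul (di b j)] at h0
    rw [← h0]
    exact Finset.sum_congr rfl fun b _ => (pd_mul (dg a b) (di b j)).symm
  have e2 : ∑ a, (g x)⁻¹ i a * ∑ b, g x a b * pd c (fun y => (g y)⁻¹ b j) x
      = pd c (fun y => (g y)⁻¹ i j) x := by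
    simp only [Finset.mul_sum]
    rw [Finset.sum_comm]
    simp only [← mul_assoc, ← Finset.sum_mul, hg.sum_inv_mul hx]
    simp
  have e3 : ∀ a, ∑ b, g x a b * pd c (fun y => (g y)⁻¹ b j) x
      = -∑ b, pd c (fun y => g y a b) x * (g x)⁻¹ b j := by
    intro a
    have := e a
    rw [Finset.sum_add_distrib] at this
    linarith
  rw [← e2]
  simp only [e3, mul_neg, Finset.sum_neg_distrib, Finset.mul_sum, mul_assoc]

theorem contDiffAt_sqrt_det : ContDiffAt ℝ ∞ (fun y => Real.sqrt (g y).det) x :=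
  (contDiffAt_det (hg.smooth x hx)).sqrt (hg.det_pos hx).ne'

/-- Jacobi's formula together with `pd_metric`. The two symbols have equal traces, and the resulting
factor 2 cancels the one from the square root. -/
theorem pd_sqrt_det (i : Fin m) : pd i (fun y => Real.sqrt (g y).det) x
    = Real.sqrt (g x).det * ∑ k, ∑ l, (g x)⁻¹ k l * christoffelLow g k i l x := by
  have hd := hg.det_pos hx
  have dg := fun a b => (hg.smooth x hx a b).differentiableAt (by simp)
  rw [pd_sqrt ((contDiffAt_det (hg.smooth x hx)).differentiableAt (by simp)) hd,
    pd_det dg hd.ne']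
  have e : ∑ k, ∑ l, (g x)⁻¹ k l * pd i (fun y => g y l k) x
      = 2 * ∑ k, ∑ l, (g x)⁻¹ k l * christoffelLow g k i l x := by
    have e1 : ∑ k, ∑ l, (g x)⁻¹ k l * christoffelLow g l i k x
        = ∑ k, ∑ l, (g x)⁻¹ k l * christoffelLow g k i l x := by
      rw [Finset.sum_comm]
      exact Finset.sum_congr rfl fun a _ => Finset.sum_congr rfl fun b _ => by
        rw [hg.inv_symm hx]
    simp only [hg.pd_metric hx, mul_add, Finset.sum_add_distrib, e1]
    ring
  rw [e]
  have hs : Real.sqrt (g x).det ≠ 0 := (Real.sqrt_pos.2 hd).ne'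
  have hss : (g x).det = Real.sqrt (g x).det * Real.sqrt (g x).det := (Real.mul_self_sqrt hd.le).symm
  rw [div_eq_iff (by positivity)]
  conv_lhs => rw [hss]
  ring

/-- The Laplacian as a divergence. -/
theorem laplaceComp_mul_sqrt_det {u : Coord m → ℝ} (hu : ContDiffAt ℝ ∞ u x) :
    laplaceComp g u x * Real.sqrt (g x).det
      = ∑ i, pd i (fun y => Real.sqrt (g y).det * ∑ j, (g y)⁻¹ i j * pd j u y) x := by
  have di := fun a b => (hg.contDiffAt_inv hx a b).differentiableAt (by simp)
  have du := fun j => (pd_contDiffAt (i := j) hu).differentiableAt (by simp)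
  have ds := (hg.contDiffAt_sqrt_det hx).differentiableAt (by simp)
  have e1 : ∀ i, pd i (fun y => Real.sqrt (g y).det * ∑ j, (g y)⁻¹ i j * pd j u y) x
      = Real.sqrt (g x).det * (∑ j, (g x)⁻¹ i j * pd i (pd j u) x
        + ∑ j, ((∑ k, ∑ l, (g x)⁻¹ k l * christoffelLow g k i l x) * (g x)⁻¹ i j
          + pd i (fun y => (g y)⁻¹ i j) x) * pd j u x) := by
    intro i
    have dm : ∀ j, DifferentiableAt ℝ (fun y => (g y)⁻¹ i j * pd j u y) x := fun j =>
      (di i j).mul (du j)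
    rw [pd_mul ds (DifferentiableAt.fun_sum fun j _ => dm j), hg.pd_sqrt_det hx,
      pd_sum (F := fun j y => (g y)⁻¹ i j * pd j u y) fun j _ => dm j]
    have : ∀ j, pd i (fun y => (g y)⁻¹ i j * pd j u y) x
        = pd i (fun y => (g y)⁻¹ i j) x * pd j u x + (g x)⁻¹ i j * pd i (pd j u) x :=
      fun j => pd_mul (di i j) (du j)
    simp only [this, add_mul, Finset.sum_add_distrib, mul_assoc]
    rw [← Finset.mul_sum]
    ring
  -- The coefficient of ∂ⱼu. Differentiating the inverse metric yields two Christoffel terms: one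
  -- (`a1`) cancels the derivative of the density, the other (`a2`) is the first order term of the
  -- Laplacian.
  have e2 : ∀ j, ∑ i, ((∑ k, ∑ l, (g x)⁻¹ k l * christoffelLow g k i l x) * (g x)⁻¹ i j
      + pd i (fun y => (g y)⁻¹ i j) x) = -∑ i, ∑ k, (g x)⁻¹ i k * christoffel g j i k x := by
    intro j
    have a1 : ∑ i, (∑ k, ∑ l, (g x)⁻¹ k l * christoffelLow g k i l x) * (g x)⁻¹ i j
        = ∑ i, ∑ a, ∑ b, (g x)⁻¹ i a * christoffelLow g a i b x * (g x)⁻¹ b j := by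
      simp only [Finset.sum_mul]
      conv_rhs => rw [Finset.sum_comm' (t' := Finset.univ) (s' := fun _ => Finset.univ) (by simp)]
      rw [Finset.sum_comm]
      refine Finset.sum_congr rfl fun a _ => ?_
      rw [Finset.sum_comm]
      exact Finset.sum_congr rfl fun l _ => Finset.sum_congr rfl fun b _ => by
        rw [hg.inv_symm hx a l, hg.christoffelLow_comm hx a b l]
    have a2 : ∑ i, ∑ a, ∑ b, (g x)⁻¹ i a * christoffelLow g b i a x * (g x)⁻¹ b j
        = ∑ i, ∑ k, (g x)⁻¹ i k * christoffel g j i k x := by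
      simp only [christoffel_eq_sum_christoffelLow, Finset.mul_sum]
      exact Finset.sum_congr rfl fun i _ => Finset.sum_congr rfl fun a _ =>
        Finset.sum_congr rfl fun b _ => by rw [hg.inv_symm hx j b]; ring
    simp only [Finset.sum_add_distrib, hg.pd_inv_apply hx, hg.pd_metric hx, mul_add, add_mul,
      Finset.sum_neg_distrib, a1, a2]
    ring
  simp only [e1]
  rw [← Finset.mul_sum, Finset.sum_add_distrib, mul_comm]
  congr 1
  rw [Finset.sum_comm (f := fun i j => (_ + _) * pd j u x)]
  simp only [← Finset.sum_mul, e2, laplaceComp, mul_sub, Finset.sum_sub_distrib]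
  rw [sub_eq_add_neg]
  congr 1
  simp only [neg_mul, Finset.sum_neg_distrib, Finset.mul_sum, Finset.sum_mul]
  congr 1
  conv_rhs => rw [Finset.sum_comm]
  refine Finset.sum_congr rfl fun i _ => ?_
  conv_rhs => rw [Finset.sum_comm]
  exact Finset.sum_congr rfl fun k _ => Finset.sum_congr rfl fun j _ => by ring

/-- Δ log u = Δu/u - |∇u|²/u², and the gradient term has a sign because the inverse metric is
positive definite. -/
theorem laplaceComp_log_le {u : Coord m → ℝ} (hu : ContDiffAt ℝ ∞ u x) (hpos : 0 < u x) :
    laplaceComp g (fun y => Real.log (u y)) x ≤ laplaceComp g u x / u x := by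
  have e1 : ∀ j, pd j (fun y => Real.log (u y)) =ᶠ[𝓝 x] fun y => pd j u y * (u y)⁻¹ := by
    intro j
    filter_upwards [ContDiffAt.eventually_differentiableAt hu,
      hu.continuousAt.eventually_ne hpos.ne'] with y hy hy'
    exact pd_log hy hy' j
  have du := hu.differentiableAt (by simp)
  have e2 : ∀ i j, pd i (pd j fun y => Real.log (u y)) x
      = pd i (pd j u) x * (u x)⁻¹ - pd i u x * pd j u x * ((u x)⁻¹) ^ 2 := by
    intro i j
    rw [pd_congr (e1 j), pd_mul ((pd_contDiffAt hu).differentiableAt (by simp)) (du.fun_inv hpos.ne'),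
      pd_inv du hpos.ne']
    field_simp
    ring
  have e3 : laplaceComp g (fun y => Real.log (u y)) x
      = laplaceComp g u x / u x
        - (∑ i, ∑ j, (g x)⁻¹ i j * pd i u x * pd j u x) * ((u x)⁻¹) ^ 2 := by
    simp only [laplaceComp, e2, (e1 _).self_of_nhds, div_eq_mul_inv, Finset.sum_mul,
      ← Finset.sum_sub_distrib, mul_assoc]
    refine Finset.sum_congr rfl fun i _ => Finset.sum_congr rfl fun j _ => ?_
    have : ∑ k, christoffel g k i j x * (pd k u x * (u x)⁻¹)
        = (∑ k, christoffel g k i j x * pd k u x) * (u x)⁻¹ := by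
      rw [Finset.sum_mul]; exact Finset.sum_congr rfl fun _ _ => by ring
    rw [this]
    ring
  have hn : 0 ≤ ∑ i, ∑ j, (g x)⁻¹ i j * pd i u x * pd j u x := by
    have := (hg.posDef x hx).inv.posSemidef.dotProduct_mulVec_nonneg fun i => pd i u x
    have h := ip_eq_dotProduct (g x)⁻¹ (fun i => pd i u x) (fun i => pd i u x)
    simp only [ip] at h
    rw [h]
    simpa using this
  rw [e3]
  have : 0 ≤ (∑ i, ∑ j, (g x)⁻¹ i j * pd i u x * pd j u x) * ((u x)⁻¹) ^ 2 := by positivity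
  linarith

theorem contDiffAt_laplaceComp {u : Coord m → ℝ} (hu : ContDiffAt ℝ ∞ u x) :
    ContDiffAt ℝ ∞ (laplaceComp g u) x := by
  refine ContDiffAt.sum fun i _ => ContDiffAt.sum fun j _ => (hg.contDiffAt_inv hx i j).mul ?_
  exact (pd_contDiffAt (pd_contDiffAt hu)).sub (ContDiffAt.sum fun k _ =>
    (hg.contDiffAt_christoffel hx k i j).mul (pd_contDiffAt hu))

end IsMetricOn

-- Integration by parts against the constant function 1.
open MeasureTheory in
theorem integral_pd_eq_zero {f : Coord m → ℝ} (hf : ContDiff ℝ ∞ f) (hc : HasCompactSupport f)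
    (i : Fin m) : ∫ x, pd i f x = 0 := by
  have h1 : Integrable (fun x => fderiv ℝ f x (basisVec i)) := by
    refine Continuous.integrable_of_hasCompactSupport ?_ ?_
    · exact (hf.continuous_fderiv (by simp)).clm_apply continuous_const
    · exact hc.fderiv_apply (𝕜 := ℝ) _
  have h2 : Integrable f := hf.continuous.integrable_of_hasCompactSupport hc
  have := integral_mul_fderiv_eq_neg_fderiv_mul_of_integrable (μ := volume) (f := fun _ => (1 : ℝ))
    (g := f) (v := basisVec i) (by simp) (by simpa using h1) (by simpa using h2)
    (fun _ _ => differentiableAt_const _) (fun x _ => hf.differentiable (by simp) x)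
  simpa [pd] using this

open MeasureTheory in
/-- The divergence theorem for the Laplacian of a function with compact support. -/
theorem IsMetricOn.setIntegral_laplaceComp {g : Coord m → Matrix (Fin m) (Fin m) ℝ}
    {V K : Set (Coord m)} (hg : IsMetricOn g V) (hK : IsCompact K) (hKV : K ⊆ V)
    {u : Coord m → ℝ} (hu : ∀ x ∈ V, ContDiffAt ℝ ∞ u x) (hu0 : ∀ x ∈ V, x ∉ K → u x = 0) :
    ∫ x in V, laplaceComp g u x * Real.sqrt (g x).det = 0 := by
  have hKo : IsOpen Kᶜ := hK.isClosed.isOpen_compl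
  -- The flux √det g · ∇u, extended by zero outside V. It vanishes off K, and K is compact inside V,
  -- so the extension is smooth on the whole space with compact support.
  set W : Fin m → Coord m → ℝ := fun i =>
    V.indicator fun y => Real.sqrt (g y).det * ∑ j, (g y)⁻¹ i j * pd j u y with hW
  have eqV : ∀ x ∈ V, ∀ i, W i =ᶠ[𝓝 x] fun y => Real.sqrt (g y).det * ∑ j, (g y)⁻¹ i j * pd j u y := by
    intro x hx i
    filter_upwards [hg.mem_nhds hx] with y hy
    simp only [hW, Set.indicator_of_mem hy]
  have eqK : ∀ x ∉ K, ∀ i, W i x = 0 := by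
    intro x hx i
    by_cases hxV : x ∈ V
    · have : u =ᶠ[𝓝 x] fun _ => 0 := by
        filter_upwards [hg.mem_nhds hxV, hKo.mem_nhds hx] with y hy hy' using hu0 y hy hy'
      simp only [hW, Set.indicator_of_mem hxV, pd_congr this, pd_const]
      simp
    · simp only [hW, Set.indicator_of_notMem hxV]
  have eqK' : ∀ x ∉ K, ∀ i, W i =ᶠ[𝓝 x] fun _ => 0 := by
    intro x hx i
    filter_upwards [hKo.mem_nhds hx] with y hy using eqK y hy i
  have smooth : ∀ i, ContDiff ℝ ∞ (W i) := by
    intro i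
    rw [contDiff_iff_contDiffAt]
    intro x
    by_cases hx : x ∈ V
    · refine ContDiffAt.congr_of_eventuallyEq ?_ (eqV x hx i)
      exact (hg.contDiffAt_sqrt_det hx).mul (ContDiffAt.sum fun j _ =>
        (hg.contDiffAt_inv hx i j).mul (pd_contDiffAt (hu x hx)))
    · exact contDiffAt_const.congr_of_eventuallyEq (eqK' x (fun h => hx (hKV h)) i)
  have supp : ∀ i, HasCompactSupport (W i) := fun i =>
    HasCompactSupport.intro hK fun x hx => eqK x hx i
  have e : ∫ x in V, laplaceComp g u x * Real.sqrt (g x).det = ∫ x, ∑ i, pd i (W i) x := by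
    rw [← integral_indicator hg.isOpen.measurableSet]
    congr 1
    funext x
    by_cases hx : x ∈ V
    · rw [Set.indicator_of_mem hx, hg.laplaceComp_mul_sqrt_det hx (hu x hx)]
      exact Finset.sum_congr rfl fun i _ => (pd_congr (eqV x hx i)).symm
    · rw [Set.indicator_of_notMem hx]
      refine (Finset.sum_eq_zero fun i _ => ?_).symm
      rw [pd_congr (eqK' x (fun h => hx (hKV h)) i), pd_const]
  rw [e, integral_finsetSum]
  · exact Finset.sum_eq_zero fun i _ => integral_pd_eq_zero (smooth i) (supp i) i
  · intro i _
    refine Continuous.integrable_of_hasCompactSupport ?_ ?_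
    · exact ((smooth i).continuous_fderiv (by simp)).clm_apply continuous_const
    · exact (supp i).fderiv_apply (𝕜 := ℝ) _

end Laplacian

end Willmore

namespace Willmore

open Filter Topology

/-! ### Maps in charts -/

section Charts

variable {m N : ℕ}
  {X : Type*} [TopologicalSpace X] [ChartedSpace (Coord m) X]
  {Y : Type*} [TopologicalSpace Y] [ChartedSpace (Coord N) Y]

/-- The components of a tangent vector at `z` in the preferred chart at `q`. -/
def vecAt (q z : X) (v : TangentSpace (𝓡 m) z) : Coord m :=
  mfderiv (𝓡 m) (𝓡 m) (extChartAt (𝓡 m) q) z v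

/-- The map `ι` in the preferred charts at `p` and `q`. -/
def rep (ι : X → Y) (p : X) (q : Y) (y : Coord m) : Coord N :=
  extChartAt (𝓡 N) q (ι ((extChartAt (𝓡 m) p).symm y))

/-- The domain of `rep ι p q`. -/
def repDom (N : ℕ) [ChartedSpace (Coord N) Y] (ι : X → Y) (p : X) (q : Y) : Set (Coord m) :=
  (extChartAt (𝓡 m) p).target ∩ (extChartAt (𝓡 m) p).symm ⁻¹' (ι ⁻¹' (extChartAt (𝓡 N) q).source)

/-- The pullback of a field of bilinear forms. -/
def pullField (g : BilinField (m := N) Y) (ι : X → Y) : BilinField (m := m) X :=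
  fun p v w => g (ι p) (mfderiv (𝓡 m) (𝓡 N) ι p v) (mfderiv (𝓡 m) (𝓡 N) ι p w)

theorem pullField_id (g : BilinField (m := m) X) : pullField g id = g := by
  funext p v w
  simp [pullField]

/-- A `BilinField` is a bare function of two vectors, so bilinearity is carried along as the
existence of a bilinear map at each point. -/
theorem exists_bilin_pullField {g : BilinField (m := N) Y}
    (hg : ∀ p, ∃ B : Coord N →ₗ[ℝ] Coord N →ₗ[ℝ] ℝ, ∀ v w : Coord N, g p v w = B v w) (ι : X → Y)
    (p : X) : ∃ B : Coord m →ₗ[ℝ] Coord m →ₗ[ℝ] ℝ,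
      ∀ v w : Coord m, pullField g ι p v w = B v w := by
  obtain ⟨B, hB⟩ := hg (ι p)
  let L : Coord m →L[ℝ] Coord N := mfderiv (𝓡 m) (𝓡 N) ι p
  exact ⟨B.compl₁₂ L L, fun v w => hB _ _⟩

/-- A field of symmetric bilinear forms whose components in charts are smooth and positive
definite. -/
structure IsSmoothMetric (g : BilinField (m := m) X) : Prop where
  exists_bilin : ∀ p, ∃ B : Coord m →ₗ[ℝ] Coord m →ₗ[ℝ] ℝ, ∀ v w : Coord m, g p v w = B v w
  isMetricOn : ∀ p, IsMetricOn (metricComp g p) (extChartAt (𝓡 m) p).target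

theorem bilin_apply_eq_ip (B : Coord m →ₗ[ℝ] Coord m →ₗ[ℝ] ℝ) (L : Coord m →ₗ[ℝ] Coord m)
    (u v : Coord m) : B (L u) (L v)
      = ip (Matrix.of fun i j => B (L (basisVec i)) (L (basisVec j))) u v := by
  conv_lhs => rw [← sum_smul_basisVec u, ← sum_smul_basisVec v]
  simp only [map_sum, map_smul, LinearMap.sum_apply, LinearMap.smul_apply, smul_eq_mul, ip,
    Matrix.of_apply, Finset.mul_sum]
  rw [Finset.sum_comm]
  exact Finset.sum_congr rfl fun i _ => Finset.sum_congr rfl fun j _ => by ring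

theorem isOpen_repDom {ι : X → Y} (hι : Continuous ι) (p : X) (q : Y) :
    IsOpen (repDom N ι p q : Set (Coord m)) :=
  (continuousOn_extChartAt_symm p).isOpen_inter_preimage (isOpen_extChartAt_target p)
    ((isOpen_extChartAt_source q).preimage hι)

theorem rep_mem {ι : X → Y} {p : X} {q : Y} {y : Coord m} (hy : y ∈ repDom N ι p q) : rep ι p q y ∈ (extChartAt (𝓡 N) q).target :=
  (extChartAt (𝓡 N) q).map_source hy.2

theorem mfderiv_id_injective (p : X) : Function.Injective (mfderiv (𝓡 m) (𝓡 m) (id : X → X) p) := by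
  rw [mfderiv_id]; exact Function.injective_id

theorem chart_mem_repDom {ι : X → Y} {p x : X} {q : Y} (hx : x ∈ (extChartAt (𝓡 m) p).source)
    (hq : ι x ∈ (extChartAt (𝓡 N) q).source) : extChartAt (𝓡 m) p x ∈ repDom N ι p q := by
  refine ⟨(extChartAt (𝓡 m) p).map_source hx, ?_⟩
  simpa only [Set.mem_preimage, (extChartAt (𝓡 m) p).left_inv hx] using hq

theorem rep_chart (ι : X → Y) {p x : X} (q : Y) (hx : x ∈ (extChartAt (𝓡 m) p).source) :
    rep ι p q (extChartAt (𝓡 m) p x) = extChartAt (𝓡 N) q (ι x) := by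
  rw [rep, (extChartAt (𝓡 m) p).left_inv hx]

variable [IsManifold (𝓡 m) ∞ X] [IsManifold (𝓡 N) ∞ Y]

theorem contMDiffAt_symm (p : X) {y : Coord m} (hy : y ∈ (extChartAt (𝓡 m) p).target) :
    ContMDiffAt (𝓡 m) (𝓡 m) ∞ (extChartAt (𝓡 m) p).symm y :=
  (contMDiffOn_extChartAt_symm p).contMDiffAt ((isOpen_extChartAt_target p).mem_nhds hy)

theorem contMDiffAt_chart (p : X) {z : X} (hz : z ∈ (extChartAt (𝓡 m) p).source) :
    ContMDiffAt (𝓡 m) (𝓡 m) ∞ (extChartAt (𝓡 m) p) z :=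
  contMDiffAt_extChartAt' (by simpa using hz)

theorem mfderiv_symm_comp (p : X) {y : Coord m} (hy : y ∈ (extChartAt (𝓡 m) p).target)
    (v : Coord m) : vecAt p ((extChartAt (𝓡 m) p).symm y)
      (mfderiv (𝓡 m) (𝓡 m) (extChartAt (𝓡 m) p).symm y v) = v := by
  have h1 := (contMDiffAt_symm p hy).mdifferentiableAt (by simp)
  have h2 := (contMDiffAt_chart p ((extChartAt (𝓡 m) p).map_target hy)).mdifferentiableAt (by simp)
  have h3 := mfderiv_comp y h2 h1
  have h4 : (extChartAt (𝓡 m) p) ∘ (extChartAt (𝓡 m) p).symm =ᶠ[𝓝 y] id := by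
    filter_upwards [(isOpen_extChartAt_target p).mem_nhds hy] with z hz
      using (extChartAt (𝓡 m) p).right_inv hz
  rw [h4.mfderiv_eq, mfderiv_id] at h3
  exact (DFunLike.congr_fun h3 v).symm

theorem mfderiv_chart_comp (p : X) {y : Coord m} (hy : y ∈ (extChartAt (𝓡 m) p).target)
    (v : TangentSpace (𝓡 m) ((extChartAt (𝓡 m) p).symm y)) :
    mfderiv (𝓡 m) (𝓡 m) (extChartAt (𝓡 m) p).symm y
      (vecAt p ((extChartAt (𝓡 m) p).symm y) v) = v := by
  have hz := (extChartAt (𝓡 m) p).map_target hy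
  have h2 := (contMDiffAt_chart p hz).mdifferentiableAt (by simp)
  have hr := (extChartAt (𝓡 m) p).right_inv hy
  have h1 : MDifferentiableAt (𝓡 m) (𝓡 m) (extChartAt (𝓡 m) p).symm
      (extChartAt (𝓡 m) p ((extChartAt (𝓡 m) p).symm y)) := by
    rw [hr]; exact (contMDiffAt_symm p hy).mdifferentiableAt (by simp)
  have h3 := mfderiv_comp _ h1 h2
  have h4 : (extChartAt (𝓡 m) p).symm ∘ (extChartAt (𝓡 m) p)
      =ᶠ[𝓝 ((extChartAt (𝓡 m) p).symm y)] id := by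
    filter_upwards [(isOpen_extChartAt_source p).mem_nhds hz] with z hz
      using (extChartAt (𝓡 m) p).left_inv hz
  rw [h4.mfderiv_eq, mfderiv_id] at h3
  have h5 := DFunLike.congr_fun h3 v
  rw [hr] at h5
  exact h5.symm

theorem vecAt_injective (q : X) {z : X} (hz : z ∈ (extChartAt (𝓡 m) q).source) :
    Function.Injective (vecAt (m := m) q z) := by
  obtain ⟨y, hy, rfl⟩ : ∃ y ∈ (extChartAt (𝓡 m) q).target, (extChartAt (𝓡 m) q).symm y = z :=
    ⟨_, (extChartAt (𝓡 m) q).map_source hz, (extChartAt (𝓡 m) q).left_inv hz⟩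
  intro v w h
  rw [← mfderiv_chart_comp q hy v, ← mfderiv_chart_comp q hy w, h]

/-- Both vectors are expanded in the coordinate frame of a chart which need not be the one preferred
at z; this freedom is what makes it possible to compare charts. -/
theorem apply_eq_ip {g : BilinField (m := m) X}
    (hg : ∀ p, ∃ B : Coord m →ₗ[ℝ] Coord m →ₗ[ℝ] ℝ, ∀ v w : Coord m, g p v w = B v w) (q : X)
    {z : X} (hz : z ∈ (extChartAt (𝓡 m) q).source) (v w : TangentSpace (𝓡 m) z) :
    g z v w = ip (metricComp g q (extChartAt (𝓡 m) q z)) (vecAt q z v) (vecAt q z w) := by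
  obtain ⟨y, hy, rfl⟩ : ∃ y ∈ (extChartAt (𝓡 m) q).target, (extChartAt (𝓡 m) q).symm y = z :=
    ⟨_, (extChartAt (𝓡 m) q).map_source hz, (extChartAt (𝓡 m) q).left_inv hz⟩
  rw [(extChartAt (𝓡 m) q).right_inv hy]
  obtain ⟨B, hB⟩ := hg ((extChartAt (𝓡 m) q).symm y)
  let L : Coord m →L[ℝ] Coord m := mfderiv (𝓡 m) (𝓡 m) (extChartAt (𝓡 m) q).symm y
  have e := bilin_apply_eq_ip B L (vecAt q _ v) (vecAt q _ w)
  have ev : L (vecAt q _ v) = v := mfderiv_chart_comp q hy v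
  have ew : L (vecAt q _ w) = w := mfderiv_chart_comp q hy w
  refine (hB v w).trans ?_
  calc B v w = B (L (vecAt q _ v)) (L (vecAt q _ w)) := by rw [ev, ew]
    _ = _ := e
    _ = _ := by
      congr 1
      ext i j
      exact (hB _ _).symm

variable {ι : X → Y} {p : X} {q : Y} {y : Coord m}

theorem contDiffAt_rep (hι : ContMDiff (𝓡 m) (𝓡 N) ∞ ι) (hy : y ∈ repDom N ι p q) :
    ContDiffAt ℝ ∞ (rep ι p q : Coord m → Coord N) y :=
  ((contMDiffAt_chart q hy.2).comp y
    ((hι _).comp y (contMDiffAt_symm p hy.1))).contDiffAt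

theorem fderiv_apply_coord {F : Coord m → Coord N} (hF : DifferentiableAt ℝ F y) (i : Fin m)
    (a : Fin N) : fderiv ℝ F y (basisVec i) a = tang F i y a := by
  have : HasFDerivAt (fun z => F z a)
      ((EuclideanSpace.proj a : Coord N →L[ℝ] ℝ).comp (fderiv ℝ F y)) y :=
    (EuclideanSpace.proj a : Coord N →L[ℝ] ℝ).hasFDerivAt.comp y hF.hasFDerivAt
  simp only [tang, pd]; rw [this.fderiv]; rfl

theorem vecAt_mfderiv (hι : ContMDiff (𝓡 m) (𝓡 N) ∞ ι) (hy : y ∈ repDom N ι p q) (v : Coord m) :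
    vecAt q (ι ((extChartAt (𝓡 m) p).symm y)) (mfderiv (𝓡 m) (𝓡 N) ι ((extChartAt (𝓡 m) p).symm y)
      (mfderiv (𝓡 m) (𝓡 m) (extChartAt (𝓡 m) p).symm y v)) = fderiv ℝ (rep ι p q) y v := by
  have h1 := (contMDiffAt_symm p hy.1).mdifferentiableAt (by simp)
  have h2 := (hι ((extChartAt (𝓡 m) p).symm y)).mdifferentiableAt (by simp)
  have h3 := (contMDiffAt_chart q hy.2).mdifferentiableAt (by simp)
  have e1 := mfderiv_comp y h2 h1
  have e2 := mfderiv_comp y (f := ι ∘ (extChartAt (𝓡 m) p).symm) h3 (h2.comp y h1)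
  rw [← mfderiv_eq_fderiv]
  change _ = mfderiv (𝓡 m) (𝓡 N) ((extChartAt (𝓡 N) q) ∘ (ι ∘ (extChartAt (𝓡 m) p).symm)) y v
  rw [e2, e1]
  rfl

theorem vecAt_mfderiv_coordField (hι : ContMDiff (𝓡 m) (𝓡 N) ∞ ι) (hy : y ∈ repDom N ι p q)
    (i : Fin m) (a : Fin N) :
    vecAt q (ι ((extChartAt (𝓡 m) p).symm y)) (mfderiv (𝓡 m) (𝓡 N) ι ((extChartAt (𝓡 m) p).symm y)
      (coordField p i y)) a = tang (rep ι p q) i y a := by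
  rw [coordField, vecAt_mfderiv hι hy,
    fderiv_apply_coord ((contDiffAt_rep hι hy).differentiableAt (by simp))]

/-- The bridge from manifolds to coordinates: through it all the results on `pullComp` apply to
induced metrics, and with the identity map to transition maps. -/
theorem metricComp_pullField {g : BilinField (m := N) Y}
    (hg : ∀ p, ∃ B : Coord N →ₗ[ℝ] Coord N →ₗ[ℝ] ℝ, ∀ v w : Coord N, g p v w = B v w)
    (hι : ContMDiff (𝓡 m) (𝓡 N) ∞ ι) (hy : y ∈ repDom N ι p q) :
    metricComp (pullField g ι) p y = pullComp (metricComp g q) (rep ι p q) y := by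
  ext i j
  simp only [metricComp, pullComp, Matrix.of_apply, pullField]
  rw [apply_eq_ip hg q hy.2]
  have e : ∀ i, (vecAt q (ι ((extChartAt (𝓡 m) p).symm y)) (mfderiv (𝓡 m) (𝓡 N) ι
      ((extChartAt (𝓡 m) p).symm y) (coordField p i y)) : Fin N → ℝ) = tang (rep ι p q) i y :=
    fun i => funext fun a => vecAt_mfderiv_coordField hι hy i a
  rw [e, e]
  rfl

theorem IsMetricOn.congr {g h : Coord m → Matrix (Fin m) (Fin m) ℝ} {U V : Set (Coord m)}
    (hg : IsMetricOn g V) (hU : IsOpen U) (hUV : U ⊆ V) (e : ∀ y ∈ U, h y = g y) :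
    IsMetricOn h U where
  isOpen := hU
  smooth x hx a b := (hg.smooth x (hUV hx) a b).congr_of_eventuallyEq
    (by filter_upwards [hU.mem_nhds hx] with z hz using by rw [e z hz])
  posDef x hx := by rw [e x hx]; exact hg.posDef x (hUV hx)

/-- Near each point the components are Jᵀ G J in a chart of the target around the image point.
Smoothness is read off from this, and positive definiteness follows from injectivity of J. -/
theorem IsSmoothMetric.pullField {g : BilinField (m := N) Y} (hg : IsSmoothMetric g)
    (hι : ContMDiff (𝓡 m) (𝓡 N) ∞ ι) (hi : ∀ p, Function.Injective (mfderiv (𝓡 m) (𝓡 N) ι p)) :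
    IsSmoothMetric (Willmore.pullField g ι : BilinField (m := m) X) where
  exists_bilin := exists_bilin_pullField hg.exists_bilin ι
  isMetricOn p := by
    have key : ∀ y ∈ (extChartAt (𝓡 m) p).target,
        y ∈ repDom N ι p (ι ((extChartAt (𝓡 m) p).symm y)) := fun y hy =>
      ⟨hy, mem_extChartAt_source (I := 𝓡 N) (ι ((extChartAt (𝓡 m) p).symm y))⟩
    refine ⟨isOpen_extChartAt_target p, fun y hy a b => ?_, fun y hy => ?_⟩
    · have hy' := key y hy
      set q := ι ((extChartAt (𝓡 m) p).symm y)
      have hr := contDiffAt_rep hι hy'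
      have : ContDiffAt ℝ ∞ (fun z => pullComp (metricComp g q) (rep ι p q) z a b) y :=
        contDiffAt_ip (fun c d => ((hg.isMetricOn q).smooth _ (rep_mem hy') c d).comp y hr)
          (contDiffAt_tang hr a) (contDiffAt_tang hr b)
      refine this.congr_of_eventuallyEq ?_
      filter_upwards [(isOpen_repDom hι.continuous p q).mem_nhds hy'] with z hz
      rw [metricComp_pullField hg.exists_bilin hι hz]
    · have hy' := key y hy
      set q := ι ((extChartAt (𝓡 m) p).symm y) with hq
      rw [metricComp_pullField hg.exists_bilin hι hy', pullComp_eq_mul]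
      have := (hg.isMetricOn q).posDef _ (rep_mem hy')
      rw [← Matrix.conjTranspose_eq_transpose_of_trivial]
      refine this.conjTranspose_mul_mul_same ?_
      intro c d hcd
      have hr := (contDiffAt_rep hι hy').differentiableAt (by simp)
      have e : ∀ c : Fin m → ℝ, (jac (rep ι p q) y).mulVec c
          = fderiv ℝ (rep ι p q : Coord m → Coord N) y (WithLp.toLp 2 c) := by
        intro c
        funext a
        conv_rhs => rw [← sum_smul_basisVec (WithLp.toLp 2 c)]
        simp [Matrix.mulVec, dotProduct, jac, fderiv_apply_coord hr, mul_comm]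
      simp only [e] at hcd
      have h1 : fderiv ℝ (rep ι p q : Coord m → Coord N) y (WithLp.toLp 2 c) = fderiv ℝ (rep ι p q : Coord m → Coord N) y (WithLp.toLp 2 d) := by
        ext a; exact congrFun hcd a
      rw [← vecAt_mfderiv hι hy', ← vecAt_mfderiv hι hy'] at h1
      have i1 : Function.Injective (vecAt q (ι ((extChartAt (𝓡 m) p).symm y))) :=
        vecAt_injective q (mem_extChartAt_source (I := 𝓡 N) _)
      have i2 : Function.Injective (mfderiv (𝓡 m) (𝓡 m) (extChartAt (𝓡 m) p).symm y) :=
        fun v w h => by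
          rw [← mfderiv_symm_comp p hy v, ← mfderiv_symm_comp p hy w, h]
      exact WithLp.toLp_injective 2 (i2 (hi _ (i1 h1)))

end Charts

end Willmore

namespace Willmore

open Filter Topology

/-! ### Independence of the chart -/

section ChartIndependence

variable {m N : ℕ}
  {X : Type*} [TopologicalSpace X] [ChartedSpace (Coord m) X] [IsManifold (𝓡 m) ∞ X]
  {Y : Type*} [TopologicalSpace Y] [ChartedSpace (Coord N) Y] [IsManifold (𝓡 N) ∞ Y]

theorem isImmersionOn_rep {g : BilinField (m := N) Y} (hg : IsSmoothMetric g) {ι : X → Y}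
    (hι : ContMDiff (𝓡 m) (𝓡 N) ∞ ι) (hi : ∀ p, Function.Injective (mfderiv (𝓡 m) (𝓡 N) ι p))
    (p : X) (q : Y) : IsImmersionOn (metricComp g q) (rep ι p q : Coord m → Coord N)
      (repDom N ι p q) (extChartAt (𝓡 N) q).target where
  metric := hg.isMetricOn q
  pull := ((hg.pullField hι hi).isMetricOn p).congr (isOpen_repDom hι.continuous p q)
    Set.inter_subset_left fun _ hy => (metricComp_pullField hg.exists_bilin hι hy).symm
  mapsTo _ hy := rep_mem hy
  smooth _ hy := contDiffAt_rep hι hy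

theorem isImmersionOn_rep_id {g : BilinField (m := m) X} (hg : IsSmoothMetric g) (p q : X) :
    IsImmersionOn (metricComp g q) (rep id p q : Coord m → Coord m)
      (repDom m id p q) (extChartAt (𝓡 m) q).target :=
  isImmersionOn_rep hg contMDiff_id mfderiv_id_injective p q

theorem metricComp_eq_pullComp {g : BilinField (m := m) X} (hg : IsSmoothMetric g) {p q : X}
    {y : Coord m} (hy : y ∈ repDom m id p q) :
    metricComp g p y = pullComp (metricComp g q) (rep id p q) y := by
  have := metricComp_pullField hg.exists_bilin (contMDiff_id (M := X)) hy
  rwa [pullField_id] at this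

/-- The transition map to the chart preferred at x is an isometric immersion between spaces of equal
dimension, so `IsImmersionOn.scalarComp_eq` applies. -/
theorem scalarCurvature_eq {g : BilinField (m := m) X} (hg : IsSmoothMetric g) {p x : X}
    (hx : x ∈ (extChartAt (𝓡 m) p).source) :
    scalarCurvature g x = scalarComp (metricComp g p) (extChartAt (𝓡 m) p x) := by
  have hy : extChartAt (𝓡 m) p x ∈ repDom m id p x :=
    chart_mem_repDom hx (mem_extChartAt_source (I := 𝓡 m) x)
  have h := (isImmersionOn_rep_id hg p x).scalarComp_eq hy
  rw [rep_chart id x hx] at h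
  refine h.symm.trans (scalarComp_congr ?_)
  filter_upwards [(isOpen_repDom continuous_id p x).mem_nhds hy] with z hz
    using (metricComp_eq_pullComp hg hz).symm

theorem laplaceBeltrami_eq {g : BilinField (m := m) X} (hg : IsSmoothMetric g) {p x : X}
    (hx : x ∈ (extChartAt (𝓡 m) p).source) {f : X → ℝ} (hf : ContMDiff (𝓡 m) 𝓘(ℝ, ℝ) ∞ f) :
    laplaceBeltrami g f x
      = laplaceComp (metricComp g p) (f ∘ (extChartAt (𝓡 m) p).symm) (extChartAt (𝓡 m) p x) := by
  have hy : extChartAt (𝓡 m) p x ∈ repDom m id p x :=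
    chart_mem_repDom hx (mem_extChartAt_source (I := 𝓡 m) x)
  have hu : ContDiffAt ℝ ∞ (f ∘ (extChartAt (𝓡 m) x).symm) (rep id p x (extChartAt (𝓡 m) p x)) :=
    ((hf _).comp _ (contMDiffAt_symm x (rep_mem hy))).contDiffAt
  have h := (isImmersionOn_rep_id hg p x).laplaceComp_eq hy hu
  rw [rep_chart id x hx] at h
  refine h.symm.trans (laplaceComp_congr ?_ ?_)
  · filter_upwards [(isOpen_repDom continuous_id p x).mem_nhds hy] with z hz
      using (metricComp_eq_pullComp hg hz).symm
  · filter_upwards [(isOpen_repDom continuous_id p x).mem_nhds hy] with z hz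
    simp only [Function.comp, rep, id]
    rw [(extChartAt (𝓡 m) x).left_inv hz.2]

theorem vecAt_eq_sum (q q' : X) {z : X} (hq : z ∈ (extChartAt (𝓡 m) q).source)
    (hq' : z ∈ (extChartAt (𝓡 m) q').source) (v : TangentSpace (𝓡 m) z) :
    (vecAt q z v : Fin m → ℝ)
      = fun a => ∑ e, tang (rep id q' q) e (extChartAt (𝓡 m) q' z) a * vecAt q' z v e := by
  obtain ⟨y, hy, rfl⟩ : ∃ y ∈ (extChartAt (𝓡 m) q').target, (extChartAt (𝓡 m) q').symm y = z :=
    ⟨_, (extChartAt (𝓡 m) q').map_source hq', (extChartAt (𝓡 m) q').left_inv hq'⟩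
  rw [(extChartAt (𝓡 m) q').right_inv hy]
  have hy' : y ∈ repDom m (id : X → X) q' q := ⟨hy, hq⟩
  have h := vecAt_mfderiv (contMDiff_id (M := X)) hy' (vecAt q' _ v)
  rw [mfderiv_chart_comp q' hy v, mfderiv_id] at h
  have hd := (contDiffAt_rep (contMDiff_id (M := X)) hy').differentiableAt (by simp)
  funext a
  have h' := congrArg (fun w : Coord m => w a) h
  refine h'.trans ?_
  conv_lhs => rw [← sum_smul_basisVec (vecAt q' _ v)]
  simp only [map_sum, map_smul, ← fderiv_apply_coord hd]
  simp [mul_comm]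

theorem IsImmersionOn.congr_metric {g h : Coord N → Matrix (Fin N) (Fin N) ℝ}
    {F : Coord m → Coord N} {U : Set (Coord m)} {V V' : Set (Coord N)}
    (hF : IsImmersionOn g F U V) (hV' : IsOpen V') (hVV : V' ⊆ V) (e : ∀ y ∈ V', h y = g y) :
    IsImmersionOn h F (U ∩ F ⁻¹' V') V' where
  metric := hF.metric.congr hV' hVV e
  pull := hF.pull.congr (ContinuousOn.isOpen_inter_preimage
      (fun y hy => (hF.smooth y hy).continuousAt.continuousWithinAt) hF.pull.isOpen hV')
    Set.inter_subset_left fun y hy => by simp only [pullComp, e (F y) hy.2]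
  mapsTo _ hy := hy.2
  smooth y hy := hF.smooth y hy.1

/-- The mean curvature may be computed in any charts. -/
theorem meanComp_rep_eq {g : BilinField (m := N) Y} (hg : IsSmoothMetric g) {ι : X → Y}
    (hι : ContMDiff (𝓡 m) (𝓡 N) ∞ ι) (hi : ∀ p, Function.Injective (mfderiv (𝓡 m) (𝓡 N) ι p))
    {p p' x : X} {q q' : Y} (hp : x ∈ (extChartAt (𝓡 m) p).source)
    (hp' : x ∈ (extChartAt (𝓡 m) p').source) (hq : ι x ∈ (extChartAt (𝓡 N) q).source)
    (hq' : ι x ∈ (extChartAt (𝓡 N) q').source) (ν : TangentSpace (𝓡 N) (ι x))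
    (hν : ∀ v, g (ι x) ν (mfderiv (𝓡 m) (𝓡 N) ι x v) = 0) :
    meanComp (metricComp g q) (rep ι p q) (vecAt q (ι x) ν) (extChartAt (𝓡 m) p x)
      = meanComp (metricComp g q') (rep ι p' q') (vecAt q' (ι x) ν) (extChartAt (𝓡 m) p' x) := by
  set y := extChartAt (𝓡 m) p x with hy
  have hφ : y ∈ repDom m id p p' := chart_mem_repDom hp hp'
  have hφy : rep id p p' y = extChartAt (𝓡 m) p' x := rep_chart id p' hp
  have hF' : extChartAt (𝓡 m) p' x ∈ repDom N ι p' q' := chart_mem_repDom hp' hq'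
  have hF'y : rep ι p' q' (extChartAt (𝓡 m) p' x) = extChartAt (𝓡 N) q' (ι x) := rep_chart ι q' hp'
  have hψ : extChartAt (𝓡 N) q' (ι x) ∈ repDom N id q' q := chart_mem_repDom hq' hq
  have sφ : ContDiffAt ℝ ∞ (rep id p p' : Coord m → Coord m) y := contDiffAt_rep contMDiff_id hφ
  have sF : ContDiffAt ℝ ∞ (rep ι p' q' : Coord m → Coord N) (rep id p p' y) :=
    hφy ▸ contDiffAt_rep hι hF'
  -- Near y the representative factors as a transition map of the target, the representative in the
  -- other charts, and a transition map of the source. The outer factor is removed by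
  -- `meanComp_comp_left`, the inner one by `meanComp_comp_right`.
  have e0 : (rep ι p q : Coord m → Coord N)
      =ᶠ[𝓝 y] fun z => rep id q' q (rep ι p' q' (rep id p p' z : Coord m) : Coord N) := by
    have hy1 : y ∈ repDom N ι p q' := chart_mem_repDom hp hq'
    filter_upwards [(isOpen_repDom continuous_id p p').mem_nhds hφ,
      (isOpen_repDom hι.continuous p q').mem_nhds hy1] with z hz hz'
    have h1 : (extChartAt (𝓡 m) p').symm (rep id p p' z : Coord m) = (extChartAt (𝓡 m) p).symm z :=
      (extChartAt (𝓡 m) p').left_inv hz.2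
    simp only [rep, id] at h1 ⊢
    rw [h1, (extChartAt (𝓡 N) q').left_inv hz'.2]
  rw [meanComp_congr e0 EventuallyEq.rfl, vecAt_eq_sum q q' hq hq' ν]
  have hpt : rep ι p' q' (rep id p p' y : Coord m) = extChartAt (𝓡 N) q' (ι x) := by rw [hφy, hF'y]
  have iψ := isImmersionOn_rep_id hg q' q
  have h2 := meanComp_comp_left iψ (F := fun z => rep ι p' q' (rep id p p' z : Coord m)) (y := y)
    (by rw [hpt]; exact hψ) (sF.comp y sφ) (vecAt q' (ι x) ν)
  simp only [hpt] at h2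
  rw [h2]
  have e1 : pullComp (metricComp g q) (rep id q' q) =ᶠ[𝓝 (rep ι p' q' (rep id p p' y : Coord m))]
      metricComp g q' := by
    rw [hpt]
    filter_upwards [(isOpen_repDom continuous_id q' q).mem_nhds hψ] with z hz
      using (metricComp_eq_pullComp hg hz).symm
  rw [meanComp_congr (F := fun z => rep ι p' q' (rep id p p' z : Coord m)) EventuallyEq.rfl e1]
  -- The source transition map is isometric for the induced metric, which is rewritten as a
  -- `pullComp` on the smaller domain where that expression is valid.
  have iφ := (isImmersionOn_rep_id (hg.pullField hι hi) p p').congr_metric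
    (isOpen_repDom hι.continuous p' q') Set.inter_subset_left
    fun z hz => (metricComp_pullField hg.exists_bilin hι hz).symm
  have h3 := meanComp_comp_right (F := rep ι p' q') (y := y) iφ
    ⟨hφ, by rw [Set.mem_preimage, hφy]; exact hF'⟩ sF (ν := vecAt q' (ι x) ν) ?_
  · rw [h3, hφy]
  · intro i
    rw [hpt, hφy]
    have hx' : (extChartAt (𝓡 m) p').symm (extChartAt (𝓡 m) p' x) = x :=
      (extChartAt (𝓡 m) p').left_inv hp'
    -- The coordinate vector lives over the chart inverse applied to the coordinates of x, a point
    -- only propositionally equal to x; replacing it by an arbitrary vector `w` lets the base point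
    -- be rewritten.
    have e : ∃ v, (vecAt q' (ι x) (mfderiv (𝓡 m) (𝓡 N) ι x v) : Fin N → ℝ)
        = tang (rep ι p' q') i (extChartAt (𝓡 m) p' x) := by
      have := fun a => vecAt_mfderiv_coordField hι hF' i a
      generalize hw : coordField p' i (extChartAt (𝓡 m) p' x) = w at this
      clear hw
      revert w
      rw [hx']
      exact fun w hw => ⟨w, funext hw⟩
    obtain ⟨v, hv⟩ := e
    rw [← hv, (hg.isMetricOn q').ip_comm ((extChartAt (𝓡 N) q').map_source hq'),
      ← apply_eq_ip hg.exists_bilin q' hq']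
    exact hν v

end ChartIndependence

end Willmore

namespace Willmore

open Filter Topology

/-! ### The metric of a Riemannian manifold in charts -/

section MetricField

variable {m : ℕ} {X : Type*} [TopologicalSpace X] [ChartedSpace (Coord m) X]
  [IsManifold (𝓡 m) ∞ X]

/-- Smoothness of ν and of g is formulated in bundle trivializations, whereas the computations use
`vecAt`; here the two descriptions of a vector are matched. -/
theorem trivializationAt_apply_snd (q : X) {z : X} (hz : z ∈ (extChartAt (𝓡 m) q).source)
    (v : TangentSpace (𝓡 m) z) :
    (trivializationAt (Coord m) (TangentSpace (𝓡 m)) q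
      (⟨z, v⟩ : TangentBundle (𝓡 m) X)).2 = vecAt q z v := by
  have hz' : z ∈ (chartAt (Coord m) q).source := by simpa using hz
  have h := TangentBundle.continuousLinearMapAt_trivializationAt (I := 𝓡 m) hz'
  refine Eq.trans ?_ (congrArg (fun L : TangentSpace (𝓡 m) z →L[ℝ] Coord m => L v) h)
  change _ = Bundle.Trivialization.linearMapAt ℝ _ z v
  rw [Bundle.Trivialization.coe_linearMapAt_of_mem]
  simpa using hz'

theorem mfderiv_symm_injective (p : X) {y : Coord m} (hy : y ∈ (extChartAt (𝓡 m) p).target) :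
    Function.Injective (mfderiv (𝓡 m) (𝓡 m) (extChartAt (𝓡 m) p).symm y) := fun v w h => by
  rw [← mfderiv_symm_comp p hy v, ← mfderiv_symm_comp p hy w, h]

theorem contMDiffAt_coordField (p : X) (i : Fin m) {y : Coord m}
    (hy : y ∈ (extChartAt (𝓡 m) p).target) :
    ContMDiffAt (𝓡 m) (𝓡 m).tangent ∞ (fun z =>
      (⟨(extChartAt (𝓡 m) p).symm z, coordField p i z⟩ : TangentBundle (𝓡 m) X)) y := by
  rw [Bundle.contMDiffAt_totalSpace]
  refine ⟨contMDiffAt_symm p hy, ?_⟩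
  set q := (extChartAt (𝓡 m) p).symm y with hq
  have hy' : y ∈ repDom m id p q := ⟨hy, mem_extChartAt_source (I := 𝓡 m) q⟩
  have hr := contDiffAt_rep (contMDiff_id (M := X)) hy'
  have h : ContDiffAt ℝ ∞ (fun z => fderiv ℝ (rep id p q : Coord m → Coord m) z (basisVec i)) y :=
    (hr.fderiv_right (m := ∞) (by simp)).clm_apply contDiffAt_const
  refine h.contMDiffAt.congr_of_eventuallyEq ?_
  filter_upwards [(isOpen_repDom continuous_id p q).mem_nhds hy'] with z hz
  have := vecAt_mfderiv (contMDiff_id (M := X)) hz (basisVec i)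
  rw [mfderiv_id] at this
  exact (trivializationAt_apply_snd q hz.2 _).trans this

theorem isSmoothMetric_metricField (g : Bundle.ContMDiffRiemannianMetric (𝓡 m) ∞ (Coord m)
    (fun x : X => TangentSpace (𝓡 m) x)) : IsSmoothMetric (metricField g) where
  exists_bilin p := by
    let B : Coord m →L[ℝ] Coord m →L[ℝ] ℝ := g.inner p
    exact ⟨ContinuousLinearMap.coeLM ℝ ∘ₗ (B : Coord m →ₗ[ℝ] (Coord m →L[ℝ] ℝ)), fun v w => rfl⟩
  isMetricOn p := by
    refine ⟨isOpen_extChartAt_target p, fun y hy a b => ?_, fun y hy => ?_⟩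
    · have hb := contMDiffAt_symm p hy
      have : ContMDiffWithinAt (𝓡 m) ((𝓡 m).prod 𝓘(ℝ)) ∞
          (fun z => Bundle.TotalSpace.mk' ℝ (E := Bundle.Trivial X ℝ) ((extChartAt (𝓡 m) p).symm z)
            (g.inner ((extChartAt (𝓡 m) p).symm z) (coordField p a z) (coordField p b z)))
          Set.univ y := by
        apply ContMDiffWithinAt.clm_bundle_apply₂ (F₁ := Coord m) (F₂ := Coord m)
        · exact (g.contMDiff.contMDiffAt.comp y hb).contMDiffWithinAt
        · exact (contMDiffAt_coordField p a hy).contMDiffWithinAt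
        · exact (contMDiffAt_coordField p b hy).contMDiffWithinAt
      rw [Bundle.contMDiffWithinAt_totalSpace] at this
      exact (contMDiffWithinAt_univ.1 this.2).contDiffAt
    · let B : Coord m →L[ℝ] Coord m →L[ℝ] ℝ := g.inner ((extChartAt (𝓡 m) p).symm y)
      let L : Coord m →L[ℝ] Coord m := mfderiv (𝓡 m) (𝓡 m) (extChartAt (𝓡 m) p).symm y
      let B' : Coord m →ₗ[ℝ] Coord m →ₗ[ℝ] ℝ :=
        ContinuousLinearMap.coeLM ℝ ∘ₗ (B : Coord m →ₗ[ℝ] (Coord m →L[ℝ] ℝ))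
      refine Matrix.PosDef.of_dotProduct_mulVec_pos ?_ fun c hc => ?_
      · ext i j
        simp only [Matrix.conjTranspose_apply, metricComp, Matrix.of_apply, star_trivial]
        exact g.symm _ _ _
      · have e := bilin_apply_eq_ip B' L (WithLp.toLp 2 c) (WithLp.toLp 2 c)
        rw [ip_eq_dotProduct] at e
        have hne : L (WithLp.toLp 2 c) ≠ 0 := by
          intro h0
          have := mfderiv_symm_injective p hy (h0.trans (map_zero L).symm)
          exact hc (WithLp.toLp_injective 2 this)
        have hp := g.pos ((extChartAt (𝓡 m) p).symm y) (L (WithLp.toLp 2 c)) hne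
        rw [star_trivial]
        exact lt_of_lt_of_eq hp e

end MetricField

/-! ### Algebra of the second fundamental form -/

section SecondFF

variable {m : ℕ}

theorem sum_four_eq_trace (A S T : Matrix (Fin m) (Fin m) ℝ) (hA : ∀ i j, A i j = A j i) :
    ∑ i, ∑ j, ∑ k, ∑ l, A i k * A j l * S i j * T k l
      = (A * S * (A * T.transpose)).trace := by
  have s : ∀ f : Fin m → Fin m → Fin m → Fin m → ℝ,
      ∑ i, ∑ j, ∑ k, ∑ l, f i j k l = ∑ k, ∑ j, ∑ l, ∑ i, f i j k l := by
    intro f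
    calc ∑ i, ∑ j, ∑ k, ∑ l, f i j k l = ∑ i, ∑ k, ∑ j, ∑ l, f i j k l :=
          Finset.sum_congr rfl fun _ _ => Finset.sum_comm
      _ = ∑ k, ∑ i, ∑ j, ∑ l, f i j k l := Finset.sum_comm
      _ = ∑ k, ∑ j, ∑ i, ∑ l, f i j k l := Finset.sum_congr rfl fun _ _ => Finset.sum_comm
      _ = _ := Finset.sum_congr rfl fun _ _ => Finset.sum_congr rfl fun _ _ => Finset.sum_comm
  rw [s]
  simp only [Matrix.trace, Matrix.diag, Matrix.mul_apply, Matrix.transpose_apply, Finset.sum_mul,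
    Finset.mul_sum]
  exact Finset.sum_congr rfl fun k _ => Finset.sum_congr rfl fun j _ =>
    Finset.sum_congr rfl fun l _ => Finset.sum_congr rfl fun i _ => by rw [hA i k]; ring

/-- The trace is that of a product of two positive semidefinite matrices, A and T A Tᵀ. Writing A as
a sum of rank one terms v vᵀ turns it into a sum of values of the second quadratic form. -/
theorem trace_mul_mul_transpose_nonneg {A : Matrix (Fin m) (Fin m) ℝ} (hA : A.PosSemidef)
    (T : Matrix (Fin m) (Fin m) ℝ) : 0 ≤ (A * T * (A * T.transpose)).trace := by
  have hM : (T * A * T.conjTranspose).PosSemidef := hA.mul_mul_conjTranspose_same T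
  rw [Matrix.conjTranspose_eq_transpose_of_trivial] at hM
  have e : A * T * (A * T.transpose) = A * (T * A * T.transpose) := by
    simp only [Matrix.mul_assoc]
  rw [e]
  generalize T * A * T.transpose = M at hM
  obtain ⟨r, v, rfl⟩ := Matrix.posSemidef_iff_eq_sum_vecMulVec.1 hA
  rw [Matrix.sum_mul, Matrix.trace_sum]
  refine Finset.sum_nonneg fun k _ => ?_
  rw [Matrix.vecMulVec_mul, Matrix.trace_vecMulVec, dotProduct_comm, ← Matrix.dotProduct_mulVec]
  exact hM.dotProduct_mulVec_nonneg (v k)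

/-- The norm of a symmetric form splits into its trace and its traceless part. -/
theorem trace_traceless {A h B : Matrix (Fin m) (Fin m) ℝ} (hAh : A * h = 1) (hm : (m : ℝ) ≠ 0)
    (hB : B.transpose = B) (hh : h.transpose = h) :
    (A * (B - ((A * B).trace / m) • h) * (A * (B - ((A * B).trace / m) • h).transpose)).trace
      = (A * B * (A * B)).trace - (A * B).trace ^ 2 / m := by
  rw [Matrix.transpose_sub, Matrix.transpose_smul, hB, hh, Matrix.mul_sub, Matrix.mul_smul, hAh]
  set t := (A * B).trace with ht
  simp only [Matrix.sub_mul, Matrix.mul_sub, Matrix.trace_sub, Matrix.smul_mul, Matrix.mul_smul,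
    Matrix.mul_one, Matrix.one_mul, Matrix.trace_smul, Matrix.trace_one, Fintype.card_fin,
    smul_eq_mul, ← ht]
  field_simp
  ring

end SecondFF

end Willmore

namespace Willmore

open Filter Topology

/-! ### ### The Laplacian of a logarithm on a manifold -/

theorem laplaceBeltrami_log_le_div {m : ℕ} {X : Type*} [TopologicalSpace X]
    [ChartedSpace (Coord m) X] [IsManifold (𝓡 m) ∞ X] {g : BilinField (m := m) X}
    (hg : IsSmoothMetric g) {f : X → ℝ} (hf : ContMDiff (𝓡 m) 𝓘(ℝ, ℝ) ∞ f) (hpos : ∀ x, 0 < f x)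
    (p : X) : laplaceBeltrami g (fun q => Real.log (f q)) p ≤ laplaceBeltrami g f p / f p := by
  have hx := (extChartAt (𝓡 m) p).map_source (mem_extChartAt_source (I := 𝓡 m) p)
  have hu : ContDiffAt ℝ ∞ (f ∘ (extChartAt (𝓡 m) p).symm) (extChartAt (𝓡 m) p p) :=
    ((hf _).comp _ (contMDiffAt_symm p hx)).contDiffAt
  have hL := (hg.isMetricOn p).laplaceComp_log_le hx hu (hpos _)
  have hpp : (f ∘ (extChartAt (𝓡 m) p).symm) (extChartAt (𝓡 m) p p) = f p :=
    congrArg f (extChartAt_to_inv (I := 𝓡 m) p)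
  rw [hpp] at hL
  exact hL

/-! ### Hypersurfaces -/

section Hypersurfaces

variable {n : ℕ}
  {M : Type*} [TopologicalSpace M] [ChartedSpace (Coord n) M]
  {S : Type*} [TopologicalSpace S] [ChartedSpace (Coord (n - 1)) S]
  {g : BilinField (m := n) M} {ι : S → M} {ν : (p : S) → TangentSpace (𝓡 n) (ι p)}

theorem center_mem_repDom (ι : S → M) (p : S) :
    extChartAt (𝓡 (n - 1)) p p ∈ repDom n ι p (ι p) :=
  chart_mem_repDom (mem_extChartAt_source (I := 𝓡 (n - 1)) p)
    (mem_extChartAt_source (I := 𝓡 n) (ι p))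

theorem rep_center (ι : S → M) (p : S) :
    rep ι p (ι p) (extChartAt (𝓡 (n - 1)) p p) = extChartAt (𝓡 n) (ι p) (ι p) :=
  rep_chart ι _ (mem_extChartAt_source (I := 𝓡 (n - 1)) p)

/-- The normal vector in the chart centred at `ι p`. -/
abbrev normalComp (ν : (p : S) → TangentSpace (𝓡 n) (ι p)) (p : S) : Fin n → ℝ :=
  vecAt (ι p) (ι p) (ν p)

theorem secondFF_eq (p : S) (i j : Fin (n - 1)) : secondFF g ι ν p i j
    = -ip (metricComp g (ι p) (rep ι p (ι p) (extChartAt (𝓡 (n - 1)) p p)))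
      (hess (metricComp g (ι p)) (rep ι p (ι p)) i j (extChartAt (𝓡 (n - 1)) p p))
      (normalComp ν p) := by
  have e : ∀ a, ambientHessian g ι p i j a
      = hess (metricComp g (ι p)) (rep ι p (ι p)) i j (extChartAt (𝓡 (n - 1)) p p) a := by
    intro a
    simp only [hess, covD, rep_center]
    rfl
  simp only [secondFF, Matrix.of_apply, e, ip, rep_center]
  rfl

variable [IsManifold (𝓡 n) ∞ M] [IsManifold (𝓡 (n - 1)) ∞ S]

theorem IsSmoothMetric.inducedMetric (hg : IsSmoothMetric g) (hι : IsSmoothImmersion n ι) :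
    IsSmoothMetric (Willmore.inducedMetric g ι) :=
  hg.pullField hι.1 hι.2

theorem firstFF_eq (hg : IsSmoothMetric g) (hι : IsSmoothImmersion n ι) (p : S) :
    firstFF g ι p = pullComp (metricComp g (ι p)) (rep ι p (ι p)) (extChartAt (𝓡 (n - 1)) p p) :=
  metricComp_pullField hg.exists_bilin hι.1 (center_mem_repDom ι p)

theorem meanCurvature_eq (hg : IsSmoothMetric g) (hι : IsSmoothImmersion n ι) (p : S) :
    meanCurvature g ι ν p = meanComp (metricComp g (ι p)) (rep ι p (ι p)) (normalComp ν p)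
      (extChartAt (𝓡 (n - 1)) p p) := by
  simp only [meanCurvature, meanComp, firstFF_eq hg hι, secondFF_eq]

/-- The mean curvature in fixed charts. -/
theorem meanCurvature_eq_meanComp (hg : IsSmoothMetric g) (hι : IsSmoothImmersion n ι)
    (hν : ∀ p v, g (ι p) (ν p) (mfderiv (𝓡 (n - 1)) (𝓡 n) ι p v) = 0) {p x : S} {q : M}
    (hp : x ∈ (extChartAt (𝓡 (n - 1)) p).source) (hq : ι x ∈ (extChartAt (𝓡 n) q).source) :
    meanCurvature g ι ν x = meanComp (metricComp g q) (rep ι p q) (vecAt q (ι x) (ν x))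
      (extChartAt (𝓡 (n - 1)) p x) := by
  rw [meanCurvature_eq hg hι]
  exact meanComp_rep_eq hg hι.1 hι.2 (mem_extChartAt_source (I := 𝓡 (n - 1)) x) hp
    (mem_extChartAt_source (I := 𝓡 n) (ι x)) hq (ν x) (hν x)

theorem contDiffAt_vecAt
    (hs : ContMDiff (𝓡 (n - 1)) (𝓡 n).tangent ∞ (fun p => (⟨ι p, ν p⟩ : TangentBundle (𝓡 n) M)))
    (hι : Continuous ι) (p : S) (a : Fin n) :
    ContDiffAt ℝ ∞ (fun y => vecAt (ι p) (ι ((extChartAt (𝓡 (n - 1)) p).symm y))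
      (ν ((extChartAt (𝓡 (n - 1)) p).symm y)) a) (extChartAt (𝓡 (n - 1)) p p) := by
  have h := (Bundle.contMDiffAt_totalSpace.1 (hs p)).2
  have h1 : ContMDiffAt (𝓡 (n - 1)) (𝓡 n) ∞ (fun x => vecAt (ι p) (ι x) (ν x)) p := by
    refine h.congr_of_eventuallyEq ?_
    filter_upwards [((isOpen_extChartAt_source (I := 𝓡 n) (ι p)).preimage hι).mem_nhds
      (mem_extChartAt_source (I := 𝓡 n) (ι p))] with x hx
      using (trivializationAt_apply_snd (ι p) hx (ν x)).symm
  have h2 := contMDiffAt_symm p ((extChartAt (𝓡 (n - 1)) p).map_source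
    (mem_extChartAt_source (I := 𝓡 (n - 1)) p))
  have h3 : (extChartAt (𝓡 (n - 1)) p).symm (extChartAt (𝓡 (n - 1)) p p) = p :=
    extChartAt_to_inv (I := 𝓡 (n - 1)) p
  have h4 : ContMDiffAt (𝓡 (n - 1)) (𝓡 n) ∞ (fun y => vecAt (ι p)
      (ι ((extChartAt (𝓡 (n - 1)) p).symm y)) (ν ((extChartAt (𝓡 (n - 1)) p).symm y)))
      (extChartAt (𝓡 (n - 1)) p p) :=
    ContMDiffAt.comp (g := fun x => vecAt (ι p) (ι x) (ν x)) _ (by rw [h3]; exact h1) h2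
  exact contDiffAt_euclidean.1 h4.contDiffAt a

/-- Near p the mean curvature is given by `meanComp` in the fixed charts at p and ι p, with the
normal vector varying smoothly; in those charts the formula is visibly smooth. -/
theorem contMDiff_meanCurvature (hg : IsSmoothMetric g) (hι : IsSmoothImmersion n ι)
    (hs : ContMDiff (𝓡 (n - 1)) (𝓡 n).tangent ∞ (fun p => (⟨ι p, ν p⟩ : TangentBundle (𝓡 n) M)))
    (hν : ∀ p v, g (ι p) (ν p) (mfderiv (𝓡 (n - 1)) (𝓡 n) ι p v) = 0) :
    ContMDiff (𝓡 (n - 1)) 𝓘(ℝ, ℝ) ∞ (meanCurvature g ι ν) := by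
  intro p
  have hy : extChartAt (𝓡 (n - 1)) p p ∈ repDom n ι p (ι p) := center_mem_repDom ι p
  have iF := isImmersionOn_rep hg hι.1 hι.2 p (ι p)
  have hr := contDiffAt_rep hι.1 hy
  have hK : ContDiffAt ℝ ∞ (fun y => meanComp (metricComp g (ι p)) (rep ι p (ι p))
      (vecAt (ι p) (ι ((extChartAt (𝓡 (n - 1)) p).symm y)) (ν ((extChartAt (𝓡 (n - 1)) p).symm y))) y)
      (extChartAt (𝓡 (n - 1)) p p) := by
    refine ContDiffAt.sum fun i _ => ContDiffAt.sum fun j _ =>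
      (iF.pull.contDiffAt_inv hy i j).mul (ContDiffAt.neg ?_)
    exact contDiffAt_ip (fun a b => (iF.metric.smooth _ (rep_mem hy) a b).comp _ hr)
      (contDiffAt_hess iF.metric (rep_mem hy) hr i j) (contDiffAt_vecAt (n := n) hs hι.1.continuous p)
  refine ContMDiffAt.congr_of_eventuallyEq (f := fun x => meanComp (metricComp g (ι p))
    (rep ι p (ι p)) (vecAt (ι p) (ι ((extChartAt (𝓡 (n - 1)) p).symm (extChartAt (𝓡 (n - 1)) p x)))
      (ν ((extChartAt (𝓡 (n - 1)) p).symm (extChartAt (𝓡 (n - 1)) p x))))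
    (extChartAt (𝓡 (n - 1)) p x))
    (hK.contMDiffAt.comp p (contMDiffAt_extChartAt (I := 𝓡 (n - 1)) (n := ∞) (x := p))) ?_
  filter_upwards [(isOpen_extChartAt_source (I := 𝓡 (n - 1)) p).mem_nhds
      (mem_extChartAt_source (I := 𝓡 (n - 1)) p),
    ((isOpen_extChartAt_source (I := 𝓡 n) (ι p)).preimage hι.1.continuous).mem_nhds
      (mem_extChartAt_source (I := 𝓡 n) (ι p))] with x hx hx'
  rw [(extChartAt (𝓡 (n - 1)) p).left_inv hx]
  exact meanCurvature_eq_meanComp hg hι hν hx hx'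

/-- The traced Gauss equation. -/
theorem scalarCurvature_inducedMetric (hn : 2 ≤ n) (hg : IsSmoothMetric g)
    (hι : IsSmoothImmersion n ι) (h1 : ∀ p, g (ι p) (ν p) (ν p) = 1)
    (h0 : ∀ p v, g (ι p) (ν p) (mfderiv (𝓡 (n - 1)) (𝓡 n) ι p v) = 0) (p : S) :
    scalarCurvature (inducedMetric g ι) p = scalarCurvature g (ι p) - 2 * ricci g (ι p) (ν p) (ν p)
      + meanCurvature g ι ν p ^ 2 - meanCurvature g ι ν p ^ 2 / ((n : ℝ) - 1)
      - tracelessNormSq g ι ν p ∧ 0 ≤ tracelessNormSq g ι ν p := by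
  set y := extChartAt (𝓡 (n - 1)) p p with hydef
  set F : Coord (n - 1) → Coord n := rep ι p (ι p) with hFdef
  have hy : y ∈ repDom n ι p (ι p) := center_mem_repDom ι p
  have hFy : F y = extChartAt (𝓡 n) (ι p) (ι p) := rep_center ι p
  have hsrc := mem_extChartAt_source (I := 𝓡 n) (ι p)
  have iF : IsImmersionOn (metricComp g (ι p)) F _ _ := isImmersionOn_rep hg hι.1 hι.2 p (ι p)
  have n1 : ip (metricComp g (ι p) (F y)) (normalComp ν p) (normalComp ν p) = 1 := by
    rw [hFy, ← apply_eq_ip hg.exists_bilin (ι p) hsrc]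
    exact h1 p
  have n0 : ∀ i, ip (metricComp g (ι p) (F y)) (tang F i y) (normalComp ν p) = 0 := by
    intro i
    have e : ∃ v, (vecAt (ι p) (ι p) (mfderiv (𝓡 (n - 1)) (𝓡 n) ι p v) : Fin n → ℝ)
        = tang F i y := by
      have := fun a => vecAt_mfderiv_coordField hι.1 hy i a
      generalize hw : coordField p i y = w at this
      clear hw
      revert w
      rw [hydef, extChartAt_to_inv (I := 𝓡 (n - 1)) p]
      exact fun w hw => ⟨w, funext hw⟩
    obtain ⟨v, hv⟩ := e
    rw [iF.metric.ip_comm (iF.mapsTo y hy), ← hv, hFy, ← apply_eq_ip hg.exists_bilin (ι p) hsrc]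
    exact h0 p v
  -- Here n - 1 is a truncated difference; the lower bound on n ensures n - 1 + 1 = n.
  have hP := proj_of_unit_normal iF hy (by omega) n1 n0
  have G := iF.scalarComp_pull hy hP
  have hsc : scalarCurvature (inducedMetric g ι) p = scalarComp (pullComp (metricComp g (ι p)) F) y := by
    refine scalarComp_congr ?_
    filter_upwards [(isOpen_repDom hι.1.continuous p (ι p)).mem_nhds hy] with z hz
      using metricComp_pullField hg.exists_bilin hι.1 hz
  have hff : firstFF g ι p = pullComp (metricComp g (ι p)) F y := firstFF_eq hg hι p
  set h := firstFF g ι p with hh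
  set B := secondFF g ι ν p with hB
  -- B carries a minus sign relative to the normal part of the second derivatives; the Gauss
  -- equation is quadratic in it, so the sign disappears.
  have hBij : ∀ i j, ip (metricComp g (ι p) (F y)) (hess (metricComp g (ι p)) F i j y)
      (normalComp ν p) = -B i j := fun i j => by rw [hB, secondFF_eq]; simp [hFdef, hydef]
  have Bs : B.transpose = B := by
    ext i j
    have := hess_comm iF.metric (rep_mem hy) (iF.smooth y hy) i j
    have e1 := hBij i j
    have e2 := hBij j i
    rw [this] at e1
    rw [Matrix.transpose_apply]
    linarith
  have hm : IsMetricOn (pullComp (metricComp g (ι p)) F) (repDom n ι p (ι p)) := iF.pull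
  have hAs : ∀ i j, h⁻¹ i j = h⁻¹ j i := fun i j => by rw [hff]; exact hm.inv_symm hy i j
  have hhs : h.transpose = h := by ext i j; rw [hff]; exact hm.symm hy j i
  have hAh : h⁻¹ * h = 1 := by rw [hff]; exact hm.inv_mul hy
  have hApd : (h⁻¹).PosSemidef := by rw [hff]; exact (hm.posDef y hy).inv.posSemidef
  have hcast : ((n - 1 : ℕ) : ℝ) = (n : ℝ) - 1 := by push_cast [Nat.cast_sub (by omega : 1 ≤ n)]; ring
  have hne : ((n - 1 : ℕ) : ℝ) ≠ 0 := by
    have : n - 1 ≠ 0 := by omega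
    exact_mod_cast this
  have hH : meanCurvature g ι ν p = (h⁻¹ * B).trace := by
    simp only [meanCurvature, Matrix.trace, Matrix.diag, Matrix.mul_apply]
    refine Finset.sum_congr rfl fun i _ => Finset.sum_congr rfl fun j _ => ?_
    have := congrFun (congrFun Bs i) j
    rw [Matrix.transpose_apply] at this
    rw [← hh, ← hB, this]
  have hT : tracelessNormSq g ι ν p
      = (h⁻¹ * tracelessFF g ι ν p * (h⁻¹ * (tracelessFF g ι ν p).transpose)).trace :=
    sum_four_eq_trace _ _ _ hAs
  have hT2 : tracelessNormSq g ι ν p = (h⁻¹ * B * (h⁻¹ * B)).trace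
      - meanCurvature g ι ν p ^ 2 / ((n : ℝ) - 1) := by
    rw [hT, tracelessFF, hH, ← hcast]
    exact trace_traceless hAh hne Bs hhs
  refine ⟨?_, by rw [hT]; exact trace_mul_mul_transpose_nonneg hApd _⟩
  have q1 : ∑ i, ∑ j, (pullComp (metricComp g (ι p)) F y)⁻¹ i j
      * ip (metricComp g (ι p) (F y)) (hess (metricComp g (ι p)) F i j y) (normalComp ν p)
      = -meanCurvature g ι ν p := by
    simp only [hBij, ← hff, mul_neg, Finset.sum_neg_distrib]
    rfl
  have q2 : ∑ i, ∑ j, ∑ k, ∑ l, (pullComp (metricComp g (ι p)) F y)⁻¹ i j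
        * (pullComp (metricComp g (ι p)) F y)⁻¹ k l
        * ip (metricComp g (ι p) (F y)) (hess (metricComp g (ι p)) F i l y) (normalComp ν p)
        * ip (metricComp g (ι p) (F y)) (hess (metricComp g (ι p)) F k j y) (normalComp ν p)
      = (h⁻¹ * B * (h⁻¹ * B)).trace := by
    have := sum_four_eq_trace h⁻¹ B B hAs
    rw [Bs] at this
    rw [← this]
    simp only [hBij, ← hff]
    refine Finset.sum_congr rfl fun i _ => ?_
    conv_rhs => rw [Finset.sum_comm]
    refine Finset.sum_congr rfl fun j _ => ?_
    conv_rhs => rw [Finset.sum_comm]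
    refine Finset.sum_congr rfl fun k _ => Finset.sum_congr rfl fun l _ => ?_
    have := congrFun (congrFun Bs k) j
    rw [Matrix.transpose_apply] at this
    rw [hAs k l, this]
    ring
  rw [hsc, G, q1, q2, hT2, hFy]
  have q3 : ∑ e, ∑ d, ricciComp (metricComp g (ι p)) e d (extChartAt (𝓡 n) (ι p) (ι p))
      * normalComp ν p e * normalComp ν p d = ricci g (ι p) (ν p) (ν p) := rfl
  rw [q3]
  simp only [scalarCurvature]
  ring

/-- Divide the Willmore equation by H and eliminate R = Ric(ν,ν) with the Gauss equation. The terms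
left over are -s/2 and -T/2, which are dropped, and L/H is bounded below by L'. -/
theorem willmore_inequality {n lam H L L' T R s s' : ℝ} (hn : 0 < n - 1) (hH : 0 < H) (hs : 0 ≤ s)
    (hT : 0 ≤ T) (hW : 0 = lam * H + L - (n - 3) / (2 * (n - 1)) * H ^ 3 + H * T + H * R)
    (hG : s' = s - 2 * R + H ^ 2 - H ^ 2 / (n - 1) - T) (hL : L' ≤ L / H) :
    lam + L' ≤ s' / 2 - H ^ 2 / (2 * (n - 1)) := by
  have hdiv : lam + L / H = (n - 3) / (2 * (n - 1)) * H ^ 2 - T - R := by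
    have : H * (lam + L / H) = H * ((n - 3) / (2 * (n - 1)) * H ^ 2 - T - R) := by
      rw [mul_add, mul_div_cancel₀ _ hH.ne']
      linarith
    exact mul_left_cancel₀ hH.ne' this
  have e : (n - 3) / (2 * (n - 1)) * H ^ 2 = H ^ 2 / 2 - H ^ 2 / (n - 1) := by
    field_simp
    ring
  have e2 : H ^ 2 / (2 * (n - 1)) = H ^ 2 / (n - 1) / 2 := by
    field_simp
  rw [hG, e2]
  linarith

/-- The Willmore equation gives a differential inequality for the logarithm of the mean
curvature. -/
theorem laplaceBeltrami_log_le (hn : 3 ≤ n) (hg : IsSmoothMetric g) (hι : IsSmoothImmersion n ι)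
    (hsc : ∀ q, 0 ≤ scalarCurvature g q)
    (hs : ContMDiff (𝓡 (n - 1)) (𝓡 n).tangent ∞ (fun p => (⟨ι p, ν p⟩ : TangentBundle (𝓡 n) M)))
    (h1 : ∀ p, g (ι p) (ν p) (ν p) = 1)
    (h0 : ∀ p v, g (ι p) (ν p) (mfderiv (𝓡 (n - 1)) (𝓡 n) ι p v) = 0)
    {lam : ℝ} (hW : IsAreaConstrainedWillmore g ι ν lam) (hH : ∀ p, 0 < meanCurvature g ι ν p)
    (p : S) :
    lam + laplaceBeltrami (inducedMetric g ι) (fun q => Real.log (meanCurvature g ι ν q)) p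
      ≤ scalarCurvature (inducedMetric g ι) p / 2
        - meanCurvature g ι ν p ^ 2 / (2 * ((n : ℝ) - 1)) := by
  obtain ⟨hG, hT⟩ := scalarCurvature_inducedMetric (by omega) hg hι h1 h0 p
  have hp := hH p
  have hL' := laplaceBeltrami_log_le_div (hg.inducedMetric hι)
    (contMDiff_meanCurvature hg hι hs h0) hH p
  have hn' : (0 : ℝ) < (n : ℝ) - 1 := by
    have : (3 : ℝ) ≤ n := by exact_mod_cast hn
    linarith
  exact willmore_inequality hn' hp (hsc (ι p)) hT (hW p) hG hL'

end Hypersurfaces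

end Willmore

namespace Willmore

open Filter Topology MeasureTheory

/-! ### The Riemannian volume -/

section Volume

variable {m : ℕ} {X : Type*} [TopologicalSpace X] [ChartedSpace (Coord m) X]

theorem measurableSet_target (p : X) : MeasurableSet (extChartAt (𝓡 m) p).target :=
  (isOpen_extChartAt_target p).measurableSet

/-- The density `√(det gᵢⱼ)`. -/
def volDensity (g : BilinField (m := m) X) (p : X) (y : Coord m) : ℝ :=
  Real.sqrt (metricComp g p y).det

theorem det_fderiv_eq {F : Coord m → Coord m} {y : Coord m} (hF : DifferentiableAt ℝ F y) :
    (fderiv ℝ F y).det = (jac F y).det := by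
  rw [ContinuousLinearMap.det, ← LinearMap.det_toMatrix (EuclideanSpace.basisFun (Fin m) ℝ).toBasis]
  congr 1
  ext a i
  rw [LinearMap.toMatrix_apply]
  simp only [OrthonormalBasis.coe_toBasis, OrthonormalBasis.coe_toBasis_repr_apply,
    EuclideanSpace.basisFun_apply, EuclideanSpace.basisFun_repr, jac, Matrix.of_apply]
  exact fderiv_apply_coord hF i a

theorem continuousOn_volDensity {g : BilinField (m := m) X} (hg : IsSmoothMetric g) (p : X) :
    ContinuousOn (volDensity g p) (extChartAt (𝓡 m) p).target :=
  fun _ hy => ((hg.isMetricOn p).contDiffAt_sqrt_det hy).continuousAt.continuousWithinAt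

/-- The determinant of Jᵀ G J is (det J)² det G, and the square root turns (det J)² into |det J|:
the factor in the change of variables formula. -/
theorem volDensity_eq [IsManifold (𝓡 m) ∞ X] {g : BilinField (m := m) X} (hg : IsSmoothMetric g)
    {p q : X} {y : Coord m} (hy : y ∈ repDom m id p q) :
    volDensity g p y = |(fderiv ℝ (rep id p q : Coord m → Coord m) y).det|
      * volDensity g q (rep id p q y) := by
  have hr := (contDiffAt_rep (contMDiff_id (M := X)) hy).differentiableAt (by simp)
  rw [det_fderiv_eq hr, volDensity, metricComp_eq_pullComp hg hy, pullComp_eq_mul,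
    Matrix.det_mul, Matrix.det_mul, Matrix.det_transpose, volDensity]
  have e : (jac (rep id p q) y).det * (metricComp g q (rep id p q y)).det * (jac (rep id p q) y).det
      = (jac (rep id p q) y).det ^ 2 * (metricComp g q (rep id p q y)).det := by ring
  rw [e, Real.sqrt_mul (sq_nonneg _), Real.sqrt_sq_eq_abs]

variable [MeasurableSpace X] [BorelSpace X]

theorem aemeasurable_symm (g : BilinField (m := m) X) (p : X) :
    AEMeasurable (extChartAt (𝓡 m) p).symm
      ((volume.restrict (extChartAt (𝓡 m) p).target).withDensity
        fun y => ENNReal.ofReal (volDensity g p y)) :=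
  ((continuousOn_extChartAt_symm p).aemeasurable (measurableSet_target p)).mono_ac
    (withDensity_absolutelyContinuous _ _)

theorem chartVolume_apply (g : BilinField (m := m) X) (p : X) {A : Set X} (hA : MeasurableSet A) :
    chartVolume g p A = ∫⁻ y in (extChartAt (𝓡 m) p).target ∩ (extChartAt (𝓡 m) p).symm ⁻¹' A,
      ENNReal.ofReal (volDensity g p y) := by
  have h := Measure.map_apply_of_aemeasurable (aemeasurable_symm g p) hA
  refine h.trans ?_
  rw [withDensity_apply', Measure.restrict_restrict' (measurableSet_target p), Set.inter_comm]

theorem chartVolume_inter_source (g : BilinField (m := m) X) (p : X) {A : Set X}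
    (hA : MeasurableSet A) :
    chartVolume g p A = chartVolume g p (A ∩ (extChartAt (𝓡 m) p).source) := by
  rw [chartVolume_apply g p hA,
    chartVolume_apply g p (hA.inter (isOpen_extChartAt_source p).measurableSet)]
  congr 2
  ext y
  simp only [Set.mem_inter_iff, Set.mem_preimage]
  exact ⟨fun h => ⟨h.1, h.2, (extChartAt (𝓡 m) p).map_target h.1⟩, fun h => ⟨h.1, h.2.1⟩⟩

theorem measurableSet_target_inter_preimage (p : X) {A : Set X} (hA : MeasurableSet A) :
    MeasurableSet ((extChartAt (𝓡 m) p).target ∩ (extChartAt (𝓡 m) p).symm ⁻¹' A) := by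
  have h := (continuousOn_iff_continuous_domRestrict.1
    (continuousOn_extChartAt_symm (I := 𝓡 m) p)).measurable hA
  have := (measurableSet_target p).subtype_image h
  convert! this using 1
  ext y
  simp [and_comm]

/-- A single chart suffices: its density is positive on a nonempty open set. -/
theorem riemannianVolume_univ_pos [Nonempty X] {g : BilinField (m := m) X}
    (hg : IsSmoothMetric g) : 0 < riemannianVolume g Set.univ := by
  obtain ⟨p⟩ := ‹Nonempty X›
  have h1 : chartVolume g p Set.univ ≤ riemannianVolume g Set.univ :=
    Measure.le_iff'.1 (le_iSup (chartVolume g) p) _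
  refine lt_of_lt_of_le ?_ h1
  rw [chartVolume_apply g p MeasurableSet.univ, Set.preimage_univ, Set.inter_univ]
  have hm : AEMeasurable (volDensity g p) (volume.restrict (extChartAt (𝓡 m) p).target) :=
    (continuousOn_volDensity hg p).aemeasurable (measurableSet_target p)
  refine pos_iff_ne_zero.2 fun h0 => ?_
  rw [lintegral_eq_zero_iff' hm.ennreal_ofReal] at h0
  have hsub : (extChartAt (𝓡 m) p).target
      ⊆ {y | ENNReal.ofReal (volDensity g p y) ≠ 0} := fun y hy =>
    (ENNReal.ofReal_pos.2 (Real.sqrt_pos.2 ((hg.isMetricOn p).det_pos hy))).ne'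
  have h2 := measure_mono_null hsub (ae_iff.1 h0)
  rw [Measure.restrict_apply_self] at h2
  exact ((isOpen_extChartAt_target p).measure_pos _
    ⟨_, (extChartAt (𝓡 m) p).map_source (mem_extChartAt_source (I := 𝓡 m) p)⟩).ne' h2

variable [IsManifold (𝓡 m) ∞ X] {g : BilinField (m := m) X} (hg : IsSmoothMetric g)
include hg

/-- Change of variables along the transition map. The chart at q sees only the part of A in its own
domain, hence an inequality. -/
theorem chartVolume_le_of_subset {p q : X} {A : Set X} (hA : MeasurableSet A)
    (hAp : A ⊆ (extChartAt (𝓡 m) p).source) : chartVolume g q A ≤ chartVolume g p A := by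
  rw [chartVolume_apply g q hA, chartVolume_apply g p hA]
  set φ : Coord m → Coord m := rep id p q with hφ
  set s := (extChartAt (𝓡 m) p).target ∩ (extChartAt (𝓡 m) p).symm ⁻¹'
    (A ∩ (extChartAt (𝓡 m) q).source) with hs
  have hsd : s ⊆ repDom m id p q := fun y hy => ⟨hy.1, hy.2.2⟩
  have hsm : MeasurableSet s := measurableSet_target_inter_preimage p
    (hA.inter (isOpen_extChartAt_source q).measurableSet)
  have himg : φ '' s = (extChartAt (𝓡 m) q).target ∩ (extChartAt (𝓡 m) q).symm ⁻¹' A := by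
    ext z
    constructor
    · rintro ⟨y, hy, rfl⟩
      refine ⟨rep_mem (hsd hy), ?_⟩
      simp only [hφ, rep, id, Set.mem_preimage]
      rw [(extChartAt (𝓡 m) q).left_inv hy.2.2]
      exact hy.2.1
    · rintro ⟨hz, hzA⟩
      have hzs : (extChartAt (𝓡 m) p).symm (extChartAt (𝓡 m) p ((extChartAt (𝓡 m) q).symm z))
        = (extChartAt (𝓡 m) q).symm z := (extChartAt (𝓡 m) p).left_inv (hAp hzA)
      refine ⟨extChartAt (𝓡 m) p ((extChartAt (𝓡 m) q).symm z),
        ⟨(extChartAt (𝓡 m) p).map_source (hAp hzA), ?_⟩, ?_⟩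
      · rw [Set.mem_preimage, hzs]
        exact ⟨hzA, (extChartAt (𝓡 m) q).map_target hz⟩
      · simp only [hφ, rep, id]
        rw [hzs, (extChartAt (𝓡 m) q).right_inv hz]
  have hinj : Set.InjOn φ s := by
    intro y hy z hz h
    have h' := congrArg (extChartAt (𝓡 m) q).symm h
    simp only [hφ, rep, id] at h'
    rw [(extChartAt (𝓡 m) q).left_inv hy.2.2, (extChartAt (𝓡 m) q).left_inv hz.2.2] at h'
    have h'' := congrArg (extChartAt (𝓡 m) p) h'
    rwa [(extChartAt (𝓡 m) p).right_inv hy.1, (extChartAt (𝓡 m) p).right_inv hz.1] at h''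
  rw [← himg, lintegral_image_eq_lintegral_abs_det_fderiv_mul volume hsm
    (f' := fun y => fderiv ℝ φ y) (fun y hy => ((contDiffAt_rep (contMDiff_id (M := X))
      (hsd hy)).differentiableAt (by simp)).hasFDerivAt.hasFDerivWithinAt) hinj]
  calc ∫⁻ y in s, ENNReal.ofReal |(fderiv ℝ φ y).det| * ENNReal.ofReal (volDensity g q (φ y))
      = ∫⁻ y in s, ENNReal.ofReal (volDensity g p y) := by
        refine setLIntegral_congr_fun hsm fun y hy => ?_
        rw [volDensity_eq hg (hsd hy), ENNReal.ofReal_mul (abs_nonneg _)]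
    _ ≤ _ := lintegral_mono_set (show s ⊆ _ ∩ _ from fun y hy => ⟨hy.1, hy.2.1⟩)

theorem riemannianVolume_restrict (p : X) :
    (riemannianVolume g).restrict (extChartAt (𝓡 m) p).source = chartVolume g p := by
  have hU : MeasurableSet (extChartAt (𝓡 m) p).source := (isOpen_extChartAt_source p).measurableSet
  refine le_antisymm ?_ ?_
  -- To bound a supremum of measures from above, one measure dominating every `chartVolume g q` is
  -- exhibited: the volume off the chart domain plus the volume of the chart at p. On the chart
  -- domain the first summand vanishes.
  · have hle : riemannianVolume g
        ≤ (riemannianVolume g).restrict (extChartAt (𝓡 m) p).sourceᶜ + chartVolume g p := by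
      refine iSup_le fun q => Measure.le_iff.2 fun A hA => ?_
      rw [Measure.add_apply, Measure.restrict_apply hA, ← measure_inter_add_sdiff A hU, add_comm]
      refine add_le_add ?_ ?_
      · rw [← Set.sdiff_eq]
        exact Measure.le_iff'.1 (le_iSup (chartVolume g) q) _
      · exact (chartVolume_le_of_subset hg (hA.inter hU) Set.inter_subset_right).trans
          (measure_mono Set.inter_subset_left)
    refine Measure.le_iff.2 fun A hA => ?_
    rw [Measure.restrict_apply hA]
    refine (Measure.le_iff'.1 hle _).trans ?_
    rw [Measure.add_apply, Measure.restrict_apply (hA.inter hU)]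
    have : A ∩ (extChartAt (𝓡 m) p).source ∩ (extChartAt (𝓡 m) p).sourceᶜ = ∅ := by
      rw [Set.inter_assoc, Set.inter_compl_self, Set.inter_empty]
    rw [this, measure_empty, zero_add]
    exact measure_mono Set.inter_subset_left
  · refine Measure.le_iff.2 fun A hA => ?_
    rw [Measure.restrict_apply hA, chartVolume_inter_source g p hA]
    exact Measure.le_iff'.1 (le_iSup (chartVolume g) p) _

/-- The integral of a function vanishing outside of the domain of a chart. -/
theorem integral_riemannianVolume (p : X) {f : X → ℝ} (hf : Continuous f)
    (h0 : ∀ x ∉ (extChartAt (𝓡 m) p).source, f x = 0) :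
    ∫ x, f x ∂riemannianVolume g
      = ∫ y in (extChartAt (𝓡 m) p).target, f ((extChartAt (𝓡 m) p).symm y) * volDensity g p y := by
  rw [← setIntegral_eq_integral_of_forall_compl_eq_zero h0, riemannianVolume_restrict hg p]
  have h1 := integral_map (aemeasurable_symm g p) (f := f) hf.aestronglyMeasurable
  refine h1.trans ?_
  have hm : AEMeasurable (volDensity g p) (volume.restrict (extChartAt (𝓡 m) p).target) :=
    (continuousOn_volDensity hg p).aemeasurable (measurableSet_target p)
  rw [integral_withDensity_eq_integral_toReal_smul₀ hm.ennreal_ofReal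
    (Filter.Eventually.of_forall fun _ => ENNReal.ofReal_lt_top)]
  refine integral_congr_ae (Filter.Eventually.of_forall fun y => ?_)
  simp only [smul_eq_mul]
  rw [ENNReal.toReal_ofReal (show 0 ≤ volDensity g p y from Real.sqrt_nonneg _), mul_comm]

/-- The density is continuous, hence integrable over a closed coordinate ball contained in the
chart. -/
theorem isLocallyFiniteMeasure_riemannianVolume : IsLocallyFiniteMeasure (riemannianVolume g) := by
  refine ⟨fun p => ?_⟩
  have hp := mem_extChartAt_source (I := 𝓡 m) p
  obtain ⟨r, hr, hrt⟩ := Metric.nhds_basis_closedBall.mem_iff.1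
    ((isOpen_extChartAt_target (I := 𝓡 m) p).mem_nhds ((extChartAt (𝓡 m) p).map_source hp))
  set W := (extChartAt (𝓡 m) p).source ∩ extChartAt (𝓡 m) p ⁻¹' Metric.ball (extChartAt (𝓡 m) p p) r
    with hW
  have hWo : IsOpen W := (continuousOn_extChartAt p).isOpen_inter_preimage
    (isOpen_extChartAt_source p) Metric.isOpen_ball
  refine ⟨W, hWo.mem_nhds ⟨hp, Metric.mem_ball_self hr⟩, ?_⟩
  have e : riemannianVolume g W = chartVolume g p W := by
    rw [← riemannianVolume_restrict hg p, Measure.restrict_apply hWo.measurableSet,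
      Set.inter_eq_left.2 Set.inter_subset_left]
  rw [e, chartVolume_apply g p hWo.measurableSet]
  have hi : IntegrableOn (volDensity g p) (Metric.closedBall (extChartAt (𝓡 m) p p) r) :=
    ((continuousOn_volDensity hg p).mono hrt).integrableOn_compact (isCompact_closedBall _ _)
  refine lt_of_le_of_lt (lintegral_mono_set ?_) hi.lintegral_lt_top
  rintro y ⟨hy, hy'⟩
  have := hy'.2
  rw [Set.mem_preimage, (extChartAt (𝓡 m) p).right_inv hy] at this
  exact Metric.ball_subset_closedBall this

end Volume

/-! ### The divergence theorem -/

section Divergence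

variable {m : ℕ} {X : Type*} [TopologicalSpace X] [ChartedSpace (Coord m) X]

theorem continuous_of_charts {f : X → ℝ} (K : X → Coord m → ℝ)
    (hK : ∀ p, ContinuousAt (K p) (extChartAt (𝓡 m) p p))
    (hf : ∀ p, ∀ x ∈ (extChartAt (𝓡 m) p).source, f x = K p (extChartAt (𝓡 m) p x)) :
    Continuous f := by
  rw [continuous_iff_continuousAt]
  intro p
  refine ((hK p).comp (continuousAt_extChartAt p)).congr ?_
  filter_upwards [(isOpen_extChartAt_source p).mem_nhds (mem_extChartAt_source (I := 𝓡 m) p)]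
    with x hx using (hf p x hx).symm

variable [IsManifold (𝓡 m) ∞ X]

theorem contDiffAt_comp_symm {f : X → ℝ} (hf : ContMDiff (𝓡 m) 𝓘(ℝ, ℝ) ∞ f) (p : X) {y : Coord m}
    (hy : y ∈ (extChartAt (𝓡 m) p).target) :
    ContDiffAt ℝ ∞ (f ∘ (extChartAt (𝓡 m) p).symm) y :=
  ((hf _).comp _ (contMDiffAt_symm p hy)).contDiffAt

variable {g : BilinField (m := m) X} (hg : IsSmoothMetric g)
include hg

theorem continuous_scalarCurvature : Continuous (scalarCurvature g) :=
  continuous_of_charts (fun p => scalarComp (metricComp g p))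
    (fun p => ((hg.isMetricOn p).contDiffAt_scalarComp
      ((extChartAt (𝓡 m) p).map_source (mem_extChartAt_source (I := 𝓡 m) p))).continuousAt)
    fun _ _ hx => scalarCurvature_eq hg hx

theorem continuous_laplaceBeltrami {f : X → ℝ} (hf : ContMDiff (𝓡 m) 𝓘(ℝ, ℝ) ∞ f) :
    Continuous (laplaceBeltrami g f) :=
  continuous_of_charts (fun p => laplaceComp (metricComp g p) (f ∘ (extChartAt (𝓡 m) p).symm))
    (fun p => by
      have hp := (extChartAt (𝓡 m) p).map_source (mem_extChartAt_source (I := 𝓡 m) p)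
      exact ((hg.isMetricOn p).contDiffAt_laplaceComp hp (contDiffAt_comp_symm hf p hp)).continuousAt)
    fun _ _ hx => laplaceBeltrami_eq hg hx hf

variable [MeasurableSpace X] [BorelSpace X]

/-- The Laplacian vanishes off the support of f, so the integral can be computed in the chart at p,
where the divergence theorem for compact support applies. -/
theorem integral_laplaceBeltrami_of_tsupport_subset [CompactSpace X] {f : X → ℝ}
    (hf : ContMDiff (𝓡 m) 𝓘(ℝ, ℝ) ∞ f) (p : X) (hs : tsupport f ⊆ (extChartAt (𝓡 m) p).source) :
    ∫ x, laplaceBeltrami g f x ∂riemannianVolume g = 0 := by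
  have h0 : ∀ x ∉ tsupport f, laplaceBeltrami g f x = 0 := by
    intro x hx
    have hx' : f ∘ (extChartAt (𝓡 m) x).symm =ᶠ[𝓝 (extChartAt (𝓡 m) x x)] fun _ => 0 := by
      have h1 : ∀ᶠ z in 𝓝 x, f z = 0 := by
        filter_upwards [(isClosed_tsupport f).isOpen_compl.mem_nhds hx] with z hz
          using image_eq_zero_of_notMem_tsupport hz
      have h2 := (continuousAt_extChartAt_symm (I := 𝓡 m) x)
      rw [ContinuousAt, extChartAt_to_inv] at h2
      exact h2.eventually h1
    rw [laplaceBeltrami, laplaceComp_congr EventuallyEq.rfl hx']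
    -- The empty case of additivity: the Laplacian of the zero function is zero.
    have := laplaceComp_sum (metricComp g x) (x := extChartAt (𝓡 m) x x) (∅ : Finset ℕ)
      (u := fun _ _ => 0) (by simp)
    simpa using this
  rw [integral_riemannianVolume hg p (continuous_laplaceBeltrami hg hf)
    fun x hx => h0 x fun h => hx (hs h)]
  have hK : IsCompact (extChartAt (𝓡 m) p '' tsupport f) :=
    (isClosed_tsupport f).isCompact.image_of_continuousOn ((continuousOn_extChartAt p).mono hs)
  have hKt : extChartAt (𝓡 m) p '' tsupport f ⊆ (extChartAt (𝓡 m) p).target := by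
    rintro _ ⟨x, hx, rfl⟩
    exact (extChartAt (𝓡 m) p).map_source (hs hx)
  rw [← (hg.isMetricOn p).setIntegral_laplaceComp hK hKt
    (u := f ∘ (extChartAt (𝓡 m) p).symm) (fun y hy => contDiffAt_comp_symm hf p hy) ?_]
  · refine setIntegral_congr_fun (measurableSet_target p) fun y hy => ?_
    have := laplaceBeltrami_eq hg ((extChartAt (𝓡 m) p).map_target hy) hf
    rw [(extChartAt (𝓡 m) p).right_inv hy] at this
    simp only [this]
    rfl
  · intro y hy hyK
    refine image_eq_zero_of_notMem_tsupport (f := f) fun h => hyK ?_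
    exact ⟨_, h, (extChartAt (𝓡 m) p).right_inv hy⟩

/-- The integral of a Laplacian over a closed manifold vanishes. -/
theorem integral_laplaceBeltrami [CompactSpace X] [T2Space X] {f : X → ℝ}
    (hf : ContMDiff (𝓡 m) 𝓘(ℝ, ℝ) ∞ f) :
    ∫ x, laplaceBeltrami g f x ∂riemannianVolume g = 0 := by
  have := isLocallyFiniteMeasure_riemannianVolume hg
  obtain ⟨t, ht⟩ := (isCompact_univ (X := X)).elim_finite_subcover
    (fun p => (extChartAt (𝓡 m) p).source) (fun p => isOpen_extChartAt_source p)
    fun x _ => Set.mem_iUnion.2 ⟨x, mem_extChartAt_source (I := 𝓡 m) x⟩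
  -- f is cut into finitely many pieces ρ f, each supported in one chart domain; the Laplacian is
  -- additive, so each piece can be integrated by itself.
  obtain ⟨ρ, hρ⟩ := SmoothPartitionOfUnity.exists_isSubordinate (𝓡 m) isClosed_univ
    (fun p : t => (extChartAt (𝓡 m) (p : X)).source) (fun p => isOpen_extChartAt_source (p : X))
    (by
      intro x hx
      obtain ⟨p, hp, hxp⟩ := Set.mem_iUnion₂.1 (ht hx)
      exact Set.mem_iUnion.2 ⟨⟨p, hp⟩, hxp⟩)
  have hs : ∀ p : t, ContMDiff (𝓡 m) 𝓘(ℝ, ℝ) ∞ fun x => ρ p x * f x := fun p =>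
    (ρ p).contMDiff.mul hf
  have hsum : ∀ x, ∑ p : t, ρ p x * f x = f x := by
    intro x
    have := ρ.sum_eq_one (Set.mem_univ x)
    rw [finsum_eq_sum_of_fintype] at this
    rw [← Finset.sum_mul, this, one_mul]
  have hL : ∀ x, laplaceBeltrami g f x = ∑ p : t, laplaceBeltrami g (fun x => ρ p x * f x) x := by
    intro x
    have hx := (extChartAt (𝓡 m) x).map_source (mem_extChartAt_source (I := 𝓡 m) x)
    have h := laplaceComp_sum (metricComp g x) (Finset.univ : Finset t)
      (u := fun p => (fun x => ρ p x * f x) ∘ (extChartAt (𝓡 m) x).symm)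
      fun p _ => contDiffAt_comp_symm (hs p) x hx
    refine Eq.trans ?_ h
    refine laplaceComp_congr EventuallyEq.rfl (Filter.Eventually.of_forall fun y => ?_)
    exact (hsum _).symm
  simp only [hL]
  rw [integral_finsetSum _ fun p _ =>
    (continuous_laplaceBeltrami hg (hs p)).integrable_of_hasCompactSupport
      (HasCompactSupport.of_compactSpace _)]
  refine Finset.sum_eq_zero fun p _ => integral_laplaceBeltrami_of_tsupport_subset hg (hs p) p ?_
  exact (tsupport_mul_subset_left).trans (hρ p)

end Divergence

end Willmore

namespace Willmore

open MeasureTheory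

/-! ### ### The integrated inequality and the normalizing constants -/

theorem sphereArea_pos {n : ℕ} (hn : 0 < n) : 0 < sphereArea n := by
  have : Nonempty (Fin n) := ⟨⟨0, hn⟩⟩
  rw [sphereArea, Measure.toSphere_real_apply_univ, finrank_euclideanSpace_fin]
  exact mul_pos (Nat.cast_pos.2 hn)
    (ENNReal.toReal_pos (Metric.measure_ball_pos _ _ one_pos).ne' measure_ball_lt_top.ne)

/-- The integrated inequality: `λ |Σ| ≤ ½ ∫ Sc - 1 / (2 (n - 1)) ∫ H²`. -/
theorem lam_mul_area_le {n : ℕ} (hn : 3 ≤ n)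
    {M : Type*} [TopologicalSpace M] [ChartedSpace (Coord n) M] [IsManifold (𝓡 n) ∞ M]
    {g : BilinField (m := n) M} (hg : IsSmoothMetric g) (hSc : ∀ q : M, 0 ≤ scalarCurvature g q)
    {S : Type*} [TopologicalSpace S] [T2Space S] [CompactSpace S] [Nonempty S]
    [ChartedSpace (Coord (n - 1)) S] [IsManifold (𝓡 (n - 1)) ∞ S]
    [MeasurableSpace S] [BorelSpace S]
    {ι : S → M} (hι : IsSmoothImmersion n ι)
    {ν : (p : S) → TangentSpace (𝓡 n) (ι p)} (hν : IsUnitNormal g ι ν)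
    {lam : ℝ} (hW : IsAreaConstrainedWillmore g ι ν lam)
    (hH : ∀ p : S, 0 < meanCurvature g ι ν p) :
    0 < area g ι ∧
    (∫ p, (scalarCurvature (inducedMetric g ι) p
        - ((n : ℝ) - 2) / ((n : ℝ) - 1) * meanCurvature g ι ν p ^ 2)
      ∂riemannianVolume (inducedMetric g ι)) = totalScalar g ι - ((n : ℝ) - 2) / ((n : ℝ) - 1)
        * ∫ p, meanCurvature g ι ν p ^ 2 ∂riemannianVolume (inducedMetric g ι) ∧
    lam * area g ι ≤ totalScalar g ι / 2
      - (∫ p, meanCurvature g ι ν p ^ 2 ∂riemannianVolume (inducedMetric g ι))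
        / (2 * ((n : ℝ) - 1)) := by
  have hm := hg.inducedMetric hι
  have hlf := isLocallyFiniteMeasure_riemannianVolume hm
  set μ := riemannianVolume (inducedMetric g ι) with hμ
  -- A locally finite measure on a compact space is finite; this makes the area a genuine number and
  -- the constant λ integrable.
  have hfin : IsFiniteMeasure μ := inferInstance
  have hsm := contMDiff_meanCurvature hg hι hν.1 hν.2.2
  have hlog : ContMDiff (𝓡 (n - 1)) 𝓘(ℝ, ℝ) ∞ fun q => Real.log (meanCurvature g ι ν q) :=
    fun p => (Real.contDiffAt_log.2 (hH p).ne').contMDiffAt.comp p (hsm p)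
  have hint : ∀ {f : S → ℝ}, Continuous f → Integrable f μ := fun hf =>
    hf.integrable_of_hasCompactSupport (HasCompactSupport.of_compactSpace _)
  have iS := hint (continuous_scalarCurvature hm)
  have iH : Integrable (fun p => meanCurvature g ι ν p ^ 2) μ := hint (hsm.continuous.pow 2)
  have iL := hint (continuous_laplaceBeltrami hm hlog)
  refine ⟨ENNReal.toReal_pos (riemannianVolume_univ_pos hm).ne' (measure_ne_top _ _), ?_, ?_⟩
  · rw [integral_sub iS (iH.const_mul _), integral_const_mul]
    rfl
  · have h := integral_mono ((integrable_const lam).add iL)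
      ((iS.div_const 2).sub (iH.div_const (2 * ((n : ℝ) - 1))))
      (fun p => laplaceBeltrami_log_le hn hg hι hSc hν.1 hν.2.1 hν.2.2 hW hH p)
    simp only [Pi.add_apply, Pi.sub_apply] at h
    rw [integral_add (integrable_const lam) iL, integral_laplaceBeltrami hm hlog,
      integral_sub (iS.div_const 2) (iH.div_const _), integral_div, integral_div,
      integral_const, add_zero, smul_eq_mul, mul_comm] at h
    exact h

/-- The bound of the normalized Willmore energy that controls the sign of `E_{n,2}`. -/
theorem normalized_willmore_eq {n : ℝ} (hn : 3 ≤ n) {A w W : ℝ} (hA : 0 < A) (hw : 0 < w) :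
    1 / ((n - 1) ^ 2 * w) * (w / A) ^ ((n - 3) / (n - 1)) * W
      = W / ((n - 1) ^ 2 * (w / A) ^ (2 / (n - 1)) * A) := by
  have hn1 : n - 1 ≠ 0 := by linarith
  -- The exponents (n-3)/(n-1) and 2/(n-1) add up to 1.
  have e : (w / A) ^ ((n - 3) / (n - 1)) * (w / A) ^ (2 / (n - 1)) = w / A := by
    rw [← Real.rpow_add (div_pos hw hA)]
    convert Real.rpow_one _ using 2
    field_simp
    ring
  have hp : (w / A) ^ (2 / (n - 1)) ≠ 0 := (Real.rpow_pos_of_pos (div_pos hw hA) _).ne'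
  rw [← eq_div_iff hp] at e
  rw [e]
  field_simp

end Willmore

end

/-! ### ### Signs of the two energies -/

theorem mainTheorem9 (n : ℕ) (hn : 3 ≤ n)
    {M : Type*} [TopologicalSpace M] [T2Space M] [SecondCountableTopology M]
    [ChartedSpace (EuclideanSpace ℝ (Fin n)) M] [IsManifold (𝓡 n) ∞ M]
    (g : Bundle.ContMDiffRiemannianMetric (𝓡 n) ∞ (EuclideanSpace ℝ (Fin n))
      (fun x : M => TangentSpace (𝓡 n) x))
    (hSc : ∀ q : M, 0 ≤ Willmore.scalarCurvature (Willmore.metricField g) q)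
    {S : Type*} [TopologicalSpace S] [T2Space S] [CompactSpace S] [Nonempty S]
    [ChartedSpace (EuclideanSpace ℝ (Fin (n - 1))) S] [IsManifold (𝓡 (n - 1)) ∞ S]
    [MeasurableSpace S] [BorelSpace S]
    (ι : S → M) (hι : Willmore.IsSmoothImmersion n ι)
    (ν : (p : S) → TangentSpace (𝓡 n) (ι p)) (hν : Willmore.IsUnitNormal (Willmore.metricField g) ι ν)
    (lam : ℝ) (hW : Willmore.IsAreaConstrainedWillmore (Willmore.metricField g) ι ν lam)
    (hH : ∀ p : S, 0 < Willmore.meanCurvature (Willmore.metricField g) ι ν p) :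
    (lam ≥ ((n : ℝ) - 3) / (2 * ((n : ℝ) - 2) * Willmore.area (Willmore.metricField g) ι)
          * Willmore.totalScalar (Willmore.metricField g) ι →
        0 ≤ Willmore.energyOne (Willmore.metricField g) ι ν) ∧
    (lam > ((n : ℝ) - 3) / (2 * ((n : ℝ) - 2) * Willmore.area (Willmore.metricField g) ι)
          * Willmore.totalScalar (Willmore.metricField g) ι →
        0 < Willmore.energyOne (Willmore.metricField g) ι ν) ∧
    (lam ≥ 1 / (2 * Willmore.area (Willmore.metricField g) ι) * Willmore.totalScalar (Willmore.metricField g) ι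
          - ((n : ℝ) - 1) / 2
            * (Willmore.sphereArea n / Willmore.area (Willmore.metricField g) ι) ^ (2 / ((n : ℝ) - 1)) →
        0 ≤ Willmore.energyTwo (Willmore.metricField g) ι ν) ∧
    (lam > 1 / (2 * Willmore.area (Willmore.metricField g) ι) * Willmore.totalScalar (Willmore.metricField g) ι
          - ((n : ℝ) - 1) / 2
            * (Willmore.sphereArea n / Willmore.area (Willmore.metricField g) ι) ^ (2 / ((n : ℝ) - 1)) →
        0 < Willmore.energyTwo (Willmore.metricField g) ι ν) := by
  have hg := Willmore.isSmoothMetric_metricField g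
  obtain ⟨hA, hE, hI⟩ := Willmore.lam_mul_area_le hn hg hSc hι hν hW hH
  have hw := Willmore.sphereArea_pos (n := n) (by omega)
  have hn' : (3 : ℝ) ≤ n := by exact_mod_cast hn
  have hn1 : (0 : ℝ) < n - 1 := by linarith
  have hn2 : (0 : ℝ) < n - 2 := by linarith
  simp only [Willmore.energyOne, Willmore.energyTwo]
  rw [hE, Willmore.normalized_willmore_eq hn' hA hw]
  set A := Willmore.area (Willmore.metricField g) ι
  set T := Willmore.totalScalar (Willmore.metricField g) ι
  set W := ∫ p, Willmore.meanCurvature (Willmore.metricField g) ι ν p ^ 2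
    ∂Willmore.riemannianVolume (Willmore.inducedMetric (Willmore.metricField g) ι)
  set w := Willmore.sphereArea n
  have hc : 0 < 1 / (2 * ((n : ℝ) - 1) * ((n : ℝ) - 2) * w) * (A / w) ^ (1 / ((n : ℝ) - 1)) := by
    have := Real.rpow_pos_of_pos (div_pos hA hw) (1 / ((n : ℝ) - 1))
    positivity
  have hd : 0 < 1 / 2 * (A / w) ^ (((n : ℝ) - 2) / ((n : ℝ) - 1)) := by
    have := Real.rpow_pos_of_pos (div_pos hA hw) (((n : ℝ) - 2) / ((n : ℝ) - 1))
    positivity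
  have hR : 0 < (w / A) ^ (2 / ((n : ℝ) - 1)) := Real.rpow_pos_of_pos (div_pos hw hA) _
  set R := (w / A) ^ (2 / ((n : ℝ) - 1))
  have hden : 0 < ((n : ℝ) - 1) ^ 2 * R * A := by positivity
  -- The integral in the first energy is a positive multiple of the defect in the integrated
  -- inequality plus |Σ| times the excess of λ over the first threshold.
  have e1 : T - ((n : ℝ) - 2) / ((n : ℝ) - 1) * W
      = 2 * ((n : ℝ) - 2) * ((T / 2 - W / (2 * ((n : ℝ) - 1)) - lam * A)
        + A * (lam - ((n : ℝ) - 3) / (2 * ((n : ℝ) - 2) * A) * T)) := by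
    field_simp
    ring
  -- The same decomposition for the second energy, whose sign is that of (n-1)² R |Σ| - ∫H²; here
  -- ∫Sc^Σ cancels altogether.
  have e2 : ((n : ℝ) - 1) ^ 2 * R * A - W
      = 2 * ((n : ℝ) - 1) * ((T / 2 - W / (2 * ((n : ℝ) - 1)) - lam * A)
        + A * (lam - (1 / (2 * A) * T - ((n : ℝ) - 1) / 2 * R))) := by
    field_simp
    ring
  have hI' := sub_nonneg.2 hI
  refine ⟨fun h => mul_nonneg hc.le ?_, fun h => mul_pos hc ?_, fun h => mul_nonneg hd.le ?_,
    fun h => mul_pos hd ?_⟩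
  · rw [e1]
    exact mul_nonneg (by positivity) (add_nonneg hI' (mul_nonneg hA.le (sub_nonneg.2 h)))
  · rw [e1]
    exact mul_pos (by positivity) (add_pos_of_nonneg_of_pos hI' (mul_pos hA (sub_pos.2 h)))
  · rw [sub_nonneg, div_le_one hden, ← sub_nonneg, e2]
    exact mul_nonneg (by positivity) (add_nonneg hI' (mul_nonneg hA.le (sub_nonneg.2 h)))
  · rw [sub_pos, div_lt_one hden, ← sub_pos, e2]
    exact mul_pos (by positivity) (add_pos_of_nonneg_of_pos hI' (mul_pos hA (sub_pos.2 h)))
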